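/- Let $X$ be a (not necessarily connected) scheme on which $2$ is invertible and such that $\mathrm{H}^1_{\text{ét}}(X,\mathbb{Z}/2\mathbb{Z})=0$, and let $\mathcal{P}$ be a locally free $\mathcal{O}_X$-module of constant rank $2$. An involution of the sheaf of $\mathcal{O}_X$-algebras $A=\mathcal{E}\!\mathit{nd}(\mathcal{P})$ is an $\mathcal{O}_X$-linear map $\sigma:A\to A$ with $\sigma\circ\sigma=\mathrm{id}$ and $\sigma(ab)=\sigma(b)\sigma(a)$ on sections. For $x\in X$ let $\sigma_x$ be the induced involution of the fibre $A(x)=A_x\otimes_{\mathcal{O}_{X,x}}\kappa(x)$; $\sigma$ is called orthogonal (respectively symplectic) if for every $x\in X$ the $\kappa(x)$-vector space $\{\sigma_x(a)-a : a\in A(x)\}$ has dimension $\tfrac12 n(n-1)=1$ (respectively $\tfrac12 n(n+1)=3$), where $n=2$ is the degree of $A$. (1) If $\mathcal{E}\!\mathit{nd}(\mathcal{P})$ admits an orthogonal involution, then $\mathcal{P}\cong\mathcal{L}_1\oplus\mathcal{L}_2$ for some line bundles $\mathcal{L}_1,\mathcal{L}_2$ on $X$. (2) In particular, if $\mathcal{P}$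 is indecomposable (that is, $\mathcal{P}$ is nonzero and is not isomorphic to a direct sum of two nonzero $\mathcal{O}_X$-modules), then $\mathcal{E}\!\mathit{nd}(\mathcal{P})$ carries a symplectic involution but no orthogonal involution. -/

import Mathlib

open CategoryTheory CategoryTheory.Limits TopologicalSpace Opposite AlgebraicGeometry

universe u

namespace AlgebraicGeometry.Scheme.Modules



variable {X : Scheme.{u}}

/-- The ring of endomorphisms of the `𝒪_U`-module `P|_U`: families of `Γ(X, V)`-linear
endomorphisms of `Γ(P, V)` for `V ⊆ U` open, compatible with restriction. -/
noncomputable def localEnd (P : X.Modules) (U : X.Opens) :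
    Subring (∀ V : {V : X.Opens // V ≤ U}, Module.End Γ(X, V.1) Γ(P, V.1)) where
  carrier := {f | ∀ (V W : {V : X.Opens // V ≤ U}) (i : W.1 ⟶ V.1) (s : Γ(P, V.1)),
    f W (P.presheaf.map i.op s) = P.presheaf.map i.op (f V s)}
  mul_mem' {f g} hf hg V W i s := by
    simp only [Pi.mul_apply, Module.End.mul_apply, hg V W i, hf V W i]
  one_mem' V W i s := rfl
  add_mem' {f g} hf hg V W i s := by
    simp only [Pi.add_apply, LinearMap.add_apply, hg V W i, hf V W i, map_add]
  zero_mem' V W i s := by simp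
  neg_mem' {f} hf V W i s := by
    simp only [Pi.neg_apply, LinearMap.neg_apply, hf V W i, map_neg]

/-- Multiplication by the sections of `𝒪_X`. -/
noncomputable def localEndScalar (P : X.Modules) (U : X.Opens) : Γ(X, U) →+* localEnd P U where
  toFun r := ⟨fun V ↦ algebraMap Γ(X, V.1) (Module.End Γ(X, V.1) Γ(P, V.1))
      (X.presheaf.map (homOfLE V.2).op r), fun V W i s ↦ by
    simp only [Module.algebraMap_end_apply]
    rw [Modules.map_smul, ← ConcreteCategory.comp_apply, ← Functor.map_comp]
    rfl⟩
  map_one' := by ext; simp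
  map_mul' a b := by ext; simp
  map_zero' := by ext; simp
  map_add' a b := by ext; simp

noncomputable instance localEndAlgebra (P : X.Modules) (U : X.Opens) : Algebra Γ(X, U) (localEnd P U) :=
  (localEndScalar P U).toAlgebra' fun r f ↦ by
    ext V s
    simp [localEndScalar]

/-- Restriction of local endomorphisms to a smaller open. -/
noncomputable def localEndRes (P : X.Modules) {U U' : X.Opens} (h : U' ≤ U) :
    localEnd P U →+* localEnd P U' where
  toFun f := ⟨fun V ↦ f.1 ⟨V.1, V.2.trans h⟩, fun V W i s ↦
    f.2 ⟨V.1, V.2.trans h⟩ ⟨W.1, W.2.trans h⟩ i s⟩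
  map_one' := rfl
  map_mul' _ _ := rfl
  map_zero' := rfl
  map_add' _ _ := rfl

/-- The abelian presheaf `U ↦ End(P|_U)`. -/
noncomputable def endPresheaf (P : X.Modules) : TopCat.Presheaf Ab.{u} X where
  obj U := AddCommGrpCat.of (localEnd P U.unop)
  map i := AddCommGrpCat.ofHom (localEndRes P i.unop.le).toAddMonoidHom

lemma endPresheaf_isSheaf (P : X.Modules) : (endPresheaf P).IsSheaf := by
  rw [TopCat.Presheaf.isSheaf_iff_isSheafUniqueGluing]
  intro ι U sf hsf
  let F : TopCat.Sheaf Ab.{u} X := ⟨P.presheaf, P.isSheaf⟩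
  have res {A B C : X.Opens} (i : B ⟶ A) (j : C ⟶ B) (s : Γ(P, A)) :
      P.presheaf.map j.op (P.presheaf.map i.op s) = P.presheaf.map (j ≫ i).op s := by
    rw [← ConcreteCategory.comp_apply, ← Functor.map_comp]; rfl
  let f (i : ι) : localEnd P (U i) := sf i
  have hf (i j : ι) (W : X.Opens) (hi : W ≤ U i) (hj : W ≤ U j) :
      (f i).1 ⟨W, hi⟩ = (f j).1 ⟨W, hj⟩ :=
    congr_fun (congr_arg Subtype.val (congr_arg (localEndRes P (le_inf hi hj)) (hsf i j)))
      ⟨W, le_rfl⟩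
  have cov (V : {V : X.Opens // V ≤ iSup U}) : V.1 ≤ ⨆ i, V.1 ⊓ U i := by
    rw [← inf_iSup_eq]; exact le_inf le_rfl V.2
  have ext' (V : {V : X.Opens // V ≤ iSup U}) (s t : Γ(P, V.1))
      (h : ∀ i, P.presheaf.map (homOfLE (inf_le_left : V.1 ⊓ U i ≤ V.1)).op s =
        P.presheaf.map (homOfLE (inf_le_left : V.1 ⊓ U i ≤ V.1)).op t) : s = t :=
    F.eq_of_locally_eq' (fun i ↦ V.1 ⊓ U i) V.1 (fun i ↦ homOfLE inf_le_left) (cov V) s t h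
  have ex (V : {V : X.Opens // V ≤ iSup U}) (s : Γ(P, V.1)) : ∃ t : Γ(P, V.1), ∀ i,
      P.presheaf.map (homOfLE (inf_le_left : V.1 ⊓ U i ≤ V.1)).op t =
        (f i).1 ⟨V.1 ⊓ U i, inf_le_right⟩
          (P.presheaf.map (homOfLE (inf_le_left : V.1 ⊓ U i ≤ V.1)).op s) := by
    refine (F.existsUnique_gluing' (fun i ↦ V.1 ⊓ U i) V.1 (fun i ↦ homOfLE inf_le_left) (cov V)
      (fun i ↦ (f i).1 ⟨V.1 ⊓ U i, inf_le_right⟩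
          (P.presheaf.map (homOfLE (inf_le_left : V.1 ⊓ U i ≤ V.1)).op s)) ?_).exists
    intro i j
    have hi : (V.1 ⊓ U i) ⊓ (V.1 ⊓ U j) ≤ U i := inf_le_left.trans inf_le_right
    have hj : (V.1 ⊓ U i) ⊓ (V.1 ⊓ U j) ≤ U j := inf_le_right.trans inf_le_right
    have h1 := (f i).2 ⟨V.1 ⊓ U i, inf_le_right⟩ ⟨_, hi⟩ (Opens.infLELeft _ _)
      (P.presheaf.map (homOfLE (inf_le_left : V.1 ⊓ U i ≤ V.1)).op s)
    have h2 := (f j).2 ⟨V.1 ⊓ U j, inf_le_right⟩ ⟨_, hj⟩ (Opens.infLERight _ _)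
      (P.presheaf.map (homOfLE (inf_le_left : V.1 ⊓ U j ≤ V.1)).op s)
    refine h1.symm.trans (Eq.trans ?_ h2)
    rw [hf i j _ hi hj, res, res]
    rfl
  choose g hg using ex
  have uniq (V : {V : X.Opens // V ≤ iSup U}) (s t : Γ(P, V.1))
      (h : ∀ i, P.presheaf.map (homOfLE (inf_le_left : V.1 ⊓ U i ≤ V.1)).op t =
        (f i).1 ⟨V.1 ⊓ U i, inf_le_right⟩
          (P.presheaf.map (homOfLE (inf_le_left : V.1 ⊓ U i ≤ V.1)).op s)) : t = g V s :=
    ext' V _ _ fun i ↦ (h i).trans (hg V s i).symm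
  have gnat (V W : {V : X.Opens // V ≤ iSup U}) (k : W.1 ⟶ V.1) (s : Γ(P, V.1)) :
      g W (P.presheaf.map k.op s) = P.presheaf.map k.op (g V s) := by
    refine (uniq W _ _ fun i ↦ ?_).symm
    have hk : W.1 ⊓ U i ≤ V.1 ⊓ U i := inf_le_inf_right _ k.le
    have := (f i).2 ⟨V.1 ⊓ U i, inf_le_right⟩ ⟨W.1 ⊓ U i, inf_le_right⟩ (homOfLE hk)
      (P.presheaf.map (homOfLE (inf_le_left : V.1 ⊓ U i ≤ V.1)).op s)
    rw [res] at this ⊢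
    rw [res]
    refine Eq.trans ?_ this.symm
    rw [← hg V s i, res]
    rfl
  let G : localEnd P (iSup U) := ⟨fun V ↦
    { toFun := g V
      map_add' := fun a b ↦ (uniq V _ _ fun i ↦ by simp only [map_add, hg]).symm
      map_smul' := fun r a ↦ (uniq V _ _ fun i ↦ by
        simp only [Modules.map_smul, hg, _root_.map_smul, RingHom.id_apply]).symm }, gnat⟩
  refine ⟨G, fun i ↦ ?_, fun G' hG' ↦ ?_⟩
  · refine Subtype.ext (funext fun V ↦ LinearMap.ext fun s ↦ ?_)
    refine (uniq ⟨V.1, V.2.trans (le_iSup U i)⟩ s ((f i).1 V s) fun j ↦ ?_).symm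
    rw [hf j i (V.1 ⊓ U j) inf_le_right (inf_le_left.trans V.2)]
    exact ((f i).2 V ⟨V.1 ⊓ U j, inf_le_left.trans V.2⟩ (homOfLE inf_le_left) s).symm
  · refine Subtype.ext (funext fun V ↦ LinearMap.ext fun s ↦ ?_)
    let G'' : localEnd P (iSup U) := G'
    refine uniq V s (G''.1 V s) fun i ↦ ?_
    have h1 : G''.1 ⟨V.1 ⊓ U i, inf_le_left.trans V.2⟩ = (f i).1 ⟨V.1 ⊓ U i, inf_le_right⟩ :=
      congr_fun (congr_arg Subtype.val (hG' i)) ⟨V.1 ⊓ U i, inf_le_right⟩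
    rw [← h1]
    exact (G''.2 V ⟨V.1 ⊓ U i, inf_le_left.trans V.2⟩ (homOfLE inf_le_left) s).symm

noncomputable instance endPresheafModule (P : X.Modules) (U : X.Opensᵒᵖ) :
    Module (X.ringCatSheaf.obj.obj U) ((endPresheaf P).obj U) :=
  inferInstanceAs (Module Γ(X, U.unop) (localEnd P U.unop))

/-- The sheaf of endomorphisms of an `𝒪_X`-module, as an `𝒪_X`-module. -/
noncomputable def sheafEnd (P : X.Modules) : X.Modules where
  val := PresheafOfModules.ofPresheaf (endPresheaf P) fun U V i r f ↦ by
    refine Subtype.ext (funext fun W ↦ LinearMap.ext fun s ↦ ?_)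
    let r' : Γ(X, U.unop) := r
    let f' : localEnd P U.unop := f
    have h : X.presheaf.map (homOfLE W.2).op (X.presheaf.map i r') =
        X.presheaf.map (homOfLE (W.2.trans i.unop.le)).op r' := by
      rw [← ConcreteCategory.comp_apply, ← Functor.map_comp]
      rfl
    exact (congr_arg (· • f'.1 ⟨W.1, W.2.trans i.unop.le⟩ s) h).symm
  isSheaf := endPresheaf_isSheaf P

/-- Sections of `End(P)` form a ring under composition. -/
noncomputable instance sheafEndRing (P : X.Modules) (U : X.Opens) : Ring Γ(sheafEnd P, U) :=
  inferInstanceAs (Ring (localEnd P U))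


noncomputable instance sheafEndAlgebra (P : X.Modules) (U : X.Opens) : Algebra Γ(X, U) Γ(sheafEnd P, U) :=
  inferInstanceAs (Algebra Γ(X, U) (localEnd P U))

noncomputable instance stalkModule (M : X.Modules) (x : X) :
    Module (X.presheaf.stalk x) (M.presheaf.stalk x) :=
  PresheafOfModules.instModuleCarrierStalkCommRingCatCarrierAbPresheafOpensCarrier
    (R := X.presheaf) M.val x

lemma germ_smul (M : X.Modules) (x : X) (U : X.Opens) (hx : x ∈ U) (r : Γ(X, U)) (m : Γ(M, U)) :
    M.presheaf.germ U x hx (r • m) = X.presheaf.germ U x hx r • M.presheaf.germ U x hx m :=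
  PresheafOfModules.germ_smul (R := X.presheaf) M.val x U hx r m

/-- The map induced on stalks by a morphism of `𝒪_X`-modules. -/
noncomputable def stalkMap {M N : X.Modules} (φ : M ⟶ N) (x : X) :
    M.presheaf.stalk x →ₗ[X.presheaf.stalk x] N.presheaf.stalk x where
  toFun := (TopCat.Presheaf.stalkFunctor Ab.{u} x).map φ.mapPresheaf
  map_add' := map_add _
  map_smul' r m := by
    obtain ⟨U, hU, r, rfl⟩ := TopCat.Presheaf.exists_germ_eq X.presheaf r
    obtain ⟨V, hV, m, rfl⟩ := TopCat.Presheaf.exists_germ_eq M.presheaf m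
    have hW : x ∈ U ⊓ V := ⟨hU, hV⟩
    rw [← TopCat.Presheaf.germ_res_apply X.presheaf (Opens.infLELeft U V) x hW r,
      ← TopCat.Presheaf.germ_res_apply M.presheaf (Opens.infLERight U V) x hW m, ← germ_smul,
      TopCat.Presheaf.stalkFunctor_map_germ_apply, TopCat.Presheaf.stalkFunctor_map_germ_apply,
      mapPresheaf_app, Hom.app_smul, germ_smul]
    rfl

/-- The fibre `M(x) = κ(x) ⊗ M_x` of an `𝒪_X`-module at a point. -/
abbrev fibre (M : X.Modules) (x : X) : Type u :=
  TensorProduct (X.presheaf.stalk x) (IsLocalRing.ResidueField (X.presheaf.stalk x))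
    (M.presheaf.stalk x)

/-- The `κ(x)`-linear map induced on fibres by a morphism of `𝒪_X`-modules. -/
noncomputable def fibreMap {M N : X.Modules} (φ : M ⟶ N) (x : X) :
    M.fibre x →ₗ[IsLocalRing.ResidueField (X.presheaf.stalk x)] N.fibre x :=
  (stalkMap φ x).baseChange _

/-- `M` is locally free of constant rank `n`. -/
def IsLocallyFreeOfRank (M : X.Modules) (n : ℕ) : Prop :=
  ∀ x : X, ∃ U : X.Opens, x ∈ U ∧
    Nonempty (M.restrict U.ι ≅
      (SheafOfModules.free (R := (U : Scheme.{u}).ringCatSheaf) (ULift.{u} (Fin n)) :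
        (U : Scheme.{u}).Modules))

/-- An involution (of the first kind) of the `𝒪_X`-algebra `End(P)`: an `𝒪_X`-linear
endomorphism of order dividing two which reverses products. -/
structure EndInvolution (P : X.Modules) where
  /-- the underlying morphism of `𝒪_X`-modules -/
  hom : sheafEnd P ⟶ sheafEnd P
  hom_comp_hom : hom ≫ hom = 𝟙 (sheafEnd P)
  hom_app_mul (U : X.Opens) (a b : Γ(sheafEnd P, U)) :
    hom.app U (a * b) = hom.app U b * hom.app U a

namespace EndInvolution

variable {P : X.Modules}

/-- The `κ(x)`-dimension of `{σ(a) - a | a ∈ A(x)}`, where `A = End(P)`. -/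
noncomputable def skewDim (σ : P.EndInvolution) (x : X) : ℕ :=
  Module.finrank (IsLocalRing.ResidueField (X.presheaf.stalk x))
    (LinearMap.range (fibreMap σ.hom x - LinearMap.id))

/-- For `End(P)` of degree `n`: the involution is orthogonal at every point. -/
def IsOrthogonal (n : ℕ) (σ : P.EndInvolution) : Prop :=
  ∀ x : X, σ.skewDim x = n * (n - 1) / 2

/-- For `End(P)` of degree `n`: the involution is symplectic at every point. -/
def IsSymplectic (n : ℕ) (σ : P.EndInvolution) : Prop :=
  ∀ x : X, σ.skewDim x = n * (n + 1) / 2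

end EndInvolution

end AlgebraicGeometry.Scheme.Modules

/-- The étale cohomology group `H^n_ét(X, A)` of the constant sheaf associated with `A`. -/
noncomputable abbrev AlgebraicGeometry.Scheme.EtaleCohomology (X : Scheme.{u})
    (A : AddCommGrpCat.{u}) (n : ℕ) : Type u :=
  ((constantSheaf X.smallEtaleTopology AddCommGrpCat.{u}).obj A).H n

/-! An orthogonal involution in degree two has, in every fibre, a one-dimensional space of skew
elements. As 2 is invertible, `a ↦ (a - σ a) / 2` is a projection onto the skew elements, so these
form a line subbundle of `End(P)`, locally generated by some `m`. Comparing `m` with `σ m = -m`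
through the trace, which `σ` preserves, shows that `m` is traceless and that `m * m` is a unit
scalar `d` (`MatrixInvolution.exists_mul_self_eq_algebraMap`).

Thus the skew line bundle carries a nowhere degenerate quadratic form, and its trivialisations by a
generator of square one form a `μ₂`-torsor for the étale topology. Since 2 is invertible, `μ₂` is
the constant sheaf `ℤ/2`, so the torsor is trivial by the hypothesis on `H¹`. Concretely, if the
generators satisfy `mᵢ mⱼ = qᵢⱼ` on overlaps, then `exists_sqrt_sections` gives `sᵢ` with `sᵢ² = dᵢ`
and `sᵢ sⱼ = qᵢⱼ`: square roots `tᵢ` of `dᵢ` exist on étale covers, the signs `qᵢⱼ / (tᵢ tⱼ)` form a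
cocycle, and splitting it corrects the `tᵢ` so that they descend. The bridge from derived functor
cohomology to cocycles is `exists_eq_coboundary`.

The sections `mᵢ / sᵢ` glue to a global traceless `u` with `u * u = 1`. Its eigenprojections `(1 ±
u) / 2` have trace one, so their images are line bundles with sum `P`.

A symplectic involution exists on `End(P)` without any cohomological condition: locally it is the
adjugate `a ↦ tr(a) - a`. An indecomposable `P` has no splitting into two line bundles, hence no
orthogonal involution. -/

namespace CategoryTheory.CechDescent

-- Vanishing of `H¹` makes Čech 1-cocycles coboundaries.

universe w v' u'

variable {C : Type u'} [Category.{v'} C]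

section

variable [HasBinaryProducts C]

/-- The presheaf `V ↦ ∏ₖ F(V × Aₖ)`. -/
noncomputable def prodFamily (F : Cᵒᵖ ⥤ AddCommGrpCat.{w}) {κ : Type w} (A : κ → C) :
    Cᵒᵖ ⥤ AddCommGrpCat.{w} where
  obj V := AddCommGrpCat.of (∀ k, F.obj (op (V.unop ⨯ A k)))
  map f := AddCommGrpCat.ofHom (AddMonoidHom.mk'
    (fun ξ k ↦ F.map (prod.map f.unop (𝟙 (A k))).op (ξ k)) fun a b ↦ by ext k; simp)
  map_id V := by
    ext ξ k
    change F.map (prod.map (𝟙 V.unop) (𝟙 (A k))).op (ξ k) = ξ k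
    simp
  map_comp f g := by
    ext ξ k
    change F.map (prod.map (g.unop ≫ f.unop) (𝟙 (A k))).op (ξ k) =
      F.map (prod.map g.unop (𝟙 (A k))).op (F.map (prod.map f.unop (𝟙 (A k))).op (ξ k))
    rw [← ConcreteCategory.comp_apply, ← Functor.map_comp, ← op_comp]
    simp

namespace prodFamily

variable {F : Cᵒᵖ ⥤ AddCommGrpCat.{w}} {κ : Type w} {A : κ → C}

/-- The restriction of the `k`-th component along `(v, a) : Z ⟶ V × Aₖ`. -/
noncomputable def ev {V : C} (ξ : (prodFamily F A).obj (op V)) (k : κ) {Z : C}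
    (v : Z ⟶ V) (a : Z ⟶ A k) : F.obj (op Z) :=
  F.map (prod.lift v a).op ((show ∀ k, F.obj (op (V ⨯ A k)) from ξ) k)

lemma ev_map {V W : C} (f : W ⟶ V) (ξ : (prodFamily F A).obj (op V)) (k : κ) {Z : C}
    (v : Z ⟶ W) (a : Z ⟶ A k) :
    ev ((prodFamily F A).map f.op ξ) k v a = ev ξ k (v ≫ f) a := by
  have : prod.lift (v ≫ f) a = prod.lift v a ≫ prod.map f (𝟙 _) := by simp
  unfold ev
  rw [this, op_comp, Functor.map_comp, ConcreteCategory.comp_apply]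
  rfl

lemma map_ev {V : C} (ξ : (prodFamily F A).obj (op V)) (k : κ) {Z Z' : C} (z : Z' ⟶ Z)
    (v : Z ⟶ V) (a : Z ⟶ A k) :
    F.map z.op (ev ξ k v a) = ev ξ k (z ≫ v) (z ≫ a) := by
  unfold ev
  rw [← ConcreteCategory.comp_apply, ← Functor.map_comp, ← op_comp, prod.comp_lift]

lemma ev_add {V : C} (ξ η : (prodFamily F A).obj (op V)) (k : κ) {Z : C}
    (v : Z ⟶ V) (a : Z ⟶ A k) : ev (ξ + η) k v a = ev ξ k v a + ev η k v a :=
  map_add (F.map (prod.lift v a).op).hom _ _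

lemma ev_zero {V : C} (k : κ) {Z : C} (v : Z ⟶ V) (a : Z ⟶ A k) :
    ev (0 : (prodFamily F A).obj (op V)) k v a = 0 :=
  map_zero (F.map (prod.lift v a).op).hom

lemma ev_neg {V : C} (ξ : (prodFamily F A).obj (op V)) (k : κ) {Z : C}
    (v : Z ⟶ V) (a : Z ⟶ A k) : ev (-ξ) k v a = -ev ξ k v a :=
  map_neg (F.map (prod.lift v a).op).hom _

lemma ext {V : C} {ξ η : (prodFamily F A).obj (op V)}
    (h : ∀ k (Z : C) (v : Z ⟶ V) (a : Z ⟶ A k), ev ξ k v a = ev η k v a) : ξ = η := by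
  funext k
  have := h k _ prod.fst prod.snd
  simpa [ev] using this

/-- Constructor for sections of `prodFamily`. -/
def mk {V : C} (ξ : ∀ k, F.obj (op (V ⨯ A k))) : (prodFamily F A).obj (op V) := ξ

lemma ev_mk {V : C} (ξ : ∀ k, F.obj (op (V ⨯ A k))) (k : κ) {Z : C}
    (v : Z ⟶ V) (a : Z ⟶ A k) : ev (mk ξ) k v a = F.map (prod.lift v a).op (ξ k) := rfl

end prodFamily

end

variable {J : GrothendieckTopology C}

lemma isSheaf_forget {F : Cᵒᵖ ⥤ AddCommGrpCat.{w}} (hF : Presheaf.IsSheaf J F) :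
    Presieve.IsSheaf J (F ⋙ forget AddCommGrpCat.{w}) :=
  (isSheaf_iff_isSheaf_of_type _ _).1 (Presheaf.isSheaf_comp_of_isSheaf _ _ _ hF)

lemma isSheaf_of_forget {F : Cᵒᵖ ⥤ AddCommGrpCat.{w}}
    (hF : Presieve.IsSheaf J (F ⋙ forget AddCommGrpCat.{w})) : Presheaf.IsSheaf J F :=
  Presheaf.isSheaf_of_isSheaf_comp _ _ (forget AddCommGrpCat.{w})
    ((isSheaf_iff_isSheaf_of_type _ _).2 hF)

lemma eq_of_locally_eq {F : Cᵒᵖ ⥤ AddCommGrpCat.{w}} (hF : Presheaf.IsSheaf J F) {V : C}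
    {S : Sieve V} (hS : S ∈ J V) (s t : F.obj (op V))
    (h : ∀ ⦃W⦄ (f : W ⟶ V), S f → F.map f.op s = F.map f.op t) : s = t :=
  ((isSheaf_forget hF).isSeparated S hS).ext fun _ f hf ↦ h f hf

lemma exists_glue {F : Cᵒᵖ ⥤ AddCommGrpCat.{w}} (hF : Presheaf.IsSheaf J F) {V : C}
    {S : Sieve V} (hS : S ∈ J V) (x : ∀ ⦃W⦄ (f : W ⟶ V), S f → F.obj (op W))
    (hx : ∀ ⦃W W'⦄ (f : W ⟶ V) (hf : S f) (g : W' ⟶ W),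
      F.map g.op (x f hf) = x (g ≫ f) (S.downward_closed hf g)) :
    ∃ s : F.obj (op V), ∀ ⦃W⦄ (f : W ⟶ V) (hf : S f), F.map f.op s = x f hf := by
  let y : Presieve.FamilyOfElements (F ⋙ forget AddCommGrpCat.{w}) S.arrows := fun W f hf ↦ x f hf
  have hy : y.SieveCompatible := fun W W' f g hf ↦ (hx f hf g).symm
  obtain ⟨t, ht, -⟩ := (isSheaf_forget hF) S hS y
    ((Presieve.compatible_iff_sieveCompatible _).2 hy)
  exact ⟨t, fun W f hf ↦ ht f hf⟩

lemma isSheaf_of_glue {F : Cᵒᵖ ⥤ AddCommGrpCat.{w}}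
    (h1 : ∀ {V : C} {S : Sieve V} (_ : S ∈ J V) (s t : F.obj (op V))
      (_ : ∀ ⦃W⦄ (f : W ⟶ V), S f → F.map f.op s = F.map f.op t), s = t)
    (h2 : ∀ {V : C} {S : Sieve V} (_ : S ∈ J V) (x : ∀ ⦃W⦄ (f : W ⟶ V), S f → F.obj (op W))
      (_ : ∀ ⦃W W'⦄ (f : W ⟶ V) (hf : S f) (g : W' ⟶ W),
        F.map g.op (x f hf) = x (g ≫ f) (S.downward_closed hf g)),
      ∃ s : F.obj (op V), ∀ ⦃W⦄ (f : W ⟶ V) (hf : S f), F.map f.op s = x f hf) :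
    Presheaf.IsSheaf J F := by
  refine isSheaf_of_forget fun V S hS x hx ↦ ?_
  rw [Presieve.compatible_iff_sieveCompatible] at hx
  obtain ⟨s, hs⟩ := h2 hS (fun W f hf ↦ x f hf) fun W W' f hf g ↦ (hx f g hf).symm
  exact ⟨s, fun W f hf ↦ hs f hf, fun t ht ↦ h1 hS _ _ fun W f hf ↦
    (ht f hf).trans (hs f hf).symm⟩

variable [HasBinaryProducts C]

open prodFamily

/-- A covering sieve of `V` pulls back along the first projection to a covering sieve of each `V ⨯ A
k`, so every factor `F(- ⨯ A k)` is itself a sheaf. -/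
lemma isSheaf_prodFamily {F : Cᵒᵖ ⥤ AddCommGrpCat.{w}} (hF : Presheaf.IsSheaf J F)
    {κ : Type w} (A : κ → C) : Presheaf.IsSheaf J (prodFamily F A) := by
  refine isSheaf_of_glue (fun {V S} hS s t h ↦ ?_) (fun {V S} hS x hx ↦ ?_)
  · refine prodFamily.ext fun k Z v a ↦ eq_of_locally_eq hF (J.pullback_stable v hS) _ _
      fun W f hf ↦ ?_
    have := congr_arg (fun ξ ↦ ev ξ k (𝟙 _) (f ≫ a)) (h (f ≫ v) hf)
    simpa only [ev_map, Category.id_comp, map_ev] using this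
  · have hc {W : C} {f f' : W ⟶ V} (h : f = f') (hf : S f) (hf' : S f') : x f hf = x f' hf' := by
      subst h; rfl
    have key (k : κ) : ∃ y : F.obj (op (V ⨯ A k)), ∀ ⦃W⦄ (f : W ⟶ V ⨯ A k)
        (hf : S (f ≫ prod.fst)), F.map f.op y = ev (x (f ≫ prod.fst) hf) k (𝟙 W) (f ≫ prod.snd) := by
      refine exists_glue hF (J.pullback_stable prod.fst hS)
        (fun W f hf ↦ ev (x (f ≫ prod.fst) hf) k (𝟙 W) (f ≫ prod.snd)) fun W W' f hf g ↦ ?_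
      have h := hx (f ≫ prod.fst) hf g
      refine (map_ev _ _ _ _ _).trans ?_
      refine Eq.trans ?_ (congr_arg (fun ξ ↦ ev ξ k (𝟙 W') ((g ≫ f) ≫ prod.snd))
        (h.trans (hc (Category.assoc g f prod.fst).symm _ _)))
      rw [ev_map, Category.comp_id, Category.id_comp, Category.assoc]
    choose y hy using key
    refine ⟨mk y, fun W f hf ↦ prodFamily.ext fun k Z v a ↦ ?_⟩
    rw [ev_map, ev_mk]
    have h1 : S (prod.lift (v ≫ f) a ≫ prod.fst) := by
      rw [prod.lift_fst]; exact S.downward_closed hf v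
    rw [hy k _ h1]
    have h2 := hx f hf v
    rw [hc (prod.lift_fst _ _) h1 (S.downward_closed hf v), ← h2, ev_map, prod.lift_snd, Category.id_comp]

variable {ι : Type w} (U : ι → C)

/-- The condition for a section of `V ↦ ∏ F(V × (Uᵢ × Uⱼ))` to be an alternating `1`-cocycle. -/
def IsCechCocycle {F : Cᵒᵖ ⥤ AddCommGrpCat.{w}} {V : C}
    (η : (prodFamily F fun p : ι × ι ↦ U p.1 ⨯ U p.2).obj (op V)) : Prop :=
  ∀ (i j k : ι) (Z : C) (v : Z ⟶ V) (a : Z ⟶ U i) (b : Z ⟶ U j) (c : Z ⟶ U k),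
    ev η (i, j) v (prod.lift a b) + ev η (j, k) v (prod.lift b c) =
      ev η (i, k) v (prod.lift a c)

variable {U}

lemma IsCechCocycle.map {F : Cᵒᵖ ⥤ AddCommGrpCat.{w}} {V W : C} (f : W ⟶ V)
    {η : (prodFamily F fun p : ι × ι ↦ U p.1 ⨯ U p.2).obj (op V)} (hη : IsCechCocycle U η) :
    IsCechCocycle U ((prodFamily F fun p : ι × ι ↦ U p.1 ⨯ U p.2).map f.op η) := by
  intro i j k Z v a b c
  simp only [ev_map]
  exact hη i j k Z _ a b c

variable (U)

/-- The subgroup of `1`-cocycles for the family `U`. -/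
noncomputable def cechCocycleSubgroup (F : Cᵒᵖ ⥤ AddCommGrpCat.{w}) (V : C) :
    AddSubgroup ((prodFamily F fun p : ι × ι ↦ U p.1 ⨯ U p.2).obj (op V)) where
  carrier := {η | IsCechCocycle U η}
  add_mem' {x y} hx hy i j k Z v a b c := by
    simp only [ev_add]
    rw [← hx i j k Z v a b c, ← hy i j k Z v a b c]
    abel
  zero_mem' i j k Z v a b c := by simp only [ev_zero, add_zero]
  neg_mem' {x} hx i j k Z v a b c := by
    simp only [ev_neg]
    rw [← hx i j k Z v a b c]
    abel

/-- The presheaf of `1`-cocycles for the family `U`. -/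
noncomputable def cechCocycle (F : Cᵒᵖ ⥤ AddCommGrpCat.{w}) : Cᵒᵖ ⥤ AddCommGrpCat.{w} where
  obj V := AddCommGrpCat.of (cechCocycleSubgroup U F V.unop)
  map {V W} f := AddCommGrpCat.ofHom
    ((((prodFamily F fun p : ι × ι ↦ U p.1 ⨯ U p.2).map f).hom.comp
      (cechCocycleSubgroup U F V.unop).subtype).codRestrict (cechCocycleSubgroup U F W.unop)
        fun η ↦ IsCechCocycle.map f.unop η.2)
  map_id V := by
    ext η
    exact ConcreteCategory.congr_hom
      ((prodFamily F fun p : ι × ι ↦ U p.1 ⨯ U p.2).map_id V) η.1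
  map_comp f g := by
    ext η
    exact ConcreteCategory.congr_hom
      ((prodFamily F fun p : ι × ι ↦ U p.1 ⨯ U p.2).map_comp f g) η.1

/-- The cocycle identity is an equation between sections of a sheaf, hence can be checked locally; a
glued cochain of cocycles is therefore a cocycle. -/
lemma isSheaf_cechCocycle {F : Cᵒᵖ ⥤ AddCommGrpCat.{w}} (hF : Presheaf.IsSheaf J F) :
    Presheaf.IsSheaf J (cechCocycle U F) := by
  have hG := isSheaf_prodFamily hF fun p : ι × ι ↦ U p.1 ⨯ U p.2
  refine isSheaf_of_glue (fun {V S} hS s t h ↦ ?_) (fun {V S} hS x hx ↦ ?_)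
  · exact Subtype.ext (eq_of_locally_eq hG hS s.1 t.1 fun W f hf ↦ congr_arg Subtype.val (h f hf))
  · obtain ⟨s, hs⟩ := exists_glue hG hS (fun W f hf ↦ (x f hf).1) fun W W' f hf g ↦
      congr_arg Subtype.val (hx f hf g)
    refine ⟨⟨s, fun i j k Z v a b c ↦ ?_⟩, fun W f hf ↦ Subtype.ext (hs f hf)⟩
    refine eq_of_locally_eq hF (J.pullback_stable v hS) _ _ fun W f hf ↦ ?_
    have h := (x (f ≫ v) hf).2 i j k W (𝟙 W) (f ≫ a) (f ≫ b) (f ≫ c)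
    simp only [← hs (f ≫ v) hf, ev_map, Category.id_comp] at h
    simpa only [map_add, map_ev, prod.comp_lift] using h

/-- The map `F(V) → ∏ F(V × Uᵢ)`. -/
noncomputable def toProdFamily (F : Cᵒᵖ ⥤ AddCommGrpCat.{w}) {κ : Type w} (A : κ → C) :
    F ⟶ prodFamily F A where
  app V := AddCommGrpCat.ofHom (AddMonoidHom.mk'
    (fun s k ↦ F.map (prod.fst : V.unop ⨯ A k ⟶ _).op s) fun a b ↦ by ext k; simp)
  naturality V W f := by
    ext s
    funext k
    change F.map (prod.fst : W.unop ⨯ A k ⟶ _).op (F.map f s) =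
      F.map (prod.map f.unop (𝟙 (A k))).op (F.map (prod.fst : V.unop ⨯ A k ⟶ _).op s)
    rw [← ConcreteCategory.comp_apply, ← Functor.map_comp, ← ConcreteCategory.comp_apply,
      ← Functor.map_comp, ← op_comp, prod.map_fst]
    rfl

lemma ev_toProdFamily {F : Cᵒᵖ ⥤ AddCommGrpCat.{w}} {κ : Type w} {A : κ → C} {V : C}
    (s : F.obj (op V)) (k : κ) {Z : C} (v : Z ⟶ V) (a : Z ⟶ A k) :
    ev ((toProdFamily F A).app (op V) s) k v a = F.map v.op s := by
  change F.map _ (F.map _ s) = _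
  rw [← ConcreteCategory.comp_apply, ← Functor.map_comp, ← op_comp, prod.lift_fst]

/-- The coboundary of a `0`-cochain. -/
noncomputable def coboundary {F : Cᵒᵖ ⥤ AddCommGrpCat.{w}} {V : C}
    (ξ : (prodFamily F U).obj (op V)) :
    (prodFamily F fun p : ι × ι ↦ U p.1 ⨯ U p.2).obj (op V) :=
  mk fun p ↦ ev ξ p.1 prod.fst (prod.snd ≫ prod.fst) - ev ξ p.2 prod.fst (prod.snd ≫ prod.snd)

lemma ev_coboundary {F : Cᵒᵖ ⥤ AddCommGrpCat.{w}} {V : C} (ξ : (prodFamily F U).obj (op V))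
    (i j : ι) {Z : C} (v : Z ⟶ V) (a : Z ⟶ U i) (b : Z ⟶ U j) :
    ev (coboundary U ξ) (i, j) v (prod.lift a b) = ev ξ i v a - ev ξ j v b := by
  simp only [coboundary, ev_mk, map_sub, map_ev, prod.lift_fst,
    prod.lift_snd, prod.lift_snd_assoc]

lemma isCechCocycle_coboundary {F : Cᵒᵖ ⥤ AddCommGrpCat.{w}} {V : C}
    (ξ : (prodFamily F U).obj (op V)) : IsCechCocycle U (coboundary U ξ) := fun i j k Z v a b c ↦ by
  rw [ev_coboundary, ev_coboundary, ev_coboundary]; abel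

lemma prodFamily.ext₂ {F : Cᵒᵖ ⥤ AddCommGrpCat.{w}} {V : C}
    {ξ η : (prodFamily F fun p : ι × ι ↦ U p.1 ⨯ U p.2).obj (op V)}
    (h : ∀ i j (Z : C) (v : Z ⟶ V) (a : Z ⟶ U i) (b : Z ⟶ U j),
      ev ξ (i, j) v (prod.lift a b) = ev η (i, j) v (prod.lift a b)) : ξ = η := by
  refine prodFamily.ext fun k Z v a ↦ ?_
  have := h k.1 k.2 Z v (a ≫ prod.fst) (a ≫ prod.snd)
  have e : prod.lift (a ≫ prod.fst) (a ≫ prod.snd) = a := by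
    ext
    · rw [prod.lift_fst]
    · rw [prod.lift_snd]
  rwa [e] at this

lemma coboundary_add {F : Cᵒᵖ ⥤ AddCommGrpCat.{w}} {V : C} (ξ η : (prodFamily F U).obj (op V)) :
    coboundary U (ξ + η) = coboundary U ξ + coboundary U η := by
  refine prodFamily.ext₂ U fun i j Z v x y ↦ ?_
  rw [ev_add, ev_coboundary, ev_coboundary, ev_coboundary, ev_add, ev_add]
  abel

/-- The coboundary map from `0`-cochains to `1`-cocycles. -/
noncomputable def toCechCocycle (F : Cᵒᵖ ⥤ AddCommGrpCat.{w}) :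
    prodFamily F U ⟶ cechCocycle U F where
  app V := AddCommGrpCat.ofHom (AddMonoidHom.mk'
    (fun ξ ↦ (⟨coboundary U (V := V.unop) ξ, isCechCocycle_coboundary U _⟩ : cechCocycleSubgroup U F V.unop)) fun a b ↦
      Subtype.ext (coboundary_add U _ _))
  naturality V W f := by
    ext ξ
    refine Subtype.ext (prodFamily.ext₂ U fun i j Z v x y ↦ ?_)
    refine (ev_coboundary U _ i j v x y).trans ?_
    refine Eq.trans ?_ (ev_map f.unop _ _ _ _).symm
    refine Eq.trans ?_ (ev_coboundary U _ i j _ x y).symm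
    exact congr_arg₂ _ (ev_map f.unop _ _ _ _) (ev_map f.unop _ _ _ _)

/-- The sieve of morphisms whose source maps to some `Uᵢ`. -/
def coverSieve (V : C) : Sieve V where
  arrows W _ := ∃ i, Nonempty (W ⟶ U i)
  downward_closed := fun ⟨i, ⟨a⟩⟩ g ↦ ⟨i, ⟨g ≫ a⟩⟩

variable (hU : ∀ V, coverSieve U V ∈ J V) (F : Sheaf J AddCommGrpCat.{w})

include hU in
lemma toProdFamily_injective {V : C} {s t : F.obj.obj (op V)}
    (h : (toProdFamily F.obj U).app (op V) s = (toProdFamily F.obj U).app (op V) t) : s = t := by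
  refine eq_of_locally_eq F.property (hU V) _ _ fun W f ⟨i, ⟨a⟩⟩ ↦ ?_
  rw [← ev_toProdFamily (A := U) s i f a, h, ev_toProdFamily]

-- A vanishing coboundary means that the value of `ξ` at a map into some `U i` depends neither on
-- `i` nor on that map. Arbitrary choices of such maps on the covering sieve then give a compatible
-- family.
include hU in
lemma exists_toProdFamily_eq {V : C} (ξ : (prodFamily F.obj U).obj (op V))
    (h : coboundary U ξ = 0) : ∃ s, (toProdFamily F.obj U).app (op V) s = ξ := by
  have hξ (i j : ι) {Z : C} (v : Z ⟶ V) (a : Z ⟶ U i) (b : Z ⟶ U j) :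
      ev ξ i v a = ev ξ j v b := by
    have := ev_coboundary U ξ i j v a b
    rw [h, ev_zero] at this
    exact (sub_eq_zero.1 this.symm)
  obtain ⟨s, hs⟩ := exists_glue F.property (hU V)
    (fun W f hf ↦ ev ξ hf.choose f hf.choose_spec.some) fun W W' f hf g ↦ by
      rw [map_ev]; exact hξ _ _ _ _ _
  refine ⟨s, prodFamily.ext fun k Z v a ↦ ?_⟩
  rw [ev_toProdFamily, hs v ⟨k, ⟨a⟩⟩]
  exact hξ _ _ _ _ _

-- Over an object with a map `a` to some `U k`, the complex contracts: the cochain `i ↦ η(i, k)`,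
-- with second argument `a`, has coboundary `η`, because `η(i, k) - η(j, k) = η(i, j)`.
include hU in
lemma isLocallySurjective_toCechCocycle :
    Presheaf.IsLocallySurjective J (toCechCocycle U F.obj) where
  imageSieve_mem {V} η := by
    refine J.superset_covering ?_ (hU V)
    rintro W f ⟨k, ⟨a⟩⟩
    refine ⟨mk fun i ↦ ev η.1 (i, k) (prod.fst ≫ f) (prod.lift prod.snd (prod.fst ≫ a)),
      Subtype.ext (prodFamily.ext₂ U fun i j Z v x y ↦ ?_)⟩
    refine (ev_coboundary U _ i j v x y).trans ?_
    refine Eq.trans ?_ (ev_map f _ _ _ _).symm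
    rw [ev_mk, ev_mk, map_ev, map_ev]
    simp only [prod.comp_lift, prod.lift_fst_assoc, prod.lift_snd]
    rw [← η.2 i j k Z (v ≫ f) x y (v ≫ a), add_sub_cancel_right]
    rfl

variable {U} {F}

/-- If `H¹(F) = 0`, every `1`-cocycle for a covering family of the terminal object is a
coboundary. -/
theorem exists_eq_coboundary [HasSheafify J AddCommGrpCat.{w}]
    [HasExt.{w} (Sheaf J AddCommGrpCat.{w})] {T : C} (hT : IsTerminal T)
    (hU : ∀ V, coverSieve U V ∈ J V) (hF : Subsingleton (F.H 1))
    (η : (prodFamily F.obj fun p : ι × ι ↦ U p.1 ⨯ U p.2).obj (op T)) (hη : IsCechCocycle U η) :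
    ∃ ξ : (prodFamily F.obj U).obj (op T), coboundary U ξ = η := by
  let E : Sheaf J AddCommGrpCat.{w} := ⟨_, isSheaf_prodFamily F.property U⟩
  let Q : Sheaf J AddCommGrpCat.{w} := ⟨_, isSheaf_cechCocycle U F.property⟩
  let f : F ⟶ E := ⟨toProdFamily F.obj U⟩
  let g : E ⟶ Q := ⟨toCechCocycle U F.obj⟩
  have hw (V : C) (s : F.obj.obj (op V)) :
      coboundary U ((toProdFamily F.obj U).app (op V) s) = 0 := by
    refine prodFamily.ext₂ U fun i j Z v x y ↦ ?_
    rw [ev_coboundary, ev_toProdFamily, ev_toProdFamily, ev_zero, sub_self]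
  have w : f ≫ g = 0 := by
    ext V s
    exact Subtype.ext (hw V.unop s)
  have hker (V : Cᵒᵖ) (ξ : (prodFamily F.obj U).obj V) (h : (toCechCocycle U F.obj).app V ξ = 0) :
      ∃ s, (toProdFamily F.obj U).app V s = ξ :=
    exists_toProdFamily_eq U hU F ξ (congr_arg Subtype.val h)
  have hinj (V : Cᵒᵖ) : Function.Injective ((toProdFamily F.obj U).app V) :=
    fun s t h ↦ toProdFamily_injective U hU F h
  have : Sheaf.IsLocallySurjective g := isLocallySurjective_toCechCocycle U hU F
  have : Epi g := inferInstance
  have : Mono f := ⟨fun {W} a b h ↦ by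
    ext V s
    exact hinj V (ConcreteCategory.congr_hom (NatTrans.congr_app (congr_arg (·.hom) h) V) s)⟩
  -- Exactness at the first two places holds on sections over every object, so a morphism killed by
  -- `g` lifts through `f` sectionwise; only the surjectivity of `g` is local.
  let hk : IsLimit (KernelFork.ofι f w) := KernelFork.IsLimit.ofι' f w fun {W} k hk ↦ by
    have hk' (V : Cᵒᵖ) (s : W.obj.obj V) : ∃ t, (toProdFamily F.obj U).app V t = k.hom.app V s :=
      hker V _ (ConcreteCategory.congr_hom (NatTrans.congr_app (congr_arg (·.hom) hk) V) s)
    choose l hl using hk'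
    refine ⟨⟨⟨fun V ↦ AddCommGrpCat.ofHom (AddMonoidHom.mk' (l V) fun a b ↦
      hinj V (by simp only [map_add, hl])), fun V V' p ↦ ?_⟩⟩, ?_⟩
    · ext s
      refine hinj V' ?_
      refine (hl V' _).trans ((NatTrans.naturality_apply k.hom p s).trans ?_)
      refine Eq.trans ?_ (NatTrans.naturality_apply (toProdFamily F.obj U) p (l V s)).symm
      rw [hl]
    · ext V s
      exact hl V s
  have hS : (ShortComplex.mk f g w).ShortExact := ⟨ShortComplex.exact_of_f_is_kernel _ hk⟩
  -- The cocycle is a global section of `Q`. Its obstruction to lifting to a global section of `E`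
  -- lies in `H¹(F)`, which is zero.
  let y := (Sheaf.H.equiv₀ Q hT).symm ⟨η, hη⟩
  obtain ⟨x, hx⟩ := Abelian.Ext.covariant_sequence_exact₃ _ hS y rfl (Subsingleton.elim _ _)
  refine ⟨Sheaf.H.equiv₀ E hT x, ?_⟩
  have h1 := Sheaf.H.equiv₀_naturality hT g x
  have h2 : Sheaf.H.equiv₀ Q hT (Sheaf.H.map g 0 x) = ⟨η, hη⟩ := by
    rw [Sheaf.H.map_apply]
    exact (congr_arg (Sheaf.H.equiv₀ Q hT) hx).trans (AddEquiv.apply_symm_apply _ _)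
  exact congr_arg Subtype.val (h1.trans h2)

end CategoryTheory.CechDescent

/-! ### The structure sheaf and the sheaf `μ₂` on the small étale site. -/

namespace AlgebraicGeometry.Scheme

variable (X : Scheme.{u})

lemma etaleTopology_le_fppfTopology : etaleTopology.{u} ≤ fppfTopology := by
  apply Precoverage.toGrothendieck_mono
  apply precoverage_mono
  intro X Y f hf
  exact ⟨inferInstance, inferInstance⟩

instance : MorphismProperty.RespectsIso (@AlgebraicGeometry.Etale.{u} : MorphismProperty Scheme.{u}) :=
  Etale.etale_isStableUnderBaseChange.respectsIso

instance : MorphismProperty.IsStableUnderComposition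
    (@AlgebraicGeometry.Etale.{u} : MorphismProperty Scheme.{u}) :=
  AlgebraicGeometry.Etale.instIsMultiplicativeScheme.toIsStableUnderComposition

instance : (Etale.forget X).LocallyCoverDense (overGrothendieckTopology @Etale X) :=
  locallyCoverDense_of_le (P := @Etale) (Q := @Etale) X le_rfl

instance : RepresentablyFlat (Etale.forget X) := flat_of_preservesFiniteLimits _

lemma coverPreserving_etaleForget :
    CoverPreserving X.smallEtaleTopology (etaleTopology.over X) (Etale.forget X) :=
  Functor.coverPreserving_restrictedTopology (G := Etale.forget X)
    (K := overGrothendieckTopology @Etale X)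

instance : (Etale.forget X).IsContinuous X.smallEtaleTopology (etaleTopology.over X) :=
  Functor.isContinuous_of_coverPreserving (compatiblePreservingOfFlat _ _)
    (coverPreserving_etaleForget X)

instance : (Etale.forget X ⋙ Over.forget X).IsContinuous X.smallEtaleTopology etaleTopology :=
  Functor.isContinuous_comp _ _ _ (etaleTopology.over X) _

/-- The presheaf of sets `V ↦ Γ(V, 𝒪_V)` on schemes. -/
def sectionsPresheaf : Scheme.{u}ᵒᵖ ⥤ Type u := Scheme.Γ ⋙ CategoryTheory.forget CommRingCat

/-- Global sections are represented by the affine line. -/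
noncomputable def sectionsPresheafIso :
    yoneda.obj (Spec (.of (MvPolynomial PUnit.{u+1} (ULift.{u} ℤ)))) ≅ sectionsPresheaf.{u} :=
  NatIso.ofComponents (fun V ↦ Equiv.toIso
    ((AffineSpace.toSpecMvPolyIntEquiv PUnit (X := V.unop)).trans (Equiv.funUnique PUnit _)))
    fun f ↦ by
      ext g
      exact AffineSpace.toSpecMvPolyIntEquiv_comp _ f.unop g _

/-- Representability by the affine line reduces this to subcanonicity of the fppf topology, of which
étale coverings are a special case. -/
lemma isSheaf_sectionsPresheaf : Presheaf.IsSheaf etaleTopology.{u} sectionsPresheaf := by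
  rw [← Presheaf.isSheaf_of_iso_iff sectionsPresheafIso, isSheaf_iff_isSheaf_of_type]
  exact Presieve.isSheaf_of_le _ etaleTopology_le_fppfTopology
    (GrothendieckTopology.Subcanonical.isSheaf_of_isRepresentable _)

lemma isSheaf_etale_sectionsPresheaf :
    Presheaf.IsSheaf X.smallEtaleTopology
      ((Etale.forget X ⋙ Over.forget X).op ⋙ sectionsPresheaf) :=
  Functor.op_comp_isSheaf_of_isSheaf _ _ etaleTopology _ isSheaf_sectionsPresheaf

variable {X}

/-- Restriction of functions along a morphism of the étale site. -/
noncomputable abbrev etaleRes {V W : X.Etale} (f : W ⟶ V) : Γ(V.left, ⊤) →+* Γ(W.left, ⊤) :=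
  f.left.appTop.hom

lemma etaleRes_comp {V W Z : X.Etale} (f : W ⟶ V) (g : Z ⟶ W) (s : Γ(V.left, ⊤)) :
    etaleRes (g ≫ f) s = etaleRes g (etaleRes f s) := by
  change (g.left ≫ f.left).appTop.hom s = _
  rw [Scheme.Hom.comp_appTop]
  rfl

lemma etaleRes_id {V : X.Etale} (s : Γ(V.left, ⊤)) : etaleRes (𝟙 V) s = s := by
  change (𝟙 V.left : V.left ⟶ V.left).appTop.hom s = _
  simp

lemma etale_eq_of_locally_eq {V : X.Etale} {S : Sieve V} (hS : S ∈ X.smallEtaleTopology V)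
    {s t : Γ(V.left, ⊤)} (h : ∀ ⦃W⦄ (f : W ⟶ V), S f → etaleRes f s = etaleRes f t) : s = t :=
  (((isSheaf_iff_isSheaf_of_type _ _).1 (isSheaf_etale_sectionsPresheaf X)).isSeparated S hS).ext
    fun _ f hf ↦ h f hf

lemma etale_exists_glue {V : X.Etale} {S : Sieve V} (hS : S ∈ X.smallEtaleTopology V)
    (x : ∀ ⦃W⦄ (f : W ⟶ V), S f → Γ(W.left, ⊤))
    (hx : ∀ ⦃W W'⦄ (f : W ⟶ V) (hf : S f) (g : W' ⟶ W),
      etaleRes g (x f hf) = x (g ≫ f) (S.downward_closed hf g)) :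
    ∃ s : Γ(V.left, ⊤), ∀ ⦃W⦄ (f : W ⟶ V) (hf : S f), etaleRes f s = x f hf := by
  let y : Presieve.FamilyOfElements
    ((Etale.forget X ⋙ Over.forget X).op ⋙ sectionsPresheaf) S.arrows := fun W f hf ↦ x f hf
  have hy : y.SieveCompatible := fun W W' f g hf ↦ (hx f hf g).symm
  obtain ⟨t, ht, -⟩ := ((isSheaf_iff_isSheaf_of_type _ _).1 (isSheaf_etale_sectionsPresheaf X)) S hS
    y ((Presieve.compatible_iff_sieveCompatible _).2 hy)
  exact ⟨t, fun W f hf ↦ ht f hf⟩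

/-- A sieve is generated by the family of all its members, so the joint surjectivity criterion for
covering families applies to it. -/
lemma mem_smallEtaleTopology_iff {V : X.Etale} (S : Sieve V) :
    S ∈ X.smallEtaleTopology V ↔
      ∀ x : V.left, ∃ (W : X.Etale) (f : W ⟶ V), S f ∧ x ∈ Set.range f.left := by
  have e : Sieve.ofArrows (fun i : Σ W, {f : W ⟶ V // S f} ↦ i.1) (fun i ↦ i.2.1) = S := by
    refine le_antisymm (fun W f ⟨_, g, _, h, e⟩ ↦ ?_) fun W f hf ↦
      ⟨W, 𝟙 W, f, Presieve.ofArrows.mk (⟨W, f, hf⟩ : Σ W, {f : W ⟶ V // S f}),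
        Category.id_comp _⟩
    obtain ⟨i⟩ := h
    subst e
    exact S.downward_closed i.2.2 g
  conv_lhs => rw [← e]
  rw [ofArrows_mem_smallEtaleTopology_iff, Set.eq_univ_iff_forall]
  refine forall_congr' fun x ↦ ?_
  rw [Set.mem_iUnion]
  exact ⟨fun ⟨⟨W, f, hf⟩, hx⟩ ↦ ⟨W, f, hf, hx⟩, fun ⟨W, f, hf, hx⟩ ↦ ⟨⟨W, f, hf⟩, hx⟩⟩

/-- The group `μ₂(R)`, written additively. -/
abbrev MuTwo (R : Type u) [CommRing R] : Type u := Additive (rootsOfUnity 2 R)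

/-- The element of `R` underlying an element of `μ₂(R)`. -/
def MuTwo.val {R : Type u} [CommRing R] (x : MuTwo R) : R := ((x.toMul : rootsOfUnity 2 R) : Rˣ)

lemma MuTwo.val_injective {R : Type u} [CommRing R] :
    Function.Injective (MuTwo.val : MuTwo R → R) := fun _ _ h ↦
  Additive.toMul.injective (Subtype.ext (Units.ext h))

lemma MuTwo.val_mul_self {R : Type u} [CommRing R] (x : MuTwo R) : x.val * x.val = 1 := by
  have := x.toMul.2
  rw [mem_rootsOfUnity, Units.ext_iff] at this
  rw [← pow_two]
  exact this

/-- Constructor for elements of `μ₂(R)`. -/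
def MuTwo.mk {R : Type u} [CommRing R] (a : R) (h : a * a = 1) : MuTwo R :=
  Additive.ofMul (⟨⟨a, a, h, h⟩, by
    rw [mem_rootsOfUnity, Units.ext_iff, Units.val_pow_eq_pow_val, pow_two]; exact h⟩ :
    rootsOfUnity 2 R)

/-- Functoriality of `μ₂`. -/
def MuTwo.map {R S : Type u} [CommRing R] [CommRing S] (f : R →+* S) : MuTwo R →+ MuTwo S :=
  (restrictRootsOfUnity f 2).toAdditive

lemma MuTwo.map_id {R : Type u} [CommRing R] {f : R →+* R} (hf : ∀ x, f x = x) :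
    MuTwo.map f = AddMonoidHom.id _ :=
  AddMonoidHom.ext fun x ↦ MuTwo.val_injective (hf x.val)

lemma MuTwo.map_comp {R S T : Type u} [CommRing R] [CommRing S] [CommRing T] {f : R →+* S}
    {g : S →+* T} {h : R →+* T} (H : ∀ x, h x = g (f x)) :
    MuTwo.map h = (MuTwo.map g).comp (MuTwo.map f) :=
  AddMonoidHom.ext fun x ↦ MuTwo.val_injective (H x.val)

lemma MuTwo.val_map {R S : Type u} [CommRing R] [CommRing S] (f : R →+* S) (x : MuTwo R) :
    (MuTwo.map f x).val = f x.val := rfl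

variable (X) in
/-- The presheaf `μ₂` on the small étale site, written additively. -/
noncomputable def muTwoPresheaf : X.Etaleᵒᵖ ⥤ AddCommGrpCat.{u} where
  obj V := AddCommGrpCat.of (MuTwo Γ(V.unop.left, ⊤))
  map f := AddCommGrpCat.ofHom (MuTwo.map (etaleRes f.unop))
  map_id _ := AddCommGrpCat.hom_ext (MuTwo.map_id etaleRes_id)
  map_comp f g := AddCommGrpCat.hom_ext (MuTwo.map_comp (etaleRes_comp f.unop g.unop))

/-- The function underlying a section of `μ₂`. -/
def muTwoVal {V : X.Etale} (x : X.muTwoPresheaf.obj (op V)) : Γ(V.left, ⊤) :=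
  MuTwo.val (show MuTwo Γ(V.left, ⊤) from x)

lemma muTwoVal_injective {V : X.Etale} :
    Function.Injective (muTwoVal : X.muTwoPresheaf.obj (op V) → _) := fun _ _ h ↦
  MuTwo.val_injective h

lemma muTwoVal_mul_self {V : X.Etale} (x : X.muTwoPresheaf.obj (op V)) :
    muTwoVal x * muTwoVal x = 1 := MuTwo.val_mul_self _

lemma muTwoVal_add {V : X.Etale} (x y : X.muTwoPresheaf.obj (op V)) :
    muTwoVal (x + y) = muTwoVal x * muTwoVal y := rfl

/-- Constructor for sections of `μ₂`. -/
def muTwoMk {V : X.Etale} (a : Γ(V.left, ⊤)) (h : a * a = 1) : X.muTwoPresheaf.obj (op V) :=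
  MuTwo.mk a h

-- `μ₂` is cut out of the structure sheaf by the equation `a * a = 1`, which holds as soon as it
-- holds locally.
variable (X) in
lemma isSheaf_muTwoPresheaf : Presheaf.IsSheaf X.smallEtaleTopology X.muTwoPresheaf := by
  refine CechDescent.isSheaf_of_glue (fun {V S} hS s t h ↦ ?_) (fun {V S} hS x hx ↦ ?_)
  · exact muTwoVal_injective (etale_eq_of_locally_eq hS fun W f hf ↦ congr_arg muTwoVal (h f hf))
  · obtain ⟨s, hs⟩ := etale_exists_glue hS (fun W f hf ↦ muTwoVal (x f hf)) fun W W' f hf g ↦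
      congr_arg muTwoVal (hx f hf g)
    refine ⟨muTwoMk s (etale_eq_of_locally_eq hS fun W f hf ↦ ?_), fun W f hf ↦
      muTwoVal_injective (hs f hf)⟩
    rw [map_mul, hs f hf, muTwoVal_mul_self, map_one]

variable (X) in
/-- The sheaf `μ₂` on the small étale site. -/
noncomputable def muTwo : Sheaf X.smallEtaleTopology AddCommGrpCat.{u} :=
  ⟨X.muTwoPresheaf, isSheaf_muTwoPresheaf X⟩

end AlgebraicGeometry.Scheme

/-! ### Comparison of `μ₂` with the constant sheaf `ℤ/2` when 2 is invertible. -/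

namespace AlgebraicGeometry.Scheme

variable {X : Scheme.{u}}

/-- Constructor for morphisms in the étale site. -/
noncomputable def etaleHomMk {V W : X.Etale} (f : W.left ⟶ V.left) (h : f ≫ V.hom = W.hom) : W ⟶ V :=
  (Etale.forgetFullyFaithful X).preimage
    (Over.homMk (U := (Etale.forget X).obj W) (V := (Etale.forget X).obj V) f h)

lemma etaleHomMk_left {V W : X.Etale} (f : W.left ⟶ V.left) (h : f ≫ V.hom = W.hom) :
    (etaleHomMk f h).left = f :=
  congr_arg (·.left) ((Etale.forgetFullyFaithful X).map_preimage
    (Over.homMk (U := (Etale.forget X).obj W) (V := (Etale.forget X).obj V) f h))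

lemma etale_w {V W : X.Etale} (f : W ⟶ V) : f.left ≫ V.hom = W.hom :=
  Over.w ((Etale.forget X).map f)

/-- The object `U ⟶ V ⟶ X` of the étale site for an open `U` of `V`. -/
noncomputable def etaleOpen (V : X.Etale) (U : V.left.Opens) : X.Etale :=
  Etale.mk (U.ι ≫ V.hom)

/-- The inclusion of an open. -/
noncomputable def etaleOpenι (V : X.Etale) (U : V.left.Opens) : etaleOpen V U ⟶ V :=
  etaleHomMk (W := etaleOpen V U) U.ι rfl

lemma etaleOpenι_left (V : X.Etale) (U : V.left.Opens) : (etaleOpenι V U).left = U.ι :=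
  etaleHomMk_left _ _

lemma mem_smallEtaleTopology_of_opens {V : X.Etale} (S : Sieve V)
    (h : ∀ x : V.left, ∃ U : V.left.Opens, x ∈ U ∧ S (etaleOpenι V U)) :
    S ∈ X.smallEtaleTopology V := by
  rw [mem_smallEtaleTopology_iff]
  intro x
  obtain ⟨U, hx, hU⟩ := h x
  refine ⟨_, _, hU, ?_⟩
  rw [etaleOpenι_left]
  exact ⟨⟨x, hx⟩, rfl⟩

lemma etaleRes_etaleOpenι (V : X.Etale) (U : V.left.Opens) (s : Γ(V.left, ⊤)) :
    etaleRes (etaleOpenι V U) s = U.ι.appTop.hom s := by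
  unfold etaleRes
  rw [etaleOpenι_left]
  rfl

lemma isUnit_ι_appTop_basicOpen (e : Γ(X, ⊤)) : IsUnit ((X.basicOpen e).ι.appTop.hom e) := by
  rw [Scheme.Opens.ι_appTop]
  have h : (X.basicOpen e).ι ''ᵁ ⊤ ≤ X.basicOpen e := by simp
  have e1 : X.presheaf.map (homOfLE (x := (X.basicOpen e).ι ''ᵁ ⊤) le_top).op =
    X.presheaf.map (homOfLE (le_top : X.basicOpen e ≤ ⊤)).op ≫ X.presheaf.map (homOfLE h).op := by
    rw [← Functor.map_comp]; rfl
  rw [e1]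
  exact (RingedSpace.isUnit_res_basicOpen X.toRingedSpace e).map (X.presheaf.map (homOfLE h).op).hom

lemma isUnit_etaleRes_basicOpen {V : X.Etale} (e : Γ(V.left, ⊤)) :
    IsUnit (etaleRes (etaleOpenι V (V.left.basicOpen e)) e) := by
  rw [etaleRes_etaleOpenι]
  exact isUnit_ι_appTop_basicOpen e

lemma isUnit_two_etale (h2 : IsUnit (2 : Γ(X, ⊤))) (V : X.Etale) : IsUnit (2 : Γ(V.left, ⊤)) := by
  have := h2.map V.hom.appTop.hom
  rwa [map_ofNat] at this

lemma MuTwo.neg_one_add_self (R : Type u) [CommRing R] :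
    MuTwo.mk (-1 : R) (by ring) + MuTwo.mk (-1 : R) (by ring) = 0 :=
  MuTwo.val_injective (by change (-1 : R) * -1 = 1; ring)

/-- The map `ℤ/2 → μ₂(R)` with value `-1` at `1`. -/
def MuTwo.ofZMod (R : Type u) [CommRing R] : ULift.{u} (ZMod 2) →+ MuTwo R :=
  (ZMod.lift 2 ⟨zmultiplesHom _ (MuTwo.mk (-1 : R) (by ring)), by
    simp [two_zsmul, MuTwo.neg_one_add_self]⟩).comp AddEquiv.ulift.toAddMonoidHom

lemma MuTwo.ofZMod_zero (R : Type u) [CommRing R] : (MuTwo.ofZMod R ⟨0⟩).val = 1 := by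
  have : MuTwo.ofZMod R ⟨0⟩ = 0 := map_zero _
  rw [this]; rfl

lemma MuTwo.ofZMod_one (R : Type u) [CommRing R] : (MuTwo.ofZMod R ⟨1⟩).val = -1 := by
  have : MuTwo.ofZMod R ⟨1⟩ = MuTwo.mk (-1 : R) (by ring) := by
    have := ZMod.lift_coe 2 ⟨zmultiplesHom _ (MuTwo.mk (-1 : R) (by ring)), by
      simp [two_zsmul, MuTwo.neg_one_add_self]⟩ 1
    refine Eq.trans ?_ (this.trans (one_zsmul _))
    rfl
  rw [this]; rfl

lemma MuTwo.map_ofZMod {R S : Type u} [CommRing R] [CommRing S] (f : R →+* S)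
    (k : ULift.{u} (ZMod 2)) : MuTwo.map f (MuTwo.ofZMod R k) = MuTwo.ofZMod S k := by
  refine MuTwo.val_injective ?_
  rw [MuTwo.val_map]
  obtain ⟨k⟩ := k
  fin_cases k
  · exact (congr_arg f (MuTwo.ofZMod_zero R)).trans ((map_one f).trans (MuTwo.ofZMod_zero S).symm)
  · exact (congr_arg f (MuTwo.ofZMod_one R)).trans
      (((map_neg f 1).trans (by rw [map_one])).trans (MuTwo.ofZMod_one S).symm)

variable (X) in
/-- The map from the constant presheaf `ℤ/2` to `μ₂`. -/
noncomputable def constToMuTwo :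
    (Functor.const X.Etaleᵒᵖ).obj (AddCommGrpCat.of (ULift.{u} (ZMod 2))) ⟶ X.muTwoPresheaf where
  app V := AddCommGrpCat.ofHom (MuTwo.ofZMod Γ(V.unop.left, ⊤))
  naturality _ _ f := AddCommGrpCat.hom_ext (AddMonoidHom.ext fun k ↦
    (MuTwo.map_ofZMod (etaleRes f.unop) k).symm)

/-- On an object with a point, `1 = -1` would make the unit 2 vanish in a nonzero ring. On an empty
object injectivity fails, but there the empty sieve covers; the pointwise criterion for coverings
absorbs this case. -/
lemma isLocallyInjective_constToMuTwo (h2 : IsUnit (2 : Γ(X, ⊤))) :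
    Presheaf.IsLocallyInjective X.smallEtaleTopology (constToMuTwo X) where
  equalizerSieve_mem {V} a b h := by
    rw [mem_smallEtaleTopology_iff]
    intro x
    refine ⟨_, 𝟙 _, ?_, ⟨x, rfl⟩⟩
    suffices a = b by subst this; rfl
    have hne : (1 : Γ(V.unop.left, ⊤)) ≠ -1 := by
      intro h
      have : Nonempty (⊤ : V.unop.left.Opens) := ⟨⟨x, trivial⟩⟩
      have : Nontrivial Γ(V.unop.left, ⊤) := component_nontrivial _ _
      have h3 : (2 : Γ(V.unop.left, ⊤)) = 0 := by linear_combination h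
      have h4 := isUnit_two_etale h2 V.unop
      rw [h3] at h4
      exact not_isUnit_zero h4
    have h' : (MuTwo.ofZMod Γ(V.unop.left, ⊤) a).val = (MuTwo.ofZMod Γ(V.unop.left, ⊤) b).val :=
      congr_arg MuTwo.val h
    change ULift (ZMod 2) at a b
    obtain ⟨a⟩ := a
    obtain ⟨b⟩ := b
    have h0 := MuTwo.ofZMod_zero Γ(V.unop.left, ⊤)
    have h1 := MuTwo.ofZMod_one Γ(V.unop.left, ⊤)
    fin_cases a <;> fin_cases b
    · rfl
    · exact (hne (h0.symm.trans (h'.trans h1))).elim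
    · exact (hne (h0.symm.trans (h'.symm.trans h1))).elim
    · rfl

/-- If `s * s = 1`, then `e = (1 + s) / 2` and `e' = (1 - s) / 2` have sum one, so near each point
one of them is a unit. Since `e * (1 - s) = 0` and `e' * (1 + s) = 0`, the section `s` is `1` where
`e` is invertible and `-1` where `e'` is. -/
lemma isLocallySurjective_constToMuTwo (h2 : IsUnit (2 : Γ(X, ⊤))) :
    Presheaf.IsLocallySurjective X.smallEtaleTopology (constToMuTwo X) where
  imageSieve_mem {V} s := by
    refine mem_smallEtaleTopology_of_opens _ fun x ↦ ?_
    obtain ⟨c, hc⟩ := (isUnit_two_etale h2 V).exists_right_inv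
    have hs : muTwoVal s * muTwoVal s = 1 := muTwoVal_mul_self s
    let e : Γ(V.left, ⊤) := c * (1 + muTwoVal s)
    let e' : Γ(V.left, ⊤) := c * (1 - muTwoVal s)
    have hee : e + e' = 1 := by simp only [e, e']; linear_combination hc
    have he1 : e * (1 - muTwoVal s) = 0 := by simp only [e]; linear_combination -c * hs
    have he2 : e' * (1 + muTwoVal s) = 0 := by simp only [e']; linear_combination -c * hs
    have hx : x ∈ V.left.basicOpen e ∨ x ∈ V.left.basicOpen e' := by
      rw [Scheme.mem_basicOpen_top, Scheme.mem_basicOpen_top]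
      apply IsLocalRing.isUnit_or_isUnit_of_add_one
      rw [← map_add, hee, map_one]
    rcases hx with hx | hx
    · refine ⟨_, hx, ⟨⟨0⟩, muTwoVal_injective ?_⟩⟩
      refine (MuTwo.ofZMod_zero _).trans ?_
      have h := congr_arg (etaleRes (etaleOpenι V (V.left.basicOpen e))) he1
      rw [map_mul, map_zero, (isUnit_etaleRes_basicOpen e).mul_right_eq_zero, map_sub, map_one,
        sub_eq_zero] at h
      exact h
    · refine ⟨_, hx, ⟨⟨1⟩, muTwoVal_injective ?_⟩⟩
      refine (MuTwo.ofZMod_one _).trans ?_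
      have h := congr_arg (etaleRes (etaleOpenι V (V.left.basicOpen e'))) he2
      rw [map_mul, map_zero, (isUnit_etaleRes_basicOpen e').mul_right_eq_zero, map_add, map_one] at h
      exact neg_eq_of_add_eq_zero_right h

/-- A locally bijective map of presheaves becomes an isomorphism after sheafification, so `μ₂`
inherits the vanishing from the constant sheaf. -/
lemma subsingleton_H_muTwo (h2 : IsUnit (2 : Γ(X, ⊤)))
    (hX : Subsingleton (X.EtaleCohomology (AddCommGrpCat.of (ULift.{u} (ZMod 2))) 1)) :
    Subsingleton (X.muTwo.H 1) := by
  have := isLocallyInjective_constToMuTwo h2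
  have := isLocallySurjective_constToMuTwo h2
  have hW := X.smallEtaleTopology.W_of_isLocallyBijective (constToMuTwo X)
  rw [GrothendieckTopology.W_iff] at hW
  let e : (constantSheaf X.smallEtaleTopology AddCommGrpCat.{u}).obj
      (AddCommGrpCat.of (ULift.{u} (ZMod 2))) ≅ X.muTwo :=
    @asIso _ _ _ _ _ hW ≪≫ (sheafificationIso X.muTwo).symm
  exact @Equiv.subsingleton _ _ ((Sheaf.functorH X.smallEtaleTopology
    1).mapIso e).addCommGroupIsoToAddEquiv.symm.toEquiv hX

end AlgebraicGeometry.Scheme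

/-! ### Descent of functions along étale covers of opens, and covers adjoining a square root. -/

namespace AlgebraicGeometry.Scheme

variable {X : Scheme.{u}}

/-- Restriction of sections of the structure sheaf. -/
noncomputable def secRes {U V : X.Opens} (h : V ≤ U) : Γ(X, U) →+* Γ(X, V) :=
  (X.presheaf.map (homOfLE h).op).hom

lemma secRes_secRes {U V W : X.Opens} (h : V ≤ U) (h' : W ≤ V) (s : Γ(X, U)) :
    secRes h' (secRes h s) = secRes (h'.trans h) s := by
  change (X.presheaf.map _) ((X.presheaf.map _) s) = _
  rw [← ConcreteCategory.comp_apply, ← Functor.map_comp]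
  rfl

lemma secRes_self {U : X.Opens} (h : U ≤ U) (s : Γ(X, U)) : secRes h s = s := by
  change X.presheaf.map (𝟙 (op U)) s = s
  rw [X.presheaf.map_id]
  rfl

lemma appLE_comp_appTop {A B : Scheme.{u}} (f : A ⟶ B) (g : B ⟶ X) (p : A ⟶ X) (e : p = f ≫ g)
    {U : X.Opens} (h : (⊤ : B.Opens) ≤ g ⁻¹ᵁ U) (h' : (⊤ : A.Opens) ≤ p ⁻¹ᵁ U) :
    g.appLE U ⊤ h ≫ f.appTop = p.appLE U ⊤ h' := by
  subst e
  have : f.appTop = f.appLE ⊤ ⊤ le_rfl := Scheme.Hom.app_eq_appLE f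
  rw [this]
  exact Scheme.Hom.appLE_comp_appLE f g U ⊤ ⊤ h le_rfl

lemma ι_appLE_top {U : X.Opens} (h : (⊤ : (U : Scheme.{u}).Opens) ≤ U.ι ⁻¹ᵁ U) :
    U.ι.appLE U ⊤ h = U.topIso.inv := by
  rw [Scheme.Opens.ι_appLE]
  rfl

/-- Pullback of sections to an étale `V ⟶ X` with image in `U`. -/
noncomputable def etalePull (V : X.Etale) {U : X.Opens} (h : (⊤ : V.left.Opens) ≤ V.hom ⁻¹ᵁ U) :
    Γ(X, U) →+* Γ(V.left, ⊤) :=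
  (V.hom.appLE U ⊤ h).hom

lemma etale_le_of_hom {V W : X.Etale} (f : W ⟶ V) {U : X.Opens}
    (h : (⊤ : V.left.Opens) ≤ V.hom ⁻¹ᵁ U) : (⊤ : W.left.Opens) ≤ W.hom ⁻¹ᵁ U := by
  intro x _
  have := h (x := f.left x) trivial
  rw [← etale_w f]
  exact this

lemma etaleRes_etalePull {V W : X.Etale} (f : W ⟶ V) {U : X.Opens}
    (h : (⊤ : V.left.Opens) ≤ V.hom ⁻¹ᵁ U) (h' : (⊤ : W.left.Opens) ≤ W.hom ⁻¹ᵁ U) (s : Γ(X, U)) :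
    etaleRes f (etalePull V h s) = etalePull W h' s := by
  exact congr_arg (fun φ ↦ φ.hom s) (appLE_comp_appTop f.left V.hom W.hom (etale_w f).symm h h')

lemma etalePull_secRes (V : X.Etale) {U U' : X.Opens} (hU : U' ≤ U)
    (h : (⊤ : V.left.Opens) ≤ V.hom ⁻¹ᵁ U') (h' : (⊤ : V.left.Opens) ≤ V.hom ⁻¹ᵁ U)
    (s : Γ(X, U)) : etalePull V h (secRes hU s) = etalePull V h' s := by
  have := Scheme.Hom.map_appLE V.hom h (homOfLE hU).op
  exact congr_arg (fun φ ↦ φ.hom s) this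

/-- An open of `X` as an object of the étale site. -/
noncomputable def etaleOfOpen (U : X.Opens) : X.Etale := Etale.mk U.ι

lemma etaleOfOpen_le (U : X.Opens) :
    (⊤ : (etaleOfOpen U).left.Opens) ≤ (etaleOfOpen U).hom ⁻¹ᵁ U := fun x _ ↦ x.2

lemma bijective_etalePull_etaleOfOpen (U : X.Opens) :
    Function.Bijective (etalePull (etaleOfOpen U) (etaleOfOpen_le U)) := by
  have h := ConcreteCategory.bijective_of_isIso U.topIso.inv
  rw [← ι_appLE_top (fun x _ ↦ x.2)] at h
  exact h

lemma exists_etale_of_hom_eq {V Y : X.Etale} (x : V.left) (y : Y.left) (h : V.hom x = Y.hom y) :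
    ∃ (W : X.Etale) (f : W ⟶ V), Nonempty (W ⟶ Y) ∧ x ∈ Set.range f.left := by
  obtain ⟨z, hz, -⟩ := Scheme.Pullback.exists_preimage_pullback x y h
  let W : X.Etale := Etale.mk (pullback.fst V.hom Y.hom ≫ V.hom)
  exact ⟨W, etaleHomMk (W := W) (pullback.fst V.hom Y.hom) rfl,
    ⟨etaleHomMk (W := W) (pullback.snd V.hom Y.hom) pullback.condition.symm⟩,
    z, (congr_arg (fun g : W.left ⟶ V.left ↦ g z) (etaleHomMk_left _ _)).trans hz⟩

/-- The sieve of morphisms to `V` whose source maps to `Y`. -/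
def homSieve (V Y : X.Etale) : Sieve V where
  arrows W _ := Nonempty (W ⟶ Y)
  downward_closed := fun ⟨a⟩ g ↦ ⟨g ≫ a⟩

lemma homSieve_mem (U : X.Opens) (Y : X.Etale) (h : ∀ x ∈ U, ∃ y, Y.hom y = x) :
    homSieve (etaleOfOpen U) Y ∈ X.smallEtaleTopology (etaleOfOpen U) := by
  rw [mem_smallEtaleTopology_iff]
  intro x
  obtain ⟨y, hy⟩ := h ((etaleOfOpen U).hom x) x.2
  exact exists_etale_of_hom_eq x y hy.symm

/-- Two surjections are allowed so that sections over `U i ⊓ U j` can be compared on objects mapping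
both to the cover of `U i` and to that of `U j`: the intersection of the two sieves still covers. -/
lemma eq_of_etalePull_eq {U : X.Opens} {Y Y' : X.Etale} (h : ∀ x ∈ U, ∃ y, Y.hom y = x)
    (h' : ∀ x ∈ U, ∃ y, Y'.hom y = x) {s t : Γ(X, U)}
    (H : ∀ (W : X.Etale) (_ : W ⟶ Y) (_ : W ⟶ Y') (hW : (⊤ : W.left.Opens) ≤ W.hom ⁻¹ᵁ U),
      etalePull W hW s = etalePull W hW t) : s = t := by
  refine (bijective_etalePull_etaleOfOpen U).1 (etale_eq_of_locally_eq
    (X.smallEtaleTopology.intersection_covering (homSieve_mem U Y h) (homSieve_mem U Y' h'))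
    fun W f ⟨⟨a⟩, ⟨b⟩⟩ ↦ ?_)
  have hW := etale_le_of_hom f (etaleOfOpen_le U)
  rw [etaleRes_etalePull _ _ hW, etaleRes_etalePull _ _ hW]
  exact H W a b hW

/-- Objects over `U` that map to `Y` cover `U`. Since any two maps `Z ⟶ Y` pull `t` back to the same
function, choosing one map for each object gives a compatible family, which glues over `U`. -/
lemma exists_etalePull_eq {U : X.Opens} {Y : X.Etale} (hY : (⊤ : Y.left.Opens) ≤ Y.hom ⁻¹ᵁ U)
    (h : ∀ x ∈ U, ∃ y, Y.hom y = x) (t : Γ(Y.left, ⊤))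
    (ht : ∀ (Z : X.Etale) (a b : Z ⟶ Y), etaleRes a t = etaleRes b t) :
    ∃ s : Γ(X, U), etalePull Y hY s = t := by
  obtain ⟨s', hs'⟩ := etale_exists_glue (homSieve_mem U Y h)
    (fun W f hf ↦ etaleRes (show Nonempty (W ⟶ Y) from hf).some t) fun W W' f hf g ↦ by
      rw [← etaleRes_comp]
      exact ht _ _ _
  obtain ⟨s, rfl⟩ := (bijective_etalePull_etaleOfOpen U).2 s'
  have hr : Set.range Y.hom ⊆ Set.range U.ι := by
    rintro _ ⟨y, rfl⟩
    rw [Scheme.Opens.range_ι]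
    exact hY (x := y) trivial
  let l : Y.left ⟶ U := IsOpenImmersion.lift (Scheme.Opens.ι U) Y.hom hr
  let f : Y ⟶ etaleOfOpen U := etaleHomMk (V := etaleOfOpen U) l
    (IsOpenImmersion.lift_fac (Scheme.Opens.ι U) Y.hom hr)
  refine ⟨s, ?_⟩
  rw [← etaleRes_etalePull f (etaleOfOpen_le U), hs' f ⟨𝟙 Y⟩, ht Y _ (𝟙 Y), etaleRes_id]

open _root_.Polynomial in
/-- The étale algebra `R[√d]`. -/
noncomputable def sqrtPair {R : Type u} [CommRing R] (d : R) (hd : IsUnit d) (h2 : IsUnit (2 : R)) :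
    StandardEtalePair R where
  f := Polynomial.X ^ 2 - C d
  monic_f := monic_X_pow_sub_C d two_ne_zero
  g := 1
  cond := by
    obtain ⟨c, hc⟩ := h2.exists_right_inv
    obtain ⟨e, he⟩ := hd.exists_right_inv
    -- With `c = 1/2` and `e = 1/d`, the identity is `2X · (c e X) - e (X² - d) = e d = 1`: the
    -- derivative is a unit modulo `X² - d`.
    refine ⟨C (c * e) * Polynomial.X, -C e, 0, ?_⟩
    have hc' : (2 : R[X]) * C c = 1 := by
      rw [← map_one C, ← hc, C_mul]; rfl
    have he' : C d * C e = (1 : R[X]) := by rw [← C_mul, he, C_1]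
    simp only [derivative_sub, derivative_X_pow, derivative_C, C_mul]
    rw [show (C ((2 : ℕ) : R) : R[X]) = 2 from rfl]
    simp only [Nat.add_one_sub_one, pow_one]
    linear_combination he' + Polynomial.X ^ 2 * C e * hc'

lemma sqrtPair_hasMap {R S : Type u} [CommRing R] [CommRing S] [Algebra R S] (d : R) (hd : IsUnit d)
    (h2 : IsUnit (2 : R)) (x : S) :
    (sqrtPair d hd h2).HasMap x ↔ x * x = algebraMap R S d := by
  simp [StandardEtalePair.HasMap, sqrtPair, sub_eq_zero, pow_two]

/-- Over an algebraic closure of the residue field of `p` the element `d` has a square root; the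
kernel of the resulting map from `R[√d]` is a prime above `p`. -/
lemma sqrtPair_surjective {R : Type u} [CommRing R] (d : R) (hd : IsUnit d) (h2 : IsUnit (2 : R)) :
    Function.Surjective
      (PrimeSpectrum.comap (algebraMap R (sqrtPair d hd h2).Ring)) := by
  intro p
  let Ω := AlgebraicClosure p.asIdeal.ResidueField
  obtain ⟨x, hx⟩ := IsAlgClosed.exists_pow_nat_eq (algebraMap R Ω d) (n := 2) two_pos
  let φ : (sqrtPair d hd h2).Ring →ₐ[R] Ω :=
    (sqrtPair d hd h2).lift x ((sqrtPair_hasMap d hd h2 x).2 (by rw [← pow_two, hx]))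
  refine ⟨PrimeSpectrum.comap φ.toRingHom ⊥, ?_⟩
  ext r
  simp only [PrimeSpectrum.comap_asIdeal, Ideal.mem_comap]
  change φ (algebraMap R _ r) ∈ (⊥ : Ideal Ω) ↔ _
  rw [AlgHom.commutes, Ideal.mem_bot, IsScalarTower.algebraMap_apply R p.asIdeal.ResidueField Ω,
    map_eq_zero_iff _ (algebraMap p.asIdeal.ResidueField Ω).injective,
    Ideal.algebraMap_residueField_eq_zero]

/-- The cover is `Spec R[√d]` for `R = Γ(X, U)`, étale because 2 and `d` are units. Affineness of
`U` makes its composite with `Spec R ⟶ X` a cover of `U`. -/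
lemma exists_etale_sqrt {U : X.Opens} (hU : IsAffineOpen U) (h2 : IsUnit (2 : Γ(X, ⊤)))
    (d : Γ(X, U)) (hd : IsUnit d) :
    ∃ (Y : X.Etale) (hY : (⊤ : Y.left.Opens) ≤ Y.hom ⁻¹ᵁ U) (t : Γ(Y.left, ⊤)),
      (∀ x ∈ U, ∃ y, Y.hom y = x) ∧ t * t = etalePull Y hY d := by
  have h2' : IsUnit (2 : Γ(X, U)) := by
    have := h2.map (secRes (le_top : U ≤ ⊤))
    rwa [map_ofNat] at this
  let P := sqrtPair d hd h2'
  let φ : Γ(X, U) ⟶ CommRingCat.of P.Ring := CommRingCat.ofHom (algebraMap _ _)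
  have hφ : φ.hom.Etale := RingHom.etale_algebraMap.mpr inferInstance
  have : AlgebraicGeometry.Etale (Spec.map φ) :=
    (HasRingHomProperty.Spec_iff (P := @AlgebraicGeometry.Etale.{u})).mpr hφ
  let f := Spec.map φ ≫ hU.fromSpec
  have hf : (⊤ : (Spec (.of P.Ring)).Opens) ≤ f ⁻¹ᵁ U := by
    intro y _
    have : hU.fromSpec (Spec.map φ y) ∈ Set.range hU.fromSpec := ⟨_, rfl⟩
    rw [hU.range_fromSpec] at this
    exact this
  have happ : f.appLE U ⊤ hf = φ ≫ (Scheme.ΓSpecIso (.of P.Ring)).inv := by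
    have h1 : hU.fromSpec.appLE U ⊤ hU.fromSpec_preimage_self.ge = (Scheme.ΓSpecIso _).inv := by
      rw [Scheme.Hom.appLE, hU.fromSpec_app_self, Category.assoc, ← Functor.map_comp]
      exact (congr_arg (_ ≫ ·) ((Spec _).presheaf.map_id _)).trans (Category.comp_id _)
    rw [Scheme.ΓSpecIso_inv_naturality, ← h1]
    exact (appLE_comp_appTop (Spec.map φ) hU.fromSpec f rfl _ hf).symm
  refine ⟨Etale.mk f, hf, (Scheme.ΓSpecIso (.of P.Ring)).inv P.X, fun x hx ↦ ?_, ?_⟩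
  · have : x ∈ Set.range hU.fromSpec := by rw [hU.range_fromSpec]; exact hx
    obtain ⟨p, rfl⟩ := this
    obtain ⟨y, hy⟩ := sqrtPair_surjective d hd h2' p
    exact ⟨y, congr_arg hU.fromSpec hy⟩
  · refine Eq.trans ?_ (congr_arg (fun g ↦ g.hom d) happ).symm
    have := (sqrtPair_hasMap d hd h2' P.X).1 P.hasMap_X
    exact (map_mul (Scheme.ΓSpecIso (.of P.Ring)).inv.hom P.X P.X).symm.trans
      (congr_arg (Scheme.ΓSpecIso (.of P.Ring)).inv.hom this)

end AlgebraicGeometry.Scheme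

/-! ### Compatible square roots from the vanishing of `H¹`. -/

namespace AlgebraicGeometry.Scheme

open CechDescent CechDescent.prodFamily

variable {X : Scheme.{u}}

lemma coverSieve_mem_smallEtaleTopology {ι : Type u} (Y : ι → X.Etale)
    (h : ∀ x : X, ∃ i y, (Y i).hom y = x) (V : X.Etale) :
    coverSieve Y V ∈ X.smallEtaleTopology V := by
  rw [mem_smallEtaleTopology_iff]
  intro x
  obtain ⟨i, y, hy⟩ := h (V.hom x)
  obtain ⟨W, f, ⟨a⟩, hf⟩ := exists_etale_of_hom_eq x y hy.symm
  exact ⟨W, f, ⟨i, ⟨a⟩⟩, hf⟩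

variable (X) in
/-- `X` is a final object of its étale site. -/
noncomputable def etaleTerminal : IsTerminal (Etale.mk (𝟙 X) : X.Etale) :=
  IsTerminal.ofUniqueHom
    (fun V ↦ etaleHomMk (V := Etale.mk (𝟙 X)) V.hom (Category.comp_id _))
    fun V m ↦ (Etale.forget X).map_injective
      (Over.OverMorphism.ext (by
        refine Eq.trans ?_ (etaleHomMk_left (V := Etale.mk (𝟙 X)) V.hom (Category.comp_id _)).symm
        exact (Category.comp_id _).symm.trans (etale_w m)))

lemma muTwoVal_eq_mul_of_eq_sub {V : X.Etale} {x y z : X.muTwoPresheaf.obj (op V)}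
    (h : x = y - z) : muTwoVal y = muTwoVal x * muTwoVal z := by
  rw [← muTwoVal_add, h, sub_add_cancel]

/-- A system `E` natural in `Z` is determined by its value at the universal pair of maps, the
projections from `T ⨯ (Y i ⨯ Y j)`. -/
lemma exists_muTwo_prodFamily {ι : Type u} (Y : ι → X.Etale)
    (E : ∀ (i j : ι) (Z : X.Etale) (_ : Z ⟶ Y i) (_ : Z ⟶ Y j), Γ(Z.left, ⊤))
    (hEmap : ∀ i j Z Z' (f : Z' ⟶ Z) (a : Z ⟶ Y i) (b : Z ⟶ Y j),
      etaleRes f (E i j Z a b) = E i j Z' (f ≫ a) (f ≫ b))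
    (hEsq : ∀ i j Z (a : Z ⟶ Y i) (b : Z ⟶ Y j), E i j Z a b * E i j Z a b = 1) (T : X.Etale) :
    ∃ η : (prodFamily X.muTwoPresheaf fun p : ι × ι ↦ Y p.1 ⨯ Y p.2).obj (op T),
      ∀ (i j : ι) (Z : X.Etale) (v : Z ⟶ T) (a : Z ⟶ Y i) (b : Z ⟶ Y j),
        muTwoVal (ev η (i, j) v (prod.lift a b)) = E i j Z a b := by
  refine ⟨prodFamily.mk fun p ↦ muTwoMk (E p.1 p.2 _ (prod.snd ≫ prod.fst) (prod.snd ≫ prod.snd))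
      (hEsq _ _ _ _ _), fun i j Z v a b ↦ ?_⟩
  refine (hEmap i j _ Z (prod.lift v (prod.lift a b)) (prod.snd ≫ prod.fst)
    (prod.snd ≫ prod.snd)).trans ?_
  congr 1
  · rw [prod.lift_snd_assoc, prod.lift_fst]
  · rw [prod.lift_snd_assoc, prod.lift_snd]

lemma exists_muTwo_eq_coboundary (h2 : IsUnit (2 : Γ(X, ⊤)))
    (hX : Subsingleton (X.EtaleCohomology (AddCommGrpCat.of (ULift.{u} (ZMod 2))) 1))
    {ι : Type u} (Y : ι → X.Etale) (h : ∀ x : X, ∃ i y, (Y i).hom y = x)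
    (η : (prodFamily X.muTwoPresheaf fun p : ι × ι ↦ Y p.1 ⨯ Y p.2).obj (op (Etale.mk (𝟙 X))))
    (hη : IsCechCocycle Y η) :
    ∃ ξ : (prodFamily X.muTwoPresheaf Y).obj (op (Etale.mk (𝟙 X))), coboundary Y ξ = η :=
  exists_eq_coboundary (J := X.smallEtaleTopology) (U := Y) (F := X.muTwo)
    (etaleTerminal X) (coverSieve_mem_smallEtaleTopology Y h) (subsingleton_H_muTwo h2 hX) η hη

lemma exists_of_coboundary {ι : Type u} (Y : ι → X.Etale)
    (ξ : (prodFamily X.muTwoPresheaf Y).obj (op (Etale.mk (𝟙 X))))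
    (E : ∀ (i j : ι) (Z : X.Etale) (_ : Z ⟶ Y i) (_ : Z ⟶ Y j), Γ(Z.left, ⊤))
    (hξ : ∀ (i j : ι) (Z : X.Etale) (a : Z ⟶ Y i) (b : Z ⟶ Y j),
      muTwoVal (ev (coboundary Y ξ) (i, j) ((etaleTerminal X).from Z) (prod.lift a b)) =
        E i j Z a b) :
    ∃ e : ∀ i, Γ((Y i).left, ⊤), (∀ i, e i * e i = 1) ∧
      ∀ i j Z (a : Z ⟶ Y i) (b : Z ⟶ Y j),
        etaleRes a (e i) = E i j Z a b * etaleRes b (e j) := by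
  have hmap (i : ι) (Z : X.Etale) (a : Z ⟶ Y i) :
      etaleRes a (muTwoVal (ev ξ i ((etaleTerminal X).from (Y i)) (𝟙 (Y i)))) =
        muTwoVal (ev ξ i ((etaleTerminal X).from Z) a) := by
    have := map_ev ξ i a ((etaleTerminal X).from (Y i)) (𝟙 (Y i))
    rw [Category.comp_id, (etaleTerminal X).hom_ext (a ≫ _) ((etaleTerminal X).from Z)] at this
    exact congr_arg muTwoVal this
  refine ⟨fun i ↦ muTwoVal (ev ξ i ((etaleTerminal X).from _) (𝟙 (Y i))),
    fun i ↦ muTwoVal_mul_self _, fun i j Z a b ↦ ?_⟩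
  rw [hmap, hmap, ← hξ i j Z a b]
  exact muTwoVal_eq_mul_of_eq_sub (ev_coboundary ..)

/-- A system of `±1`-valued sections satisfying the cocycle condition is a coboundary when
`H¹_ét(X, ℤ/2) = 0`. -/
theorem exists_muTwo_coboundary (h2 : IsUnit (2 : Γ(X, ⊤)))
    (hX : Subsingleton (X.EtaleCohomology (AddCommGrpCat.of (ULift.{u} (ZMod 2))) 1))
    {ι : Type u} (Y : ι → X.Etale) (h : ∀ x : X, ∃ i y, (Y i).hom y = x)
    (E : ∀ (i j : ι) (Z : X.Etale) (_ : Z ⟶ Y i) (_ : Z ⟶ Y j), Γ(Z.left, ⊤))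
    (hEmap : ∀ i j Z Z' (f : Z' ⟶ Z) (a : Z ⟶ Y i) (b : Z ⟶ Y j),
      etaleRes f (E i j Z a b) = E i j Z' (f ≫ a) (f ≫ b))
    (hEsq : ∀ i j Z (a : Z ⟶ Y i) (b : Z ⟶ Y j), E i j Z a b * E i j Z a b = 1)
    (hE : ∀ i j k Z (a : Z ⟶ Y i) (b : Z ⟶ Y j) (c : Z ⟶ Y k),
      E i j Z a b * E j k Z b c = E i k Z a c) :
    ∃ e : ∀ i, Γ((Y i).left, ⊤), (∀ i, e i * e i = 1) ∧
      ∀ i j Z (a : Z ⟶ Y i) (b : Z ⟶ Y j),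
        etaleRes a (e i) = E i j Z a b * etaleRes b (e j) := by
  obtain ⟨η, hη⟩ := exists_muTwo_prodFamily Y E hEmap hEsq (Etale.mk (𝟙 X))
  have hcoc : IsCechCocycle Y η := fun i j k Z v a b c ↦ muTwoVal_injective
    ((muTwoVal_add _ _).trans ((congr_arg₂ _ (hη i j Z v a b) (hη j k Z v b c)).trans
      ((hE i j k Z a b c).trans (hη i k Z v a c).symm)))
  obtain ⟨ξ, hξ⟩ := exists_muTwo_eq_coboundary h2 hX Y h η hcoc
  exact exists_of_coboundary Y ξ E fun i j Z a b ↦ hξ ▸ hη i j Z _ a b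

/-- The expression is the sign `q / (t t')` comparing two square roots of `d d'`, with `c`, `c'`
inverse to `d`, `d'`. This lemma and the next two give its square, its cocycle identity and the
effect of splitting it. -/
lemma sq_mul_inv_eq_one {R : Type*} [CommRing R] {t t' q c c' d d' : R} (h : t * t = d)
    (h' : t' * t' = d') (hq : q * q = d * d') (hc : d * c = 1) (hc' : d' * c' = 1) :
    t * t' * q * (c * c') * (t * t' * q * (c * c')) = 1 := by
  calc _ = (t * t) * (t' * t') * (q * q) * (c * c) * (c' * c') := by ring
    _ = (d * c) * (d * c) * ((d' * c') * (d' * c')) := by rw [h, h', hq]; ring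
    _ = 1 := by rw [hc, hc']; ring

lemma mul_inv_cocycle {R : Type*} [CommRing R] {t t' t'' q q' q'' c c' c'' d' : R}
    (h' : t' * t' = d') (hq : q * q' = d' * q'') (hc' : d' * c' = 1) :
    t * t' * q * (c * c') * (t' * t'' * q' * (c' * c'')) = t * t'' * q'' * (c * c'') := by
  calc _ = t * t'' * (t' * t') * (q * q') * (c * c'') * (c' * c') := by ring
    _ = t * t'' * q'' * (c * c'') * ((d' * c') * (d' * c')) := by rw [h', hq]; ring
    _ = _ := by rw [hc']; ring

lemma coboundary_mul_eq {R : Type*} [CommRing R] {t t' q c c' d d' e' : R} (h : t * t = d)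
    (h' : t' * t' = d') (hc : d * c = 1) (hc' : d' * c' = 1) (he : e' * e' = 1) :
    t * t' * q * (c * c') * e' * t * (e' * t') = q := by
  calc _ = (t * t) * (t' * t') * q * (c * c') * (e' * e') := by ring
    _ = q * (d * c) * (d' * c') := by rw [h, h', he]; ring
    _ = _ := by rw [hc', hc]; ring

/-- If `H¹_ét(X, ℤ/2) = 0`, then a square root of a line bundle cocycle exists: for units `d i` on
an affine cover and a compatible system `q i j` of square roots of `d i * d j`, there are square
roots `s i` of `d i` with `s i * s j = q i j`. -/
theorem exists_sqrt_sections (h2 : IsUnit (2 : Γ(X, ⊤)))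
    (hX : Subsingleton (X.EtaleCohomology (AddCommGrpCat.of (ULift.{u} (ZMod 2))) 1))
    {ι : Type u} (U : ι → X.Opens) (hU : ∀ i, IsAffineOpen (U i)) (cov : ∀ x, ∃ i, x ∈ U i)
    (d : ∀ i, Γ(X, U i)) (hd : ∀ i, IsUnit (d i)) (q : ∀ i j, Γ(X, U i ⊓ U j))
    (hq : ∀ i j, q i j * q i j = secRes inf_le_left (d i) * secRes inf_le_right (d j))
    (hq' : ∀ (i j k : ι) (W : X.Opens) (hi : W ≤ U i) (hj : W ≤ U j) (hk : W ≤ U k),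
      secRes (le_inf hi hj) (q i j) * secRes (le_inf hj hk) (q j k) =
        secRes hj (d j) * secRes (le_inf hi hk) (q i k)) :
    ∃ s : ∀ i, Γ(X, U i), (∀ i, s i * s i = d i) ∧
      ∀ i j, secRes inf_le_left (s i) * secRes inf_le_right (s j) = q i j := by
  choose Y hY t hsurj ht using fun i ↦ exists_etale_sqrt (hU i) h2 (d i) (hd i)
  choose c hc using fun i ↦ (hd i).exists_right_inv
  have hin {i j : ι} {Z : X.Etale} (a : Z ⟶ Y i) (b : Z ⟶ Y j) :
      (⊤ : Z.left.Opens) ≤ Z.hom ⁻¹ᵁ (U i ⊓ U j) := fun _ hx ↦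
    ⟨etale_le_of_hom a (hY i) (by exact hx), etale_le_of_hom b (hY j) (by exact hx)⟩
  have ht' {i : ι} {Z : X.Etale} (a : Z ⟶ Y i) :
      etaleRes a (t i) * etaleRes a (t i) = etalePull Z (etale_le_of_hom a (hY i)) (d i) := by
    rw [← map_mul, ht, etaleRes_etalePull]
  have hc' {i : ι} {Z : X.Etale} (a : Z ⟶ Y i) : etalePull Z (etale_le_of_hom a (hY i)) (d i) *
      etalePull Z (etale_le_of_hom a (hY i)) (c i) = 1 := by
    rw [← map_mul, hc, map_one]
  have hqq {i j : ι} {Z : X.Etale} (a : Z ⟶ Y i) (b : Z ⟶ Y j) :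
      etalePull Z (hin a b) (q i j) * etalePull Z (hin a b) (q i j) =
        etalePull Z (etale_le_of_hom a (hY i)) (d i) *
          etalePull Z (etale_le_of_hom b (hY j)) (d j) := by
    rw [← map_mul, hq, map_mul, etalePull_secRes, etalePull_secRes]
  have hqqq {i j k : ι} {Z : X.Etale} (a : Z ⟶ Y i) (b : Z ⟶ Y j) (e : Z ⟶ Y k) :
      etalePull Z (hin a b) (q i j) * etalePull Z (hin b e) (q j k) =
        etalePull Z (etale_le_of_hom b (hY j)) (d j) * etalePull Z (hin a e) (q i k) := by
    have hW : (⊤ : Z.left.Opens) ≤ Z.hom ⁻¹ᵁ (U i ⊓ U j ⊓ U k) := fun _ hx ↦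
      ⟨hin a b (by exact hx), etale_le_of_hom e (hY k) (by exact hx)⟩
    have := congr_arg (etalePull Z hW) (hq' i j k (U i ⊓ U j ⊓ U k) (inf_le_left.trans inf_le_left)
      (inf_le_left.trans inf_le_right) inf_le_right)
    rwa [map_mul, map_mul, etalePull_secRes _ _ _ (hin a b), etalePull_secRes _ _ _ (hin b e),
      etalePull_secRes _ _ _ (etale_le_of_hom b (hY j)),
      etalePull_secRes _ _ _ (hin a e)] at this
  -- The cocycle is `qᵢⱼ / (tᵢ tⱼ)`, written with the inverses `c` of `d`. Its splitting `e` is a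
  -- choice of signs for which `(eᵢ tᵢ)(eⱼ tⱼ) = qᵢⱼ`.
  obtain ⟨e, he, heE⟩ := exists_muTwo_coboundary h2 hX Y
    (fun x ↦ by
      obtain ⟨i, hi⟩ := cov x
      exact ⟨i, hsurj i x hi⟩)
    (fun i j Z a b ↦ etaleRes a (t i) * etaleRes b (t j) * etalePull Z (hin a b) (q i j) *
      (etalePull Z (etale_le_of_hom a (hY i)) (c i) * etalePull Z (etale_le_of_hom b (hY j)) (c j)))
    (fun i j Z Z' f a b ↦ by
      simp only [map_mul, etaleRes_comp]
      rw [etaleRes_etalePull f _ (hin (f ≫ a) (f ≫ b)),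
        etaleRes_etalePull f _ (etale_le_of_hom (f ≫ a) (hY i)),
        etaleRes_etalePull f _ (etale_le_of_hom (f ≫ b) (hY j))])
    (fun i j Z a b ↦ by
      exact sq_mul_inv_eq_one (ht' a) (ht' b) (hqq a b) (hc' a) (hc' b))
    (fun i j k Z a b e ↦ mul_inv_cocycle (ht' b) (hqqq a b e) (hc' b))
  have hee (i j : ι) (Z : X.Etale) (a : Z ⟶ Y i) (b : Z ⟶ Y j) :
      etaleRes a (e i * t i) * etaleRes b (e j * t j) = etalePull Z (hin a b) (q i j) := by
    rw [map_mul, map_mul, heE i j Z a b]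
    have h1 := congr_arg (etaleRes b) (he j)
    rw [map_mul, map_one] at h1
    exact coboundary_mul_eq (ht' a) (ht' b) (hc' a) (hc' b) h1
  -- The relation for the triple `i, i, i` reads `qᵢᵢ² = dᵢ qᵢᵢ`, while `qᵢᵢ² = dᵢ²`; cancelling the
  -- unit `dᵢ` gives `qᵢᵢ = dᵢ`.
  have hqi {i : ι} {Z : X.Etale} (a b : Z ⟶ Y i) : etalePull Z (hin a b) (q i i) =
      etalePull Z (etale_le_of_hom a (hY i)) (d i) := by
    have h1 := hqq a b
    have h3 := hc' a
    rw [hqqq a b b] at h1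
    linear_combination etalePull Z (etale_le_of_hom a (hY i)) (c i) * h1 +
      (etalePull Z (etale_le_of_hom a (hY i)) (d i) - etalePull Z (hin a b) (q i i)) * h3
  -- Let `A`, `B` be the pullbacks of `eᵢ tᵢ` along `a`, `b`. Then `A B = dᵢ = B B`, so `B` is a
  -- unit and `A = B`: the corrected root descends to `U i`.
  have hex (i : ι) := exists_etalePull_eq (hY i) (hsurj i) (e i * t i) fun Z a b ↦ by
    have h1 := (hee i i Z a b).trans (hqi a b)
    have h3 := (hee i i Z b b).trans (hqi b b)
    have h4 := hc' a
    linear_combination etaleRes b (e i * t i) * etalePull Z (etale_le_of_hom a (hY i)) (c i) *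
      (h1 - h3) + (etaleRes b (e i * t i) - etaleRes a (e i * t i)) *
      (h4 + etalePull Z (etale_le_of_hom a (hY i)) (c i) * h3)
  choose s hs using hex
  refine ⟨s, fun i ↦ ?_, fun i j ↦ ?_⟩
  · refine eq_of_etalePull_eq (hsurj i) (hsurj i) fun W a _ hW ↦ ?_
    rw [map_mul, ← etaleRes_etalePull a (hY i), hs, hee, hqi a a]
  · refine eq_of_etalePull_eq (U := U i ⊓ U j) (fun x hx ↦ hsurj i x hx.1)
      (fun x hx ↦ hsurj j x hx.2)
      (fun W a b hW ↦ ?_)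
    rw [map_mul, etalePull_secRes _ _ _ (etale_le_of_hom a (hY i)),
      etalePull_secRes _ _ _ (etale_le_of_hom b (hY j)), ← etaleRes_etalePull a (hY i),
      ← etaleRes_etalePull b (hY j), hs, hs, hee]

end AlgebraicGeometry.Scheme

/-! ### Sections of modules, gluing, and local bases. -/

namespace AlgebraicGeometry.Scheme.Modules

variable {X : Scheme.{u}} {M N : X.Modules}

/-- Restriction of sections of an `𝒪_X`-module. -/
noncomputable def res (M : X.Modules) {U V : X.Opens} (h : V ≤ U) : Γ(M, U) →+ Γ(M, V) :=
  (M.presheaf.map (homOfLE h).op).hom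

lemma res_res {U V W : X.Opens} (h : V ≤ U) (h' : W ≤ V) (s : Γ(M, U)) :
    M.res h' (M.res h s) = M.res (h'.trans h) s := by
  change (M.presheaf.map _) ((M.presheaf.map _) s) = _
  rw [← ConcreteCategory.comp_apply, ← Functor.map_comp]
  rfl

lemma res_self {U : X.Opens} (h : U ≤ U) (s : Γ(M, U)) : M.res h s = s := by
  change M.presheaf.map (𝟙 (op U)) s = s
  rw [M.presheaf.map_id]
  rfl

lemma res_smul {U V : X.Opens} (h : V ≤ U) (r : Γ(X, U)) (s : Γ(M, U)) :
    M.res h (r • s) = secRes h r • M.res h s :=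
  map_smul M (homOfLE h) r s

lemma app_res (φ : M ⟶ N) {U V : X.Opens} (h : V ≤ U) (s : Γ(M, U)) :
    φ.app V (M.res h s) = N.res h (φ.app U s) :=
  congr_arg (fun f ↦ f s) (φ.mapPresheaf.naturality (homOfLE h).op)

/-- The linear map on sections induced by a morphism of `𝒪_X`-modules. -/
noncomputable def appₗ (φ : M ⟶ N) (U : X.Opens) : Γ(M, U) →ₗ[Γ(X, U)] Γ(N, U) where
  toFun := φ.app U
  map_add' := map_add _
  map_smul' r s := Hom.app_smul φ r s

/-- Constructor for morphisms of `𝒪_X`-modules. -/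
noncomputable def homMk (f : ∀ U : X.Opens, Γ(M, U) →ₗ[Γ(X, U)] Γ(N, U))
    (hf : ∀ {U V : X.Opens} (h : V ≤ U) (s : Γ(M, U)), f V (M.res h s) = N.res h (f U s)) :
    M ⟶ N where
  val := PresheafOfModules.homMk
    { app U := AddCommGrpCat.ofHom (f U.unop).toAddMonoidHom
      naturality _ _ i := AddCommGrpCat.hom_ext (AddMonoidHom.ext fun s ↦ hf i.unop.le s) }
    fun U r s ↦ (f U.unop).map_smul r s

lemma hom_ext_apply {φ ψ : M ⟶ N} (h : ∀ U (s : Γ(M, U)), φ.app U s = ψ.app U s) : φ = ψ :=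
  hom_ext _ _ fun U ↦ AddCommGrpCat.hom_ext (AddMonoidHom.ext (h U))

lemma isIso_of_bijective_app (φ : M ⟶ N) (h : ∀ U, Function.Bijective (φ.app U)) : IsIso φ :=
  Hom.isIso_iff_isIso_app.2 fun U ↦ (ConcreteCategory.isIso_iff_bijective _).2 (h U)

lemma eq_of_locally_eq {U : X.Opens} {s t : Γ(M, U)}
    (h : ∀ x ∈ U, ∃ (V : X.Opens) (hV : V ≤ U), x ∈ V ∧ M.res hV s = M.res hV t) : s = t := by
  choose! V hV hx h using h
  let F : TopCat.Sheaf Ab.{u} X := ⟨M.presheaf, M.isSheaf⟩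
  refine F.eq_of_locally_eq' (fun x : U ↦ V x.1) U (fun x ↦ homOfLE (hV x.1 x.2))
    (fun x hxU ↦ Opens.mem_iSup.2 ⟨⟨x, hxU⟩, hx x hxU⟩) s t fun x ↦ h x.1 x.2

lemma exists_glue {κ : Type u} (V : κ → X.Opens) {U : X.Opens} (hV : ∀ k, V k ≤ U)
    (cov : ∀ x ∈ U, ∃ k, x ∈ V k) (s : ∀ k, Γ(M, V k))
    (h : ∀ k l, M.res (inf_le_left : V k ⊓ V l ≤ V k) (s k) =
      M.res (inf_le_right : V k ⊓ V l ≤ V l) (s l)) :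
    ∃ t : Γ(M, U), ∀ k, M.res (hV k) t = s k := by
  let F : TopCat.Sheaf Ab.{u} X := ⟨M.presheaf, M.isSheaf⟩
  exact (F.existsUnique_gluing' V U (fun k ↦ homOfLE (hV k))
    (fun x hxU ↦ Opens.mem_iSup.2 (cov x hxU)) s h).exists

variable (M) in
/-- The sections `b` form a basis of `M` on `U`: over each open `V ≤ U` their restrictions form a
basis of the module of sections. -/
def IsLocalBasis {ι : Type*} [Fintype ι] {U : X.Opens} (b : ι → Γ(M, U)) : Prop :=
  ∀ (V : X.Opens) (h : V ≤ U),
    Function.Bijective fun c : ι → Γ(X, V) ↦ ∑ i, c i • M.res h (b i)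

namespace IsLocalBasis

variable {ι : Type*} [Fintype ι] {U : X.Opens} {b : ι → Γ(M, U)}

lemma res (hb : M.IsLocalBasis b) {V : X.Opens} (h : V ≤ U) :
    M.IsLocalBasis fun i ↦ M.res h (b i) := by
  intro W hW
  simp only [res_res]
  exact hb W (hW.trans h)

/-- The basis of sections given by a local basis. -/
noncomputable def basis [DecidableEq ι] (hb : M.IsLocalBasis b) : Module.Basis ι Γ(X, U) Γ(M, U) :=
  Module.Basis.ofEquivFun (LinearEquiv.symm (LinearEquiv.ofBijective
    (Fintype.linearCombination Γ(X, U) b) (by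
      have := hb U le_rfl
      simp only [res_self] at this
      exact this)))

lemma basis_apply [DecidableEq ι] (hb : M.IsLocalBasis b) (i : ι) : hb.basis i = b i := by
  simp only [basis, Module.Basis.coe_ofEquivFun, LinearEquiv.symm_symm]
  exact (Fintype.linearCombination_apply_single ..).trans (one_smul _ _)

lemma reindex {ι' : Type*} [Fintype ι'] (e : ι' ≃ ι) (hb : M.IsLocalBasis b) :
    M.IsLocalBasis (b ∘ e) := by
  intro V hV
  have h1 : (fun c : ι' → Γ(X, V) ↦ ∑ i, c i • M.res hV ((b ∘ e) i)) =
      (fun c : ι → Γ(X, V) ↦ ∑ i, c i • M.res hV (b i)) ∘ fun c ↦ c ∘ e.symm := by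
    funext c
    exact Fintype.sum_equiv e _ _ fun i ↦ by simp
  rw [h1]
  exact (hb V hV).comp (e.arrowCongr (Equiv.refl _)).bijective

lemma of_bijective {φ : M ⟶ N} (hb : M.IsLocalBasis b)
    (h : ∀ V ≤ U, Function.Bijective (φ.app V)) : N.IsLocalBasis fun i ↦ φ.app U (b i) := by
  intro V hV
  have e : (fun c : ι → Γ(X, V) ↦ ∑ i, c i • N.res hV (φ.app U (b i))) =
      φ.app V ∘ fun c : ι → Γ(X, V) ↦ ∑ i, c i • M.res hV (b i) := by
    funext c
    simp only [Function.comp_apply, map_sum, Hom.app_smul, app_res]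
  rw [e]
  exact (h V hV).comp (hb V hV)

end IsLocalBasis

variable (X) in
/-- The structure sheaf as a module over itself. -/
noncomputable def unitMod : X.Modules := SheafOfModules.unit X.ringCatSheaf

variable (X) in
/-- The free module on a type. -/
noncomputable def freeMod (I : Type u) : X.Modules := SheafOfModules.free (R := X.ringCatSheaf) I

/-- The section `1` of the structure sheaf. -/
noncomputable def unitOne (U : X.Opens) : Γ(unitMod X, U) := (1 : Γ(X, U))

lemma smul_unitOne {U : X.Opens} (s : Γ(X, U)) : s • unitOne U = (show Γ(unitMod X, U) from s) :=
  mul_one s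

/-- The morphism from the structure sheaf given by a global section. -/
noncomputable def unitTo (s : Γ(M, ⊤)) : unitMod X ⟶ M :=
  homMk (fun U ↦ (LinearMap.toSpanSingleton Γ(X, U) _ (M.res le_top s) :
      Γ(X, U) →ₗ[Γ(X, U)] Γ(M, U))) fun {U V} h r ↦ by
    refine Eq.trans ?_ (res_smul h (show Γ(X, U) from r) (M.res le_top s)).symm
    rw [res_res]
    rfl

lemma unitTo_app (s : Γ(M, ⊤)) (U : X.Opens) (r : Γ(X, U)) :
    (unitTo s).app U (show Γ(unitMod X, U) from r) = r • M.res le_top s := rfl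

lemma unit_hom_ext {φ ψ : unitMod X ⟶ M} (h : φ.app ⊤ (unitOne ⊤) = ψ.app ⊤ (unitOne ⊤)) :
    φ = ψ := by
  refine hom_ext_apply fun U s ↦ ?_
  have h1 : s = (show Γ(X, U) from s) • (unitMod X).res le_top (unitOne ⊤) := by
    refine (smul_unitOne (show Γ(X, U) from s)).symm.trans (congr_arg _ ?_)
    exact (map_one (secRes (le_top : U ≤ ⊤))).symm
  rw [h1, Hom.app_smul, Hom.app_smul, app_res, app_res, h]

/-- The inclusions of the free module. -/
noncomputable def freeι {I : Type u} (i : I) : unitMod X ⟶ freeMod X I :=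
  SheafOfModules.ιFree (R := X.ringCatSheaf) i

lemma exists_freeDesc {I : Type u} (f : I → (unitMod X ⟶ M)) :
    ∃ φ : freeMod X I ⟶ M, ∀ i, freeι i ≫ φ = f i :=
  ⟨Cofan.IsColimit.desc (SheafOfModules.isColimitFreeCofan (R := X.ringCatSheaf) I) f, fun i ↦
    Cofan.IsColimit.fac (SheafOfModules.isColimitFreeCofan (R := X.ringCatSheaf) I) f i⟩

lemma free_hom_ext {I : Type u} {φ ψ : freeMod X I ⟶ M} (h : ∀ i, freeι i ≫ φ = freeι i ≫ ψ) :
    φ = ψ :=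
  Cofan.IsColimit.hom_ext (SheafOfModules.isColimitFreeCofan (R := X.ringCatSheaf) I) φ ψ h

/-- The standard sections of the free module. -/
noncomputable def freeBasis {I : Type u} (i : I) : Γ(freeMod X I, ⊤) :=
  (freeι i).app ⊤ (unitOne ⊤)

lemma freeι_app {I : Type u} (i : I) (U : X.Opens) (r : Γ(X, U)) :
    (freeι i).app U (show Γ(unitMod X, U) from r) = r • (freeMod X I).res le_top (freeBasis i) := by
  have : freeι (X := X) i = unitTo (freeBasis i) := unit_hom_ext (by
    refine Eq.trans ?_ (unitTo_app (freeBasis i) ⊤ (1 : Γ(X, ⊤))).symm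
    rw [res_self, one_smul]
    rfl)
  rw [this, unitTo_app]

/-- The universal property gives coordinate projections `p j`, and finiteness of `I` gives `∑ j, p j
≫ freeι j = 𝟙`. Coordinates of sections are thus read off by the `p j`, without describing sections
of the coproduct. -/
lemma isLocalBasis_freeBasis (I : Type u) [Fintype I] :
    (freeMod X I).IsLocalBasis (freeBasis (X := X) (I := I)) := by
  classical
  choose p hp using fun j : I ↦ exists_freeDesc fun i : I ↦ if i = j then 𝟙 (unitMod X) else 0
  have hsum : ∑ j, p j ≫ freeι j = 𝟙 (freeMod X I) := free_hom_ext fun i ↦ by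
    rw [Preadditive.comp_sum, Finset.sum_eq_single i]
    · rw [← Category.assoc, hp, if_pos rfl, Category.id_comp, Category.comp_id]
    · intro j _ hj
      rw [← Category.assoc, hp, if_neg hj.symm, zero_comp]
    · simp
  have sum_app (U : X.Opens) (s : Γ(freeMod X I, U)) (f : I → (freeMod X I ⟶ freeMod X I)) :
      (∑ j, f j).app U s = ∑ j, (f j).app U s :=
    map_sum (AddMonoidHom.mk' (fun f : freeMod X I ⟶ freeMod X I ↦ f.app U s) fun _ _ ↦ rfl) f _
  intro V hV
  have key (c : I → Γ(X, V)) (j : I) :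
      (p j).app V (∑ i, c i • (freeMod X I).res hV (freeBasis i)) = c j := by
    rw [map_sum, Finset.sum_eq_single j]
    · rw [← freeι_app, ← ConcreteCategory.comp_apply, ← Hom.comp_app, hp, if_pos rfl]
      rfl
    · intro i _ hi
      rw [← freeι_app, ← ConcreteCategory.comp_apply, ← Hom.comp_app, hp, if_neg hi]
      rfl
    · simp
  refine ⟨fun c c' h ↦ funext fun j ↦ ?_, fun s ↦ ⟨fun j ↦ (p j).app V s, ?_⟩⟩
  · rw [← key c j, ← key c' j]
    exact congr_arg _ h
  · refine (Finset.sum_congr rfl fun j _ ↦ (freeι_app j V ((p j).app V s)).symm).trans ?_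
    exact (sum_app V s fun j ↦ p j ≫ freeι j).symm.trans (congr_arg (fun φ ↦ Hom.app φ V s) hsum)

lemma exists_freeMod_iso_of_isLocalBasis {I : Type u} [Fintype I] {b : I → Γ(M, ⊤)}
    (hb : M.IsLocalBasis b) : Nonempty (M ≅ freeMod X I) := by
  obtain ⟨φ, hφ⟩ := exists_freeDesc fun i ↦ unitTo (b i)
  have h1 (i : I) : φ.app ⊤ (freeBasis i) = b i := by
    have := congr_arg (fun ψ ↦ ψ.app ⊤ (unitOne ⊤)) (hφ i)
    refine this.trans ((unitTo_app (b i) ⊤ (1 : Γ(X, ⊤))).trans ?_)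
    rw [res_self, one_smul]
  have : IsIso φ := isIso_of_bijective_app φ fun U ↦ by
    have e : (fun c : I → Γ(X, U) ↦ ∑ i, c i • M.res le_top (b i)) =
        φ.app U ∘ fun c : I → Γ(X, U) ↦ ∑ i, c i • (freeMod X I).res le_top (freeBasis i) := by
      funext c
      simp only [Function.comp_apply, map_sum, Hom.app_smul, app_res, h1]
    have h2 := hb U le_top
    rw [e] at h2
    exact (Function.Bijective.of_comp_iff _ (isLocalBasis_freeBasis I U le_top)).1 h2
  exact ⟨(asIso φ).symm⟩

section Restrict

variable {U : X.Opens}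

lemma image_le (V : (U : Scheme.{u}).Opens) : U.ι ''ᵁ V ≤ U := by
  rintro _ ⟨x, -, rfl⟩
  exact x.2

lemma restrict_sum_smul {ι : Type*} [Fintype ι] (b : ι → Γ(M, U)) (V : (U : Scheme.{u}).Opens)
    (c : ι → Γ(X, U.ι ''ᵁ V)) :
    ∑ i, ((U.ι.appIso V).hom (c i)) • (M.restrict U.ι).res le_top
      (show Γ(M.restrict U.ι, ⊤) from M.res (image_le ⊤) (b i)) =
    (show Γ(M.restrict U.ι, V) from ∑ i, c i • M.res (image_le V) (b i)) := by
  refine Finset.sum_congr rfl fun i _ ↦ ?_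
  have h1 : (U.ι.appIso V).inv ((U.ι.appIso V).hom (c i)) = c i := by
    rw [← ConcreteCategory.comp_apply, Iso.hom_inv_id]
    rfl
  have h2 := res_res (M := M) (image_le (⊤ : (U : Scheme.{u}).Opens))
    (Scheme.Hom.image_mono U.ι (le_top : V ≤ ⊤)) (b i)
  rw [← h2]
  exact congr_arg₂ (fun (r : Γ(X, U.ι ''ᵁ V)) (s : Γ(M, U.ι ''ᵁ V)) ↦ r • s) h1 rfl

/-- Opens of the scheme `U` are the opens of `X` below `U`, via image and preimage, and `appIso`
identifies the rings of scalars on the two sides. -/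
lemma isLocalBasis_restrict_iff {ι : Type*} [Fintype ι] (b : ι → Γ(M, U)) :
    (M.restrict U.ι).IsLocalBasis
      (fun i ↦ (show Γ(M.restrict U.ι, ⊤) from M.res (image_le ⊤) (b i))) ↔ M.IsLocalBasis b := by
  have key (V : (U : Scheme.{u}).Opens) :
      Function.Bijective (fun c : ι → Γ((U : Scheme.{u}), V) ↦
        ∑ i, c i • (M.restrict U.ι).res (le_top : V ≤ ⊤)
          (show Γ(M.restrict U.ι, ⊤) from M.res (image_le ⊤) (b i))) ↔
      Function.Bijective fun c : ι → Γ(X, U.ι ''ᵁ V) ↦ ∑ i, c i • M.res (image_le V) (b i) := by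
    have hbij : Function.Bijective (fun (c : ι → Γ(X, U.ι ''ᵁ V)) i ↦ (U.ι.appIso V).hom (c i)) :=
      Function.Bijective.piMap fun _ ↦ ConcreteCategory.bijective_of_isIso (U.ι.appIso V).hom
    rw [← Function.Bijective.of_comp_iff _ hbij]
    exact iff_of_eq (congr_arg _ (funext fun c ↦ restrict_sum_smul b V c))
  refine ⟨fun h V hV ↦ ?_, fun h V _ ↦ (key V).2 (h _ _)⟩
  have h1 := (key (U.ι ⁻¹ᵁ V)).1 (h _ le_top)
  have h2 : U.ι ''ᵁ U.ι ⁻¹ᵁ V = V := by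
    rw [Scheme.Hom.image_preimage_eq_opensRange_inf, Scheme.Opens.opensRange_ι]
    exact inf_eq_right.2 hV
  have h3 : ∀ (W : X.Opens) (hW : W ≤ U), W = V → Function.Bijective (fun c : ι → Γ(X, W) ↦
      ∑ i, c i • M.res hW (b i)) → Function.Bijective (fun c : ι → Γ(X, V) ↦
      ∑ i, c i • M.res hV (b i)) := by
    rintro W hW rfl h
    exact h
  exact h3 _ _ h2 h1

/-- A module is free on `U` if and only if it has a local basis on `U`. -/
lemma exists_isLocalBasis_iff (n : ℕ) :
    Nonempty (M.restrict U.ι ≅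
      (SheafOfModules.free (R := (U : Scheme.{u}).ringCatSheaf) (ULift.{u} (Fin n)) :
        (U : Scheme.{u}).Modules)) ↔ ∃ b : Fin n → Γ(M, U), M.IsLocalBasis b := by
  refine ⟨fun ⟨e⟩ ↦ ?_, fun ⟨b, hb⟩ ↦ ?_⟩
  · let φ : freeMod (U : Scheme.{u}) (ULift.{u} (Fin n)) ⟶ M.restrict U.ι := e.inv
    have hφ : IsIso φ := Iso.isIso_inv e
    have h1 := (isLocalBasis_freeBasis (X := U) (ULift.{u} (Fin n))).of_bijective (φ := φ)
      fun V _ ↦ ConcreteCategory.bijective_of_isIso (φ.app V)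
    have h2 := h1.reindex (Equiv.ulift.{u} (α := Fin n)).symm
    have hU : U ≤ U.ι ''ᵁ ⊤ := by simp
    refine ⟨fun i ↦ M.res hU (φ.app ⊤ (freeBasis ⟨i⟩)), (isLocalBasis_restrict_iff _).1 ?_⟩
    refine (congr_arg _ (funext fun i ↦ ?_)).mpr h2
    exact (res_res (M := M) hU (image_le ⊤) _).trans (res_self _ _)
  · have h1 := (isLocalBasis_restrict_iff b).2 hb
    exact exists_freeMod_iso_of_isLocalBasis (h1.reindex (Equiv.ulift.{u} (α := Fin n)))

end Restrict

end AlgebraicGeometry.Scheme.Modules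

/-! ### Local bases, the matrix description of `End(P)`, stalks and fibres. -/

namespace AlgebraicGeometry.Scheme.Modules

variable {X : Scheme.{u}} {M N P : X.Modules} {U V : X.Opens}

lemma sheafEnd_res_mul (h : V ≤ U) (f g : Γ(sheafEnd P, U)) :
    (sheafEnd P).res h (f * g) = (sheafEnd P).res h f * (sheafEnd P).res h g :=
  map_mul (localEndRes P h) f g

lemma sheafEnd_res_one (h : V ≤ U) : (sheafEnd P).res h 1 = 1 :=
  map_one (localEndRes P h)

/-- The endomorphism of `Γ(P, U)` given by a section of `End(P)`. -/
noncomputable def endEval (U : X.Opens) :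
    Γ(sheafEnd P, U) →ₐ[Γ(X, U)] Module.End Γ(X, U) Γ(P, U) where
  toFun f := (show localEnd P U from f).1 ⟨U, le_rfl⟩
  map_one' := rfl
  map_mul' _ _ := rfl
  map_zero' := rfl
  map_add' _ _ := rfl
  commutes' r := by
    refine LinearMap.ext fun s ↦ ?_
    exact congr_arg (· • s) (secRes_self (le_refl U) r)

lemma endEval_res (h : V ≤ U) (f : Γ(sheafEnd P, U)) (s : Γ(P, U)) :
    endEval V ((sheafEnd P).res h f) (P.res h s) = P.res h (endEval U f s) :=
  (show localEnd P U from f).2 ⟨U, le_rfl⟩ ⟨V, h⟩ (homOfLE h) s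

lemma sheafEnd_ext {f g : Γ(sheafEnd P, U)}
    (h : ∀ (V : X.Opens) (hV : V ≤ U), endEval V ((sheafEnd P).res hV f) =
      endEval V ((sheafEnd P).res hV g)) : f = g :=
  Subtype.ext (funext fun V ↦ h V.1 V.2)

namespace IsLocalBasis

variable {ι : Type*} [Fintype ι] [DecidableEq ι] {b : ι → Γ(P, U)}

lemma repr_res (hb : P.IsLocalBasis b) (h : V ≤ U) (s : Γ(P, U)) (i : ι) :
    (hb.res h).basis.repr (P.res h s) i = secRes h (hb.basis.repr s i) := by
  have : P.res h s = ∑ j, secRes h (hb.basis.repr s j) • (hb.res h).basis j := by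
    conv_lhs => rw [← hb.basis.sum_repr s]
    simp only [map_sum, res_smul, basis_apply]
  rw [this, Module.Basis.repr_sum_self]

/-- The restrictions of `b` remain bases on every smaller open, so a linear map over `U` has exactly
one compatible extension there, fixed by its values on `b`. -/
lemma bijective_endEval (hb : P.IsLocalBasis b) : Function.Bijective (endEval (P := P) U) := by
  refine ⟨fun f g hfg ↦ sheafEnd_ext fun V hV ↦ (hb.res hV).basis.ext fun i ↦ ?_, fun φ ↦ ?_⟩
  · rw [basis_apply, endEval_res, endEval_res, hfg]
  · let ψ (V : X.Opens) (hV : V ≤ U) : Module.End Γ(X, V) Γ(P, V) :=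
      (hb.res hV).basis.constr Γ(X, V) fun i ↦ P.res hV (φ (b i))
    have hψ (V : X.Opens) (hV : V ≤ U) (i : ι) : ψ V hV (P.res hV (b i)) = P.res hV (φ (b i)) := by
      have := (hb.res hV).basis.constr_basis Γ(X, V) (fun i ↦ P.res hV (φ (b i))) i
      rwa [basis_apply] at this
    have hres (V W : X.Opens) (hV : V ≤ U) (h : W ≤ V) (s : Γ(P, V)) :
        ψ W (h.trans hV) (P.res h s) = P.res h (ψ V hV s) := by
      rw [← (hb.res hV).basis.sum_repr s]
      simp only [map_sum, res_smul, basis_apply, _root_.map_smul, hψ, res_res]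
    refine ⟨(⟨fun V ↦ ψ V.1 V.2, fun V W i s ↦ hres V.1 W.1 V.2 i.le s⟩ : localEnd P U), ?_⟩
    refine hb.basis.ext fun i ↦ ?_
    have := hψ U le_rfl i
    rw [res_self, res_self] at this
    rw [basis_apply]
    exact this

/-- A local basis of `P` identifies the sections of `End(P)` with matrices. -/
noncomputable def endMat (hb : P.IsLocalBasis b) :
    Γ(sheafEnd P, U) ≃ₐ[Γ(X, U)] Matrix ι ι Γ(X, U) :=
  (AlgEquiv.ofBijective (endEval U) hb.bijective_endEval).trans
    (LinearMap.toMatrixAlgEquiv hb.basis)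

lemma endMat_apply (hb : P.IsLocalBasis b) (f : Γ(sheafEnd P, U)) (i j : ι) :
    hb.endMat f i j = hb.basis.repr (endEval U f (b j)) i := by
  have := LinearMap.toMatrixAlgEquiv_apply hb.basis (endEval U f) i j
  rwa [basis_apply] at this

lemma endMat_res (hb : P.IsLocalBasis b) (h : V ≤ U) (f : Γ(sheafEnd P, U)) :
    (hb.res h).endMat ((sheafEnd P).res h f) = (hb.endMat f).map (secRes h) := by
  ext i j
  rw [endMat_apply, Matrix.map_apply, endMat_apply, endEval_res, repr_res]

lemma res_endMat_symm (hb : P.IsLocalBasis b) (h : V ≤ U) (A : Matrix ι ι Γ(X, U)) :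
    (sheafEnd P).res h (hb.endMat.symm A) = (hb.res h).endMat.symm (A.map (secRes h)) := by
  rw [AlgEquiv.eq_symm_apply, hb.endMat_res, AlgEquiv.apply_symm_apply]

/-- The matrix units form a local basis of `End(P)`. -/
lemma isLocalBasis_single (hb : P.IsLocalBasis b) :
    (sheafEnd P).IsLocalBasis fun p : ι × ι ↦ hb.endMat.symm (Matrix.single p.1 p.2 1) := by
  intro V hV
  have e : (fun c : ι × ι → Γ(X, V) ↦ ∑ p, c p • (sheafEnd P).res hV
      (hb.endMat.symm (Matrix.single p.1 p.2 1))) =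
      (hb.res hV).endMat.symm ∘ (Equiv.curry ι ι Γ(X, V)).trans Matrix.of := by
    funext c
    rw [Function.comp_apply, AlgEquiv.eq_symm_apply, map_sum]
    ext i j
    rw [Matrix.sum_apply, Finset.sum_eq_single (i, j)]
    · rw [_root_.map_smul, res_endMat_symm, AlgEquiv.apply_symm_apply]
      simp
    · intro p _ hp
      rw [_root_.map_smul, res_endMat_symm, AlgEquiv.apply_symm_apply]
      have : ¬ (p.1 = i ∧ p.2 = j) := fun h ↦ hp (Prod.ext h.1 h.2)
      simp [this]
    · simp
  rw [e]
  exact (hb.res hV).endMat.symm.bijective.comp (Equiv.bijective _)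

end IsLocalBasis

section Stalk

variable {ι : Type*} [Fintype ι] {b : ι → Γ(M, U)}

/-- The germ of a section, as an additive map. -/
noncomputable def germ (M : X.Modules) (x : X) (hx : x ∈ U) : Γ(M, U) →+ M.presheaf.stalk x :=
  (M.presheaf.germ U x hx).hom

lemma germ_res (x : X) (h : V ≤ U) (hx : x ∈ V) (s : Γ(M, U)) :
    M.germ x hx (M.res h s) = M.germ x (h hx) s :=
  TopCat.Presheaf.germ_res_apply M.presheaf (homOfLE h) x hx s

lemma secGerm_secRes (x : X) (h : V ≤ U) (hx : x ∈ V) (s : Γ(X, U)) :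
    X.presheaf.germ V x hx (secRes h s) = X.presheaf.germ U x (h hx) s :=
  TopCat.Presheaf.germ_res_apply X.presheaf (homOfLE h) x hx s

lemma germ_smul' (x : X) (hx : x ∈ U) (r : Γ(X, U)) (s : Γ(M, U)) :
    M.germ x hx (r • s) = X.presheaf.germ U x hx r • M.germ x hx s :=
  germ_smul M x U hx r s

lemma exists_res_eq_of_germ_eq (x : X) (hx : x ∈ U) (s t : Γ(M, U))
    (h : M.germ x hx s = M.germ x hx t) :
    ∃ (V : X.Opens) (hV : V ≤ U), x ∈ V ∧ M.res hV s = M.res hV t := by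
  obtain ⟨W, hW, i, j, e⟩ := TopCat.Presheaf.germ_eq M.presheaf x hx hx s t h
  exact ⟨W, i.le, hW, e⟩

lemma exists_secRes_eq_of_germ_eq (x : X) (hx : x ∈ U) (s t : Γ(X, U))
    (h : X.presheaf.germ U x hx s = X.presheaf.germ U x hx t) :
    ∃ (V : X.Opens) (hV : V ≤ U), x ∈ V ∧ secRes hV s = secRes hV t := by
  obtain ⟨W, hW, i, j, e⟩ := TopCat.Presheaf.germ_eq X.presheaf x hx hx s t h
  exact ⟨W, i.le, hW, e⟩

lemma exists_le_of_forall_mem {κ : Type*} [Finite κ] (x : X) (V : κ → X.Opens)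
    (hV : ∀ k, x ∈ V k) : ∃ W : X.Opens, x ∈ W ∧ ∀ k, W ≤ V k :=
  ⟨⟨⋂ k, (V k : Set X), isOpen_iInter_of_finite fun k ↦ (V k).isOpen⟩, Set.mem_iInter.2 hV,
    fun k ↦ Set.iInter_subset (fun k ↦ (V k : Set X)) k⟩

/-- Finitely many equalities of germs hold on a common neighbourhood. -/
lemma exists_secRes_eq_of_forall_germ_eq {κ : Type*} [Finite κ] (x : X) (hx : x ∈ U)
    (s t : κ → Γ(X, U)) (h : ∀ k, X.presheaf.germ U x hx (s k) = X.presheaf.germ U x hx (t k)) :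
    ∃ (V : X.Opens) (hV : V ≤ U), x ∈ V ∧ ∀ k, secRes hV (s k) = secRes hV (t k) := by
  choose V hV hx' e using fun k ↦ exists_secRes_eq_of_germ_eq x hx (s k) (t k) (h k)
  obtain ⟨W, hW, hWV⟩ := exists_le_of_forall_mem x V hx'
  refine ⟨U ⊓ W, inf_le_left, ⟨hx, hW⟩, fun k ↦ ?_⟩
  rw [← secRes_secRes (hV k) (inf_le_right.trans (hWV k)), e k, secRes_secRes]

/-- A linear relation between germs involves finitely many sections and already holds on a
neighbourhood, where the basis property kills its coefficients; surjectivity comes from expanding a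
representative of a germ. -/
lemma bijective_germ_sum (hb : M.IsLocalBasis b) (x : X) (hx : x ∈ U) :
    Function.Bijective (Fintype.linearCombination (X.presheaf.stalk x)
      fun i ↦ M.germ x hx (b i)) := by
  refine ⟨?_, fun m ↦ ?_⟩
  · rw [injective_iff_map_eq_zero]
    intro c hc
    choose V hV c' hc' using fun i ↦ TopCat.Presheaf.exists_germ_eq X.presheaf (c i)
    obtain ⟨W, hW, hWV⟩ := exists_le_of_forall_mem x V hV
    have hUW : x ∈ U ⊓ W := ⟨hx, hW⟩
    let d (i : ι) : Γ(X, U ⊓ W) := secRes (inf_le_right.trans (hWV i)) (c' i)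
    have hd (i : ι) : X.presheaf.germ _ x hUW (d i) = c i :=
      (secGerm_secRes x _ hUW (c' i)).trans (hc' i)
    have h0 : M.germ x hUW (∑ i, d i • M.res inf_le_left (b i)) = M.germ x hUW 0 := by
      rw [map_sum, map_zero, ← hc, Fintype.linearCombination_apply]
      simp only [germ_smul', germ_res, hd]
    obtain ⟨T, hT, hxT, h1⟩ := exists_res_eq_of_germ_eq x hUW _ _ h0
    have h2 : (fun i ↦ secRes hT (d i)) = 0 := by
      apply (hb T (hT.trans inf_le_left)).1
      simp only [map_sum, res_smul, res_res, map_zero] at h1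
      simp only [Pi.zero_apply, zero_smul, Finset.sum_const_zero]
      exact h1
    funext i
    rw [← hd, ← secGerm_secRes x hT hxT]
    exact (congr_arg _ (congr_fun h2 i)).trans (map_zero (X.presheaf.germ T x hxT).hom)
  · obtain ⟨V, hV, m, rfl⟩ := TopCat.Presheaf.exists_germ_eq M.presheaf m
    have hW : x ∈ U ⊓ V := ⟨hx, hV⟩
    obtain ⟨c, hc⟩ := (hb (U ⊓ V) inf_le_left).2 (M.res inf_le_right m)
    refine ⟨fun i ↦ X.presheaf.germ _ x hW (c i), ?_⟩
    refine Eq.trans ?_ (germ_res x inf_le_right hW m)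
    rw [← hc, map_sum, Fintype.linearCombination_apply]
    simp only [germ_smul', germ_res]

variable [DecidableEq ι]

/-- A local basis induces a basis of the stalk. -/
noncomputable def IsLocalBasis.stalkBasis (hb : M.IsLocalBasis b) (x : X) (hx : x ∈ U) :
    Module.Basis ι (X.presheaf.stalk x) (M.presheaf.stalk x) :=
  Module.Basis.ofEquivFun (LinearEquiv.symm (LinearEquiv.ofBijective _ (bijective_germ_sum hb x hx)))

lemma IsLocalBasis.stalkBasis_apply (hb : M.IsLocalBasis b) (x : X) (hx : x ∈ U) (i : ι) :
    hb.stalkBasis x hx i = M.germ x hx (b i) := by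
  simp only [stalkBasis, Module.Basis.coe_ofEquivFun, LinearEquiv.symm_symm]
  exact (Fintype.linearCombination_apply_single ..).trans (one_smul _ _)

/-- A local basis induces a basis of the fibre. -/
noncomputable def IsLocalBasis.fibreBasis (hb : M.IsLocalBasis b) (x : X) (hx : x ∈ U) :
    Module.Basis ι (IsLocalRing.ResidueField (X.presheaf.stalk x)) (M.fibre x) :=
  (hb.stalkBasis x hx).baseChange _

/-- The value of a section in the fibre. -/
noncomputable def fibreVal (M : X.Modules) (x : X) (hx : x ∈ U) : Γ(M, U) →+ M.fibre x :=
  (TensorProduct.mk (X.presheaf.stalk x) (IsLocalRing.ResidueField (X.presheaf.stalk x))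
    (M.presheaf.stalk x) 1).toAddMonoidHom.comp (M.germ x hx)

/-- The value of a function in the residue field. -/
noncomputable def secVal (x : X) (hx : x ∈ U) :
    Γ(X, U) →+* IsLocalRing.ResidueField (X.presheaf.stalk x) :=
  (IsLocalRing.residue _).comp (X.presheaf.germ U x hx).hom

lemma fibreVal_smul (x : X) (hx : x ∈ U) (r : Γ(X, U)) (s : Γ(M, U)) :
    M.fibreVal x hx (r • s) = secVal x hx r • M.fibreVal x hx s := by
  change TensorProduct.mk _ _ _ _ (M.germ x hx (r • s)) = _ • TensorProduct.mk _ _ _ _ _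
  rw [germ_smul', _root_.map_smul]
  exact (algebraMap_smul (IsLocalRing.ResidueField (X.presheaf.stalk x))
    (X.presheaf.germ U x hx r) _).symm

lemma IsLocalBasis.fibreBasis_apply (hb : M.IsLocalBasis b) (x : X) (hx : x ∈ U) (i : ι) :
    hb.fibreBasis x hx i = M.fibreVal x hx (b i) := by
  rw [fibreBasis, Module.Basis.baseChange_apply, stalkBasis_apply]
  rfl

lemma fibreMap_fibreVal (φ : M ⟶ N) (x : X) (hx : x ∈ U) (s : Γ(M, U)) :
    fibreMap φ x (M.fibreVal x hx s) = N.fibreVal x hx (φ.app U s) := by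
  have : stalkMap φ x (M.germ x hx s) = N.germ x hx (φ.app U s) :=
    TopCat.Presheaf.stalkFunctor_map_germ_apply U x hx φ.mapPresheaf s
  refine (LinearMap.baseChange_tmul _ _ _).trans ?_
  rw [this]
  rfl

end Stalk

end AlgebraicGeometry.Scheme.Modules

/-! ### Matrix algebra: rank-one idempotents and involutions of `M₂(R)`. -/

namespace MatrixInvolution

open Matrix

/-- An idempotent matrix over a local ring whose reduction has columns proportional to one nonzero
vector has a unit entry, and its columns are proportional to the column of that entry. -/
lemma exists_isUnit_entry_of_idempotent {R ι : Type*} [CommRing R] [IsLocalRing R] [Fintype ι]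
    [DecidableEq ι] (A : Matrix ι ι R) (hA : A * A = A) (v c : ι → IsLocalRing.ResidueField R)
    (h : ∀ i j, IsLocalRing.residue R (A i j) = c j * v i) (h0 : ∃ i j, c j * v i ≠ 0) :
    ∃ k l, IsUnit (A k l) ∧ ∀ i j, A i j * A k l = A i l * A k j := by
  obtain ⟨k, l, hkl⟩ := h0
  have hu : IsUnit (A k l) := by
    rw [← IsLocalRing.residue_ne_zero_iff_isUnit, h]
    exact hkl
  refine ⟨k, l, hu, ?_⟩
  obtain ⟨e, he⟩ := hu.exists_right_inv
  have hAA (i j : ι) : ∑ a, A i a * A a j = A i j := by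
    rw [← Matrix.mul_apply, hA]
  -- `B` is the rank-one matrix with the same column `l` and row `k` as `A`, normalised by `e = 1 /
  -- A k l`. It satisfies `AB = BA = BB = B`, so `A - B` is idempotent. Its reduction is zero
  -- because that of `A` has rank one, so `1 - (A - B)` is invertible and kills `A - B`; hence `A =
  -- B`.
  let B : Matrix ι ι R := vecMulVec (fun i ↦ A i l) (fun j ↦ e * A k j)
  have hAB : A * B = B := by
    ext i j
    simp only [B, mul_apply, vecMulVec_apply, ← mul_assoc, ← Finset.sum_mul, hAA]
  have hBA : B * A = B := by
    ext i j
    simp only [B, mul_apply, vecMulVec_apply, mul_assoc, ← Finset.mul_sum, hAA]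
  have hBB : B * B = B := by
    ext i j
    have (a : ι) : A i l * (e * A k a) * (A a l * (e * A k j)) =
        A k a * A a l * (A i l * e * e * A k j) := by ring
    simp only [B, mul_apply, vecMulVec_apply, this, ← Finset.sum_mul, hAA]
    linear_combination A i l * e * A k j * he
  have hQ : (A - B) * (A - B) = A - B := by
    rw [sub_mul, mul_sub, mul_sub, hA, hAB, hBA, hBB]
    abel
  have hres : (IsLocalRing.residue R).mapMatrix (1 - (A - B)) = 1 := by
    rw [map_sub, map_one, sub_eq_self]
    ext i j
    have h1 := congr_arg (IsLocalRing.residue R) he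
    simp only [RingHom.mapMatrix_apply, Matrix.map_apply, B, Matrix.sub_apply, vecMulVec_apply,
      map_sub, map_mul, h, Matrix.zero_apply, map_one] at h1 ⊢
    linear_combination -c j * v i * h1
  have hdet : IsUnit (1 - (A - B)) := by
    rw [Matrix.isUnit_iff_isUnit_det, ← IsLocalRing.residue_ne_zero_iff_isUnit, RingHom.map_det,
      hres, det_one]
    exact one_ne_zero
  have hz : A - B = 0 := by
    have h1 : (1 - (A - B)) * (A - B) = 0 := by rw [sub_mul, hQ, one_mul, sub_self]
    exact (hdet.mul_right_eq_zero).1 h1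
  intro i j
  have h2 : A i j = A i l * (e * A k j) := by
    have := congr_fun (congr_fun (sub_eq_zero.1 hz) i) j
    exact this
  rw [h2]
  linear_combination A i l * A k j * he

section Involution

variable {R : Type*} [CommRing R]

lemma involution_one (σ : Matrix (Fin 2) (Fin 2) R →ₗ[R] Matrix (Fin 2) (Fin 2) R)
    (hσ : ∀ a, σ (σ a) = a) (hmul : ∀ a b, σ (a * b) = σ b * σ a) : σ 1 = 1 := by
  have h := hmul (σ 1) 1
  rw [mul_one, hσ, mul_one] at h
  exact h.symm

/-- Since `σ` reverses products, `a ↦ tr (σ a)` is a linear form vanishing on commutators, hence a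
multiple of the trace. The factor is one because `σ 1 = 1` and `tr 1 = 2` is a unit. -/
lemma trace_involution (σ : Matrix (Fin 2) (Fin 2) R →ₗ[R] Matrix (Fin 2) (Fin 2) R)
    (hσ : ∀ a, σ (σ a) = a) (hmul : ∀ a b, σ (a * b) = σ b * σ a)
    (h2 : IsUnit (2 : R)) (a : Matrix (Fin 2) (Fin 2) R) :
    (σ a).trace = a.trace := by
  have hc (x y : Matrix (Fin 2) (Fin 2) R) : (σ (x * y)).trace = (σ (y * x)).trace := by
    rw [hmul, hmul, trace_mul_comm]
  have h01 : (σ (single 0 1 1)).trace = 0 := by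
    have := hc (single 0 0 1) (single 0 1 1)
    simpa using this
  have h10 : (σ (single 1 0 1)).trace = 0 := by
    have := hc (single 1 1 1) (single 1 0 1)
    simpa using this
  have h00 : (σ (single 0 0 1)).trace = (σ (single 1 1 1)).trace := by
    have := hc (single 0 1 1) (single 1 0 1)
    simpa using this
  have hone : (1 : Matrix (Fin 2) (Fin 2) R) = single 0 0 1 + single 1 1 1 := by
    ext i j; fin_cases i <;> fin_cases j <;> simp
  have h1 : 2 * (σ (single 1 1 1)).trace = 2 := by
    have := congr_arg trace (involution_one σ hσ hmul)
    rw [hone, map_add, trace_add, h00] at this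
    rw [two_mul, this]
    simp
    norm_num
  have h11 : (σ (single 1 1 1)).trace = 1 := h2.mul_left_cancel (by rw [h1, mul_one])
  have ha : a = a 0 0 • single 0 0 1 + a 0 1 • single 0 1 1 + a 1 0 • single 1 0 1 +
      a 1 1 • single 1 1 1 := by
    ext i j; fin_cases i <;> fin_cases j <;> simp
  conv_lhs => rw [ha]
  simp only [map_add, map_smul, trace_add, trace_smul, h01, h10, h00, h11]
  simp [trace_fin_two]

/-- If the skew elements of an involution of `M₂(R)` are the multiples of a matrix `m` with a unit
entry, then `m` is traceless and its square is an invertible scalar. -/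
lemma exists_mul_self_eq_algebraMap (σ : Matrix (Fin 2) (Fin 2) R →ₗ[R] Matrix (Fin 2) (Fin 2) R)
    (hσ : ∀ a, σ (σ a) = a) (hmul : ∀ a b, σ (a * b) = σ b * σ a)
    (h2 : IsUnit (2 : R)) (m : Matrix (Fin 2) (Fin 2) R)
    (hm : σ m = -m) (hu : ∃ i j, IsUnit (m i j)) (hskew : ∀ a, σ a = -a → ∃ c : R, a = c • m) :
    m.trace = 0 ∧ ∃ d : R, IsUnit d ∧ m * m = algebraMap R _ d := by
  have htr := trace_involution σ hσ hmul h2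
  have h0 : m.trace = 0 := by
    have := htr m
    rw [hm, trace_neg] at this
    have h3 : 2 * m.trace = 2 * 0 := by linear_combination -this
    exact h2.mul_left_cancel h3
  -- Cayley–Hamilton for a traceless 2 × 2 matrix; what remains is that the determinant is a unit.
  have hmm : m * m = algebraMap R _ (-m.det) := by
    rw [trace_fin_two] at h0
    rw [algebraMap_eq_diagonal]
    ext i j
    fin_cases i <;> fin_cases j <;> simp [mul_apply, det_fin_two]
    · linear_combination m 0 0 * h0
    · linear_combination m 0 1 * h0
    · linear_combination m 1 0 * h0
    · linear_combination m 1 1 * h0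
  refine ⟨h0, -m.det, ?_, hmm⟩
  obtain ⟨i, j, hij⟩ := hu
  obtain ⟨e, he⟩ := h2.exists_right_inv
  -- This `a` has `tr (a m) = m i j`, a unit. Its symmetric part is trace-orthogonal to `m` and its
  -- skew part is `c • m`, so `m i j = c · tr (m²) = -2 c det m`, which forces `det m` to be a unit.
  let a : Matrix (Fin 2) (Fin 2) R := single j i 1
  obtain ⟨c, hc⟩ := hskew (e • (a - σ a)) (by
    rw [map_smul, map_sub, hσ, ← smul_neg, neg_sub])
  have hs : ((a + σ a) * m).trace = 0 := by
    have h3 := htr ((a + σ a) * m)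
    rw [hmul, hm, map_add, hσ, neg_mul, trace_neg, trace_mul_comm, add_comm (σ a)] at h3
    have h4 : 2 * ((a + σ a) * m).trace = 2 * 0 := by linear_combination -h3
    exact h2.mul_left_cancel h4
  have h5 : (a * m).trace = m i j := by
    rw [trace_fin_two, mul_apply, mul_apply]
    fin_cases i <;> fin_cases j <;> simp [a]
  have h6 : a = e • (a + σ a) + c • m := by
    rw [← hc, ← smul_add, add_add_sub_cancel, ← two_smul R a, smul_smul, mul_comm e, he, one_smul]
  have h7 : m i j = -m.det * (2 * c) := by
    rw [← h5, h6, add_mul, trace_add, smul_mul, trace_smul, hs, smul_mul, trace_smul, hmm]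
    simp [algebraMap_eq_diagonal]
    ring
  exact isUnit_of_mul_isUnit_left (h7 ▸ hij)

end Involution

end MatrixInvolution

/-! ### Local generators of the skew elements of an orthogonal involution. -/

namespace AlgebraicGeometry.Scheme.Modules

variable {X : Scheme.{u}} {P : X.Modules} {U V : X.Opens}

lemma IsLocalBasis.repr_single {ι : Type*} [Fintype ι] [DecidableEq ι] {b : ι → Γ(P, U)}
    (hb : P.IsLocalBasis b) (a : Γ(sheafEnd P, U)) (p : ι × ι) :
    hb.isLocalBasis_single.basis.repr a p = hb.endMat a p.1 p.2 := by
  have h := hb.isLocalBasis_single.basis.sum_repr a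
  conv_rhs => rw [← h]
  rw [map_sum, Matrix.sum_apply, Finset.sum_eq_single p]
  · rw [_root_.map_smul, basis_apply, AlgEquiv.apply_symm_apply]
    simp
  · intro q _ hq
    rw [_root_.map_smul, basis_apply, AlgEquiv.apply_symm_apply]
    have : ¬ (q.1 = p.1 ∧ q.2 = p.2) := fun h ↦ hq (Prod.ext h.1 h.2)
    simp [this]
  · simp

lemma exists_of_finrank_range_eq_one {K V : Type*} [Field K] [AddCommGroup V] [Module K V]
    (f : V →ₗ[K] V) (h : Module.finrank K (LinearMap.range f) = 1) :
    ∃ v ∈ LinearMap.range f, v ≠ 0 ∧ ∀ w, ∃ c : K, f w = c • v := by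
  obtain ⟨⟨v, hv⟩, hv0, hc⟩ := finrank_eq_one_iff'.1 h
  refine ⟨v, hv, fun h ↦ hv0 (Subtype.ext h), fun w ↦ ?_⟩
  obtain ⟨c, hc⟩ := hc ⟨f w, w, rfl⟩
  exact ⟨c, (congr_arg Subtype.val hc).symm⟩

namespace EndInvolution

variable (σ : P.EndInvolution)

lemma app_app (a : Γ(sheafEnd P, U)) : σ.hom.app U (σ.hom.app U a) = a :=
  congr_arg (fun φ ↦ Hom.app φ U a) σ.hom_comp_hom

/-- The projection `(1 - σ) / 2` to the skew-symmetric elements, `e` being half of one. -/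
noncomputable def skewProj (e : Γ(X, U)) : Γ(sheafEnd P, U) →ₗ[Γ(X, U)] Γ(sheafEnd P, U) :=
  e • (LinearMap.id - appₗ σ.hom U)

lemma skewProj_apply (e : Γ(X, U)) (a : Γ(sheafEnd P, U)) :
    σ.skewProj e a = e • (a - σ.hom.app U a) := rfl

lemma app_skewProj (e : Γ(X, U)) (a : Γ(sheafEnd P, U)) :
    σ.hom.app U (σ.skewProj e a) = -σ.skewProj e a := by
  rw [skewProj_apply, Hom.app_smul, map_sub, app_app, ← smul_neg, neg_sub]

lemma skewProj_of_skew {e : Γ(X, U)} (he : 2 * e = 1) {a : Γ(sheafEnd P, U)}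
    (ha : σ.hom.app U a = -a) : σ.skewProj e a = a := by
  rw [skewProj_apply, ha, sub_neg_eq_add, ← two_smul Γ(X, U) a, smul_smul, mul_comm, he, one_smul]

lemma res_skewProj (h : V ≤ U) (e : Γ(X, U)) (a : Γ(sheafEnd P, U)) :
    (sheafEnd P).res h (σ.skewProj e a) = σ.skewProj (secRes h e) ((sheafEnd P).res h a) := by
  rw [skewProj_apply, skewProj_apply, res_smul, map_sub, app_res]

section

variable {b : Fin 2 → Γ(P, U)} (hb : P.IsLocalBasis b)

/-- The matrix of the projection to the skew-symmetric elements. -/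
noncomputable def skewMatrix (e : Γ(X, U)) :
    Matrix (Fin 2 × Fin 2) (Fin 2 × Fin 2) Γ(X, U) :=
  LinearMap.toMatrix hb.isLocalBasis_single.basis hb.isLocalBasis_single.basis (σ.skewProj e)

lemma skewMatrix_mul_self {e : Γ(X, U)} (he : 2 * e = 1) :
    σ.skewMatrix hb e * σ.skewMatrix hb e = σ.skewMatrix hb e := by
  rw [skewMatrix, ← LinearMap.toMatrix_comp]
  congr 1
  exact LinearMap.ext fun a ↦ σ.skewProj_of_skew he (σ.app_skewProj e a)

lemma sum_skewMatrix_smul (e : Γ(X, U)) (j : Fin 2 × Fin 2) :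
    ∑ i, σ.skewMatrix hb e i j • hb.isLocalBasis_single.basis i =
      σ.skewProj e (hb.isLocalBasis_single.basis j) := by
  rw [← hb.isLocalBasis_single.basis.sum_repr (σ.skewProj e (hb.isLocalBasis_single.basis j))]
  exact Finset.sum_congr rfl fun i _ ↦ by rw [skewMatrix, LinearMap.toMatrix_apply]

/-- On the fibre the projection is `-e` times `σ_x - 1`, whose range is a line. All columns are then
multiples of the coordinate vector of one generator of it, and `2 e = 1` keeps the factor nonzero.
-/
lemma exists_secVal_skewMatrix {e : Γ(X, U)} (he : 2 * e = 1) (x : X) (hx : x ∈ U)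
    (h : σ.skewDim x = 1) :
    ∃ v c : Fin 2 × Fin 2 → IsLocalRing.ResidueField (X.presheaf.stalk x),
      (∀ i j, secVal x hx (σ.skewMatrix hb e i j) = c j * v i) ∧ ∃ i j, c j * v i ≠ 0 := by
  let F := hb.isLocalBasis_single.fibreBasis x hx
  let f := fibreMap σ.hom x - LinearMap.id
  obtain ⟨v, ⟨w, hw⟩, hv0', hv⟩ := exists_of_finrank_range_eq_one f h
  choose c hc' using fun j ↦ hv (F j)
  have hF (j) : F j = (sheafEnd P).fibreVal x hx (hb.isLocalBasis_single.basis j) := by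
    rw [IsLocalBasis.fibreBasis_apply, IsLocalBasis.basis_apply]
  have h2e : (2 : IsLocalRing.ResidueField (X.presheaf.stalk x)) * secVal x hx e = 1 := by
    have := congr_arg (secVal x hx) he
    rwa [map_mul, map_ofNat, map_one] at this
  have key (j) : ∑ i, secVal x hx (σ.skewMatrix hb e i j) • F i =
      (-secVal x hx e * c j) • v := by
    have h1 := congr_arg ((sheafEnd P).fibreVal x hx) (σ.sum_skewMatrix_smul hb e j)
    rw [map_sum, skewProj_apply, fibreVal_smul, map_sub, ← fibreMap_fibreVal, ← hF] at h1
    simp only [fibreVal_smul, ← hF] at h1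
    rw [h1, mul_smul, ← hc', neg_smul, ← smul_neg]
    congr 1
    simp [f]
  have hentry (i j) : secVal x hx (σ.skewMatrix hb e i j) =
      (-secVal x hx e * c j) * F.repr v i := by
    have h1 := congr_arg (fun z ↦ F.repr z i) (key j)
    rw [Module.Basis.repr_sum_self] at h1
    simpa using h1
  refine ⟨fun i ↦ F.repr v i, fun j ↦ -secVal x hx e * c j, hentry, ?_⟩
  have hi : ∃ i, F.repr v i ≠ 0 := by
    by_contra! h
    exact hv0' (F.repr.injective (by ext i; simp [h i]))
  have hj : ∃ j, c j ≠ 0 := by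
    by_contra! h
    have hf : f = 0 := F.ext fun j ↦ by rw [hc', h j, zero_smul]; rfl
    refine hv0' ?_
    rw [← hw]
    exact congr_arg (fun g ↦ g w) hf
  obtain ⟨i, hi⟩ := hi
  obtain ⟨j, hj⟩ := hj
  have he0 : secVal x hx e ≠ 0 := right_ne_zero_of_mul_eq_one h2e
  exact ⟨i, j, mul_ne_zero (mul_ne_zero (neg_ne_zero.2 he0) hj) hi⟩

/-- The germ at `x` of the matrix `A` of the projection is idempotent with rank-one reduction, so it
has a unit entry `A k l` and all its columns are multiples of column `l`. These finitely many
conditions persist near `x`. A skew element equals its own projection, hence is a combination of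
columns and a multiple of the projection of the basis vector `E l`. -/
lemma exists_skew_generator {e : Γ(X, U)} (he : 2 * e = 1) (x : X) (hx : x ∈ U)
    (h : σ.skewDim x = 1) :
    ∃ (V : X.Opens) (hV : V ≤ U) (m : Γ(sheafEnd P, V)), x ∈ V ∧ IsAffineOpen V ∧
      σ.hom.app V m = -m ∧ (∃ i j, IsUnit ((hb.res hV).endMat m i j)) ∧
      ∀ (W : X.Opens) (hW : W ≤ V) (a : Γ(sheafEnd P, W)), σ.hom.app W a = -a →
        ∃ c : Γ(X, W), a = c • (sheafEnd P).res hW m := by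
  obtain ⟨v, c, hvc, h0⟩ := σ.exists_secVal_skewMatrix hb he x hx h
  let A := σ.skewMatrix hb e
  have hA : A * A = A := σ.skewMatrix_mul_self hb he
  let g := (X.presheaf.germ U x hx).hom
  obtain ⟨k, l, hkl, hminor⟩ := MatrixInvolution.exists_isUnit_entry_of_idempotent (A.map g)
    (by rw [← Matrix.map_mul, hA]) v c hvc h0
  obtain ⟨V₁, hV₁, hx₁, hminor₁⟩ := exists_secRes_eq_of_forall_germ_eq x hx
    (fun p : (Fin 2 × Fin 2) × (Fin 2 × Fin 2) ↦ A p.1 p.2 * A k l)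
    (fun p ↦ A p.1 l * A k p.2) fun p ↦ by
      have := hminor p.1 p.2
      refine (map_mul g _ _).trans (this.trans (map_mul g _ _).symm)
  have hx₂ : x ∈ X.basicOpen (A k l) := (X.mem_basicOpen (A k l) x hx).2 hkl
  obtain ⟨V, hVaff, hxV, hV⟩ := exists_isAffineOpen_mem_and_subset (U := V₁ ⊓ X.basicOpen (A k l))
    (x := x) ⟨hx₁, hx₂⟩
  have hVU : V ≤ U := (show V ≤ _ from hV).trans (inf_le_left.trans hV₁)
  have hVb : V ≤ X.basicOpen (A k l) := (show V ≤ _ from hV).trans inf_le_right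
  have hunit : IsUnit (secRes hVU (A k l)) := by
    have h1 := (RingedSpace.isUnit_res_basicOpen X.toRingedSpace (A k l)).map (secRes hVb)
    have h2 := secRes_secRes (X.basicOpen_le (A k l)) hVb (A k l)
    rw [← h2]
    exact h1
  let E := hb.isLocalBasis_single.basis
  refine ⟨V, hVU, (sheafEnd P).res hVU (σ.skewProj e (E l)), hxV, hVaff, ?_, ⟨k.1, k.2, ?_⟩, ?_⟩
  · rw [app_res, app_skewProj, map_neg]
  · rw [hb.endMat_res, Matrix.map_apply, ← hb.repr_single]
    convert hunit
    exact (LinearMap.toMatrix_apply ..).symm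
  · intro W hW a ha
    have heW : 2 * secRes (hW.trans hVU) e = 1 := by
      have := congr_arg (secRes (hW.trans hVU)) he
      rwa [map_mul, map_ofNat, map_one] at this
    obtain ⟨t, ht⟩ := hunit.exists_right_inv
    have htW : secRes (hW.trans hVU) (A k l) * secRes hW t = 1 := by
      have := congr_arg (secRes hW) ht
      rwa [map_mul, map_one, secRes_secRes] at this
    have hmin (i j) : secRes (hW.trans hVU) (A i j) * secRes (hW.trans hVU) (A k l) =
        secRes (hW.trans hVU) (A i l) * secRes (hW.trans hVU) (A k j) := by
      have := congr_arg (secRes (hW.trans ((show V ≤ _ from hV).trans inf_le_left)))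
        (hminor₁ (i, j))
      simpa only [secRes_secRes, map_mul] using this
    have hproj (j) : (sheafEnd P).res (hW.trans hVU) (σ.skewProj e (E j)) =
        (secRes hW t * secRes (hW.trans hVU) (A k j)) •
          (sheafEnd P).res (hW.trans hVU) (σ.skewProj e (E l)) := by
      rw [← σ.sum_skewMatrix_smul hb e j, ← σ.sum_skewMatrix_smul hb e l, map_sum, map_sum,
        Finset.smul_sum]
      refine Finset.sum_congr rfl fun i _ ↦ ?_
      rw [res_smul, res_smul, smul_smul]
      congr 1
      linear_combination secRes hW t * hmin i j - secRes (hW.trans hVU) (A i j) * htW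
    obtain ⟨r, hr⟩ := (hb.isLocalBasis_single W (hW.trans hVU)).2 a
    refine ⟨∑ j, r j * (secRes hW t * secRes (hW.trans hVU) (A k j)), ?_⟩
    rw [res_res, Finset.sum_smul]
    conv_lhs => rw [← σ.skewProj_of_skew heW ha, ← hr]
    rw [map_sum]
    refine Finset.sum_congr rfl fun j _ ↦ ?_
    rw [_root_.map_smul, ← res_skewProj, mul_smul]
    exact congr_arg (r j • ·) ((congr_arg (fun z ↦ (sheafEnd P).res _ (σ.skewProj e z))
      (hb.isLocalBasis_single.basis_apply j).symm).trans (hproj j))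

end

/-- A generator of the skew-symmetric elements of an orthogonal involution near a point. -/
structure SkewGenerator (x : X) where
  /-- the neighbourhood -/
  opens : X.Opens
  mem : x ∈ opens
  isAffineOpen : IsAffineOpen opens
  /-- a local basis of `P` -/
  basis : Fin 2 → Γ(P, opens)
  isLocalBasis : P.IsLocalBasis basis
  /-- the generator -/
  gen : Γ(sheafEnd P, opens)
  skew : σ.hom.app opens gen = -gen
  exists_smul (W : X.Opens) (hW : W ≤ opens) (a : Γ(sheafEnd P, W)) (ha : σ.hom.app W a = -a) :
    ∃ c : Γ(X, W), a = c • (sheafEnd P).res hW gen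
  trace_gen : (isLocalBasis.endMat gen).trace = 0
  /-- the square of the generator -/
  sq : Γ(X, opens)
  isUnit_sq : IsUnit sq
  gen_mul_gen : gen * gen = algebraMap _ _ sq

lemma nonempty_skewGenerator (h2 : IsUnit (2 : Γ(X, ⊤))) {b : Fin 2 → Γ(P, U)}
    (hb : P.IsLocalBasis b) (x : X) (hx : x ∈ U) (h : σ.skewDim x = 1) :
    Nonempty (σ.SkewGenerator x) := by
  have h2' (W : X.Opens) : IsUnit (2 : Γ(X, W)) := by
    have := h2.map (secRes (le_top : W ≤ ⊤))
    rwa [map_ofNat] at this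
  obtain ⟨e, he⟩ := (h2' U).exists_right_inv
  obtain ⟨V, hV, m, hxV, hVaff, hm, hu, hgen⟩ := σ.exists_skew_generator hb he x hx h
  let B := (hb.res hV).endMat
  let τ : Matrix (Fin 2) (Fin 2) Γ(X, V) →ₗ[Γ(X, V)] Matrix (Fin 2) (Fin 2) Γ(X, V) :=
    B.toLinearMap ∘ₗ appₗ σ.hom V ∘ₗ B.symm.toLinearMap
  have hτ (a) : τ (B a) = B (σ.hom.app V a) := by
    change B (σ.hom.app V (B.symm (B a))) = _
    rw [AlgEquiv.symm_apply_apply]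
  obtain ⟨htr, d, hd, hmm⟩ := MatrixInvolution.exists_mul_self_eq_algebraMap τ
    (fun a ↦ by
      obtain ⟨a, rfl⟩ := B.surjective a
      rw [hτ, hτ, app_app])
    (fun a a' ↦ by
      obtain ⟨a, rfl⟩ := B.surjective a
      obtain ⟨a', rfl⟩ := B.surjective a'
      rw [← map_mul, hτ, hτ, hτ, σ.hom_app_mul, map_mul])
    (h2' V) (B m) (by rw [hτ, hm, map_neg]) hu
    (fun a ha ↦ by
      obtain ⟨a, rfl⟩ := B.surjective a
      rw [hτ, ← map_neg, B.injective.eq_iff] at ha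
      obtain ⟨c, hc⟩ := hgen V le_rfl a ha
      rw [res_self] at hc
      refine ⟨c, ?_⟩
      rw [hc]
      exact _root_.map_smul B c m)
  exact ⟨⟨V, hxV, hVaff, _, hb.res hV, m, hm, hgen, htr, d, hd, B.injective (by
    rw [map_mul, hmm, AlgEquiv.commutes])⟩⟩

end EndInvolution

end AlgebraicGeometry.Scheme.Modules

/-! ### Gluing the normalised generators to a global section of square one. -/

namespace AlgebraicGeometry.Scheme.Modules

variable {X : Scheme.{u}} {P : X.Modules} {U V : X.Opens}

lemma sheafEnd_res_algebraMap (h : V ≤ U) (r : Γ(X, U)) :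
    (sheafEnd P).res h (algebraMap _ _ r) = algebraMap _ _ (secRes h r) := by
  rw [Algebra.algebraMap_eq_smul_one, Algebra.algebraMap_eq_smul_one]
  exact (res_smul h r _).trans (congr_arg _ (sheafEnd_res_one h))

lemma IsLocalBasis.algebraMap_injective {ι : Type*} [Fintype ι] [DecidableEq ι] [Nonempty ι]
    {b : ι → Γ(P, U)} (hb : P.IsLocalBasis b) :
    Function.Injective (algebraMap Γ(X, U) Γ(sheafEnd P, U)) := fun r r' h ↦ by
  have h1 := congr_arg hb.endMat h
  rw [AlgEquiv.commutes, AlgEquiv.commutes] at h1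
  have i : ι := Classical.arbitrary ι
  have h2 := congr_fun (congr_fun h1 i) i
  rwa [Matrix.algebraMap_matrix_apply, Matrix.algebraMap_matrix_apply, if_pos rfl, if_pos rfl] at h2

namespace EndInvolution

variable {σ : P.EndInvolution}

lemma SkewGenerator.exists_secRes_smul (S : ∀ x, σ.SkewGenerator x) :
    ∃ g : ∀ x y, Γ(X, (S x).opens ⊓ (S y).opens), ∀ (x y : X) (W : X.Opens)
      (hx : W ≤ (S x).opens) (hy : W ≤ (S y).opens),
        (sheafEnd P).res hx (S x).gen = secRes (le_inf hx hy) (g x y) •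
          (sheafEnd P).res hy (S y).gen := by
  have h (x y : X) := (S y).exists_smul _ inf_le_right
    ((sheafEnd P).res (inf_le_left : (S x).opens ⊓ (S y).opens ≤ _) (S x).gen)
    (by rw [app_res, (S x).skew, map_neg])
  choose g hg using h
  refine ⟨g, fun x y W hx hy ↦ ?_⟩
  have h1 := congr_arg ((sheafEnd P).res (le_inf hx hy)) (hg x y)
  rw [res_res] at h1
  refine h1.trans ((res_smul _ _ _).trans ?_)
  rw [res_res]

lemma SkewGenerator.res_gen_mul_res_gen {x : X} (S : σ.SkewGenerator x) {W : X.Opens}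
    (h : W ≤ S.opens) : (sheafEnd P).res h S.gen * (sheafEnd P).res h S.gen =
      algebraMap _ _ (secRes h S.sq) := by
  rw [← sheafEnd_res_mul, S.gen_mul_gen, sheafEnd_res_algebraMap]

/-- Multiplying once more by the generator replaces it by the scalar `sq`, and scalars embed in
`End(P)` over an open with a basis. -/
lemma SkewGenerator.mul_sq_injective {x : X} (S : σ.SkewGenerator x) {W : X.Opens}
    (h : W ≤ S.opens) {r r' : Γ(X, W)}
    (e : r • (sheafEnd P).res h S.gen = r' • (sheafEnd P).res h S.gen) :
    r * secRes h S.sq = r' * secRes h S.sq := by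
  apply (S.isLocalBasis.res h).algebraMap_injective
  have h1 (r : Γ(X, W)) : algebraMap _ _ (r * secRes h S.sq) =
      (r • (sheafEnd P).res h S.gen) * (sheafEnd P).res h S.gen := by
    rw [map_mul, ← S.res_gen_mul_res_gen h, ← mul_assoc, ← Algebra.smul_def]
  rw [h1, h1, e]

lemma SkewGenerator.sq_eq_of_smul {x y : X} (S : σ.SkewGenerator x) (T : σ.SkewGenerator y)
    {W : X.Opens} (hx : W ≤ S.opens) (hy : W ≤ T.opens) {g : Γ(X, W)}
    (e : (sheafEnd P).res hx S.gen = g • (sheafEnd P).res hy T.gen) :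
    secRes hx S.sq = g * g * secRes hy T.sq := by
  apply (S.isLocalBasis.res hx).algebraMap_injective
  rw [← S.res_gen_mul_res_gen hx, e]
  have h1 := T.res_gen_mul_res_gen hy
  have h2 : g • (sheafEnd P).res hy T.gen = algebraMap _ _ g * (sheafEnd P).res hy T.gen :=
    Algebra.smul_def g ((sheafEnd P).res hy T.gen)
  rw [h2, map_mul, ← h1, map_mul]
  exact Commute.mul_mul_mul_comm (Algebra.commute_algebraMap_right g _) _ _

/-- An orthogonal involution on `End(P)` for `P` of rank two gives a traceless section of `End(P)`
of square one when `H¹_ét(X, ℤ/2) = 0`. -/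
theorem IsOrthogonal.exists_mul_self_eq_one (h2 : IsUnit (2 : Γ(X, ⊤)))
    (hX : Subsingleton (X.EtaleCohomology (AddCommGrpCat.of (ULift.{u} (ZMod 2))) 1))
    (hP : P.IsLocallyFreeOfRank 2) (hσ : σ.IsOrthogonal 2) :
    ∃ u : Γ(sheafEnd P, ⊤), u * u = 1 ∧ ∀ x : X, ∃ (V : X.Opens) (b : Fin 2 → Γ(P, V))
      (hb : P.IsLocalBasis b), x ∈ V ∧ (hb.endMat ((sheafEnd P).res le_top u)).trace = 0 := by
  have hS (x : X) : Nonempty (σ.SkewGenerator x) := by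
    obtain ⟨U, hx, hU⟩ := hP x
    obtain ⟨b, hb⟩ := (exists_isLocalBasis_iff 2).1 hU
    exact σ.nonempty_skewGenerator h2 hb x hx (hσ x)
  let S (x : X) : σ.SkewGenerator x := (hS x).some
  obtain ⟨g, hg⟩ := SkewGenerator.exists_secRes_smul S
  -- The chosen root `g x y * sq y` of `sq x * sq y` is the scalar `gen x * gen y`, since `gen x = g
  -- x y • gen y`. The relation on triples follows from the cocycle identity for `g`.
  obtain ⟨s, hs, hs'⟩ := exists_sqrt_sections h2 hX (fun x ↦ (S x).opens)
    (fun x ↦ (S x).isAffineOpen) (fun x ↦ ⟨x, (S x).mem⟩) (fun x ↦ (S x).sq)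
    (fun x ↦ (S x).isUnit_sq) (fun x y ↦ g x y * secRes inf_le_right (S y).sq)
    (fun x y ↦ by
      have h1 := (S x).sq_eq_of_smul (S y) inf_le_left inf_le_right
        (hg x y _ inf_le_left inf_le_right)
      rw [secRes_self] at h1
      rw [h1]
      ring)
    (fun x y z W hx hy hz ↦ by
      have h1 := (S z).mul_sq_injective hz
        (((hg x z W hx hz).symm.trans (hg x y W hx hy)).trans
          ((congr_arg _ (hg y z W hy hz)).trans (smul_smul _ _ _)))
      simp only [map_mul, secRes_secRes]
      linear_combination -secRes hy (S y).sq * h1)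
  choose c hc using fun x ↦ (S x).isUnit_sq.exists_right_inv
  -- As `c x = 1 / sq x` and `s x * s x = sq x`, the scalar `s x * c x` is `1 / s x`, so the local
  -- section is `gen x / s x`, of square one. From `s x * s y = g x y * sq y` follows `s x = g x y *
  -- s y`, which gives agreement on overlaps.
  obtain ⟨u, hu⟩ := exists_glue (M := sheafEnd P) (U := ⊤) (fun x ↦ (S x).opens)
    (fun _ ↦ le_top) (fun x _ ↦ ⟨x, (S x).mem⟩) (fun x ↦ (s x * c x) • (S x).gen) fun x y ↦ by
      have h1 := hs' x y
      have h3 := congr_arg (secRes (inf_le_left : (S x).opens ⊓ (S y).opens ≤ _)) (hs x)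
      have h4 := congr_arg (secRes (inf_le_left : (S x).opens ⊓ (S y).opens ≤ _)) (hc x)
      have h5 := congr_arg (secRes (inf_le_right : (S x).opens ⊓ (S y).opens ≤ _)) (hc y)
      have h6 := hg x y _ inf_le_left inf_le_right
      rw [secRes_self] at h6
      simp only [map_mul, map_one] at h3 h4 h5
      refine (res_smul _ _ _).trans (Eq.trans ?_ (res_smul _ _ _).symm)
      rw [h6]
      refine (smul_smul _ _ _).trans (congr_arg (· • _) ?_)
      rw [map_mul, map_mul]
      linear_combination -(secRes inf_le_left (s x) * secRes inf_le_left (c x) * g x y) * h5 -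
        secRes inf_le_left (s x) * secRes inf_le_left (c x) * secRes inf_le_right (c y) * h1 +
        secRes inf_le_left (c x) * secRes inf_le_right (c y) * secRes inf_le_right (s y) * h3 +
        secRes inf_le_right (c y) * secRes inf_le_right (s y) * h4
  refine ⟨u, eq_of_locally_eq fun x _ ↦ ⟨(S x).opens, le_top, (S x).mem, ?_⟩,
    fun x ↦ ⟨_, _, (S x).isLocalBasis, (S x).mem, ?_⟩⟩
  · rw [sheafEnd_res_mul, hu, sheafEnd_res_one]
    have h1 : (s x * c x) • (S x).gen = algebraMap _ _ (s x * c x) * (S x).gen :=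
      Algebra.smul_def _ _
    rw [h1, mul_assoc, ← mul_assoc (S x).gen, ← Algebra.commutes, mul_assoc, (S x).gen_mul_gen,
      ← map_mul, ← map_mul]
    refine Eq.trans (congr_arg _ ?_) (map_one _)
    linear_combination c x * c x * (S x).sq * hs x + (c x * (S x).sq + 1) * hc x
  · rw [hu]
    refine (congr_arg _ (_root_.map_smul (S x).isLocalBasis.endMat _ (S x).gen)).trans ?_
    rw [Matrix.trace_smul, (S x).trace_gen, smul_zero]

end EndInvolution

end AlgebraicGeometry.Scheme.Modules

/-! ### Splitting a rank-two module by idempotents of trace one. -/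

namespace AlgebraicGeometry.Scheme.Modules

variable {X : Scheme.{u}} {P : X.Modules} {U V : X.Opens}

/-- The endomorphism of `P` given by a global section of `End(P)`. -/
noncomputable def endHom (f : Γ(sheafEnd P, ⊤)) : P ⟶ P :=
  homMk (fun U ↦ endEval U ((sheafEnd P).res le_top f)) fun {U V} h s ↦ by
    rw [← endEval_res, res_res]

lemma endHom_app (f : Γ(sheafEnd P, ⊤)) (U : X.Opens) (s : Γ(P, U)) :
    (endHom f).app U s = endEval U ((sheafEnd P).res le_top f) s := rfl

lemma endHom_one : endHom (1 : Γ(sheafEnd P, ⊤)) = 𝟙 P :=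
  hom_ext_apply fun U s ↦ by
    rw [endHom_app, sheafEnd_res_one, map_one]
    rfl

lemma endHom_mul (f g : Γ(sheafEnd P, ⊤)) : endHom (f * g) = endHom g ≫ endHom f :=
  hom_ext_apply fun U s ↦ by
    rw [endHom_app, sheafEnd_res_mul, map_mul]
    rfl

lemma endHom_add (f g : Γ(sheafEnd P, ⊤)) : endHom (f + g) = endHom f + endHom g :=
  hom_ext_apply fun U s ↦ by
    rw [endHom_app, map_add, map_add]
    rfl

lemma endHom_zero : endHom (0 : Γ(sheafEnd P, ⊤)) = 0 :=
  hom_ext_apply fun U s ↦ by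
    rw [endHom_app, map_zero, map_zero]
    rfl

lemma IsLocalBasis.repr_endEval {ι : Type*} [Fintype ι] [DecidableEq ι] {b : ι → Γ(P, U)}
    (hb : P.IsLocalBasis b) (f : Γ(sheafEnd P, U)) (s : Γ(P, U)) (i : ι) :
    hb.basis.repr (endEval U f s) i = ∑ j, hb.endMat f i j * hb.basis.repr s j := by
  have h := LinearMap.toMatrix_mulVec_repr hb.basis hb.basis (endEval U f) s
  exact (congr_fun h i).symm

/-- The upper left entry of `A * A = A`, together with trace one, gives determinant zero, and each
of these identities is either trivial or this vanishing. -/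
lemma idempotent_entry_mul {R : Type*} [CommRing R] {A : Matrix (Fin 2) (Fin 2) R} (hA : A * A = A)
    (htr : A.trace = 1) (i j k : Fin 2) : A i j * A k k = A i k * A k j := by
  have h00 := congr_fun (congr_fun hA 0) 0
  have hdet : A 0 0 * A 1 1 = A 0 1 * A 1 0 := by
    rw [Matrix.trace_fin_two] at htr
    simp only [Matrix.mul_apply, Fin.sum_univ_two] at h00
    linear_combination A 0 0 * htr - h00
  fin_cases i <;> fin_cases j <;> fin_cases k <;> simp only [Fin.zero_eta, Fin.mk_one] <;>
    first | ring1 | linear_combination hdet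

/-- The diagonal entries of the matrix of `e` add up to one, so some `A k k` is a unit near `x`. By
the vanishing of the minors every column is a multiple of column `k`; hence `r (b k)` generates `L`.
Its coordinate `A k k` being a unit shows that it does so freely. -/
lemma isLocallyFreeOfRank_one_of_split {e : Γ(sheafEnd P, ⊤)} (he : e * e = e)
    (htr : ∀ x : X, ∃ (V : X.Opens) (b : Fin 2 → Γ(P, V)) (hb : P.IsLocalBasis b), x ∈ V ∧
      (hb.endMat ((sheafEnd P).res le_top e)).trace = 1)
    {L : X.Modules} (i : L ⟶ P) (r : P ⟶ L) (hir : i ≫ r = 𝟙 L) (hri : r ≫ i = endHom e) :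
    L.IsLocallyFreeOfRank 1 := by
  intro x
  obtain ⟨V, b, hb, hx, htr⟩ := htr x
  let A := hb.endMat ((sheafEnd P).res le_top e)
  have hA : A * A = A := by
    rw [← map_mul, ← sheafEnd_res_mul, he]
  have hri' (W : X.Opens) (s : Γ(P, W)) :
      i.app W (r.app W s) = endEval W ((sheafEnd P).res le_top e) s := by
    rw [← endHom_app, ← hri]
    rfl
  have hir' (W : X.Opens) (s : Γ(L, W)) : r.app W (i.app W s) = s :=
    congr_arg (fun φ ↦ Hom.app φ W s) hir
  obtain ⟨k, hk⟩ : ∃ k, x ∈ X.basicOpen (A k k) := by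
    by_contra! h
    rw [Matrix.trace_fin_two] at htr
    have h0 := h 0
    have h1 := h 1
    rw [X.mem_basicOpen _ x hx] at h0 h1
    have h2 := congr_arg (X.presheaf.germ V x hx).hom htr
    rw [map_add, map_one] at h2
    exact (IsLocalRing.isUnit_or_isUnit_of_add_one h2).elim h0 h1
  let W := X.basicOpen (A k k)
  have hW : W ≤ V := X.basicOpen_le _
  refine ⟨W, hk, (exists_isLocalBasis_iff 1).2 ⟨fun _ ↦ r.app W (P.res hW (b k)), ?_⟩⟩
  intro T hT
  have hTV := hT.trans hW
  let B := hb.res hTV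
  let A' := B.endMat ((sheafEnd P).res le_top e)
  have hA' : A' = A.map (secRes hTV) := by
    rw [← hb.endMat_res, res_res]
  have hunit : IsUnit (A' k k) := by
    rw [hA', Matrix.map_apply]
    have h1 := (RingedSpace.isUnit_res_basicOpen X.toRingedSpace (A k k)).map (secRes hT)
    rw [← secRes_secRes hW hT]
    exact h1
  obtain ⟨t, ht⟩ := hunit.exists_right_inv
  have hent (i j k : Fin 2) : A' i j * A' k k = A' i k * A' k j := by
    have := congr_arg (secRes hTV) (idempotent_entry_mul hA htr i j k)
    rw [hA']
    simpa only [map_mul, Matrix.map_apply] using this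
  have hcol (c : Fin 1 → Γ(X, T)) (j : Fin 2) : B.basis.repr
      (i.app T (∑ a, c a • L.res hT (r.app W (P.res hW (b k))))) j = c 0 * A' j k := by
    rw [Fin.sum_univ_one, Hom.app_smul, app_res, hri', ← endEval_res, res_res, res_res,
      _root_.map_smul, Finsupp.smul_apply, B.repr_endEval, smul_eq_mul]
    congr 1
    rw [Finset.sum_eq_single k, ← B.basis_apply, B.basis.repr_self]
    · simp [A']
    · intro l _ hl
      rw [← B.basis_apply, B.basis.repr_self, Finsupp.single_eq_of_ne hl, mul_zero]
    · simp
  refine ⟨fun c c' h ↦ funext fun a ↦ ?_, fun s ↦ ⟨fun _ ↦ B.basis.repr (i.app T s) k * t, ?_⟩⟩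
  · have h1 := congr_arg (fun s ↦ B.basis.repr (i.app T s) k) h
    simp only [hcol] at h1
    rw [Subsingleton.elim a 0]
    linear_combination t * h1 + (c' 0 - c 0) * ht
  · have hinj : Function.Injective (i.app T) := fun s s' h ↦ by
      rw [← hir' T s, h, hir']
    refine hinj (B.basis.repr.injective (Finsupp.ext fun j ↦ ?_))
    refine (hcol _ j).trans ?_
    have h1 (j) := B.repr_endEval ((sheafEnd P).res le_top e) (i.app T s) j
    rw [← hri', hir'] at h1
    have h2 : B.basis.repr (i.app T s) j * A' k k = A' j k * B.basis.repr (i.app T s) k := by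
      rw [h1 j, h1 k, Finset.sum_mul, Finset.mul_sum]
      refine Finset.sum_congr rfl fun a _ ↦ ?_
      linear_combination B.basis.repr (i.app T s) a * hent j a k
    linear_combination B.basis.repr (i.app T s) j * ht - t * h2

/-- The cross terms vanish because `i₁ ≫ r₂` factors through `e₁ ≫ e₂`, and `i₂ ≫ r₁` through `e₂ ≫
e₁`. -/
lemma nonempty_iso_biprod_of_split {C : Type*} [Category C] [Preadditive C] [HasBinaryBiproducts C]
    {A L₁ L₂ : C} {e₁ e₂ : A ⟶ A} (h : e₁ + e₂ = 𝟙 A) (h12 : e₁ ≫ e₂ = 0) (h21 : e₂ ≫ e₁ = 0)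
    {i₁ : L₁ ⟶ A} {r₁ : A ⟶ L₁} (hir₁ : i₁ ≫ r₁ = 𝟙 L₁) (hri₁ : r₁ ≫ i₁ = e₁)
    {i₂ : L₂ ⟶ A} {r₂ : A ⟶ L₂} (hir₂ : i₂ ≫ r₂ = 𝟙 L₂) (hri₂ : r₂ ≫ i₂ = e₂) :
    Nonempty (A ≅ L₁ ⊞ L₂) := by
  have h1 : i₁ ≫ r₂ = 0 := by
    have : i₁ ≫ r₂ = (i₁ ≫ r₁) ≫ i₁ ≫ r₂ ≫ (i₂ ≫ r₂) := by
      rw [hir₁, hir₂, Category.id_comp, Category.comp_id]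
    rw [this]
    have : (i₁ ≫ r₁) ≫ i₁ ≫ r₂ ≫ i₂ ≫ r₂ = i₁ ≫ ((r₁ ≫ i₁) ≫ (r₂ ≫ i₂)) ≫ r₂ := by
      simp only [Category.assoc]
    rw [this, hri₁, hri₂, h12, zero_comp, comp_zero]
  have h2 : i₂ ≫ r₁ = 0 := by
    have : i₂ ≫ r₁ = (i₂ ≫ r₂) ≫ i₂ ≫ r₁ ≫ (i₁ ≫ r₁) := by
      rw [hir₁, hir₂, Category.id_comp, Category.comp_id]
    rw [this]
    have : (i₂ ≫ r₂) ≫ i₂ ≫ r₁ ≫ i₁ ≫ r₁ = i₂ ≫ ((r₂ ≫ i₂) ≫ (r₁ ≫ i₁)) ≫ r₁ := by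
      simp only [Category.assoc]
    rw [this, hri₁, hri₂, h21, zero_comp, comp_zero]
  exact ⟨{
    hom := biprod.lift r₁ r₂
    inv := biprod.desc i₁ i₂
    hom_inv_id := by rw [biprod.lift_desc, hri₁, hri₂, h]
    inv_hom_id := by ext <;> simp [hir₁, hir₂, h1, h2] }⟩

/-- A traceless section of `End(P)` of square one splits `P` into two line bundles. -/
lemma exists_iso_biprod_of_mul_self_eq_one (h2 : IsUnit (2 : Γ(X, ⊤))) {u : Γ(sheafEnd P, ⊤)}
    (hu : u * u = 1) (htr : ∀ x : X, ∃ (V : X.Opens) (b : Fin 2 → Γ(P, V))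
      (hb : P.IsLocalBasis b), x ∈ V ∧ (hb.endMat ((sheafEnd P).res le_top u)).trace = 0) :
    ∃ L₁ L₂ : X.Modules, L₁.IsLocallyFreeOfRank 1 ∧ L₂.IsLocallyFreeOfRank 1 ∧
      Nonempty (P ≅ L₁ ⊞ L₂) := by
  obtain ⟨c, hc⟩ := h2.exists_right_inv
  let γ : Γ(sheafEnd P, ⊤) := algebraMap _ _ c
  have hγ (a : Γ(sheafEnd P, ⊤)) : γ * a = a * γ := Algebra.commutes c a
  have hγ2 : γ + γ = 1 := by
    rw [← map_add, ← two_mul, hc, map_one]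
  have key (w : Γ(sheafEnd P, ⊤)) (hw : w * w = 1) : γ * (1 + w) * (γ * (1 + w)) = γ * (1 + w) := by
    have : (1 + w) * (1 + w) = (1 + w) + (1 + w) := by
      rw [mul_add, mul_one, add_mul, one_mul, hw]
      abel
    rw [mul_assoc, ← mul_assoc (1 + w), ← hγ, mul_assoc γ (1 + w), this, mul_add γ (1 + w),
      ← add_mul, hγ2, one_mul]
  have ktr (w : Γ(sheafEnd P, ⊤)) (V : X.Opens) (b : Fin 2 → Γ(P, V)) (hb : P.IsLocalBasis b)
      (hw : (hb.endMat ((sheafEnd P).res le_top w)).trace = 0) :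
      (hb.endMat ((sheafEnd P).res le_top (γ * (1 + w)))).trace = 1 := by
    rw [sheafEnd_res_mul, sheafEnd_res_algebraMap, map_add, sheafEnd_res_one, map_mul, map_add,
      AlgEquiv.commutes, map_one, ← Algebra.smul_def, Matrix.trace_smul, Matrix.trace_add, hw,
      Matrix.trace_one]
    have := congr_arg (secRes (le_top : V ≤ ⊤)) hc
    rw [map_mul, map_ofNat, map_one] at this
    simpa [mul_comm] using this
  -- With `γ = 1/2` these are the projections onto the eigenspaces of `u` for `1` and `-1`. They
  -- have trace one because `tr 1 = 2` and `tr u = 0`.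
  let e₁ := γ * (1 + u)
  let e₂ := γ * (1 + -u)
  have he₁ : e₁ * e₁ = e₁ := key u hu
  have he₂ : e₂ * e₂ = e₂ := key (-u) (by rw [neg_mul_neg, hu])
  have hsum : e₁ + e₂ = 1 := by
    have : 1 + u + (1 + -u) = 1 + 1 := by abel
    rw [← mul_add, this, mul_add, mul_one, hγ2]
  have h12 : e₁ * e₂ = 0 := by
    have : e₁ * (e₁ + e₂) = e₁ := by rw [hsum, mul_one]
    rwa [mul_add, he₁, add_eq_left] at this
  have h21 : e₂ * e₁ = 0 := by
    have : e₂ * (e₁ + e₂) = e₂ := by rw [hsum, mul_one]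
    rwa [mul_add, he₂, add_eq_right] at this
  obtain ⟨L₁, i₁, r₁, hir₁, hri₁⟩ := IsIdempotentComplete.idempotents_split P (endHom e₁)
    (by rw [← endHom_mul, he₁])
  obtain ⟨L₂, i₂, r₂, hir₂, hri₂⟩ := IsIdempotentComplete.idempotents_split P (endHom e₂)
    (by rw [← endHom_mul, he₂])
  refine ⟨L₁, L₂, isLocallyFreeOfRank_one_of_split he₁ (fun x ↦ ?_) i₁ r₁ hir₁ hri₁,
    isLocallyFreeOfRank_one_of_split he₂ (fun x ↦ ?_) i₂ r₂ hir₂ hri₂,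
    nonempty_iso_biprod_of_split (e₁ := endHom e₁) (e₂ := endHom e₂) ?_ ?_ ?_ hir₁ hri₁ hir₂ hri₂⟩
  · obtain ⟨V, b, hb, hx, h⟩ := htr x
    exact ⟨V, b, hb, hx, ktr _ V b hb h⟩
  · obtain ⟨V, b, hb, hx, h⟩ := htr x
    refine ⟨V, b, hb, hx, ktr _ V b hb ?_⟩
    rw [map_neg, map_neg, Matrix.trace_neg, h, neg_zero]
  · rw [← endHom_add, hsum, endHom_one]
  · rw [← endHom_mul, h21, endHom_zero]
  · rw [← endHom_mul, h12, endHom_zero]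

end AlgebraicGeometry.Scheme.Modules

/-! ### The canonical symplectic involution in rank two. -/

namespace AlgebraicGeometry.Scheme.Modules

variable {X : Scheme.{u}} {P : X.Modules} {U V : X.Opens}

lemma IsLocalBasis.trace_endEval {b : Fin 2 → Γ(P, U)} (hb : P.IsLocalBasis b)
    (a : Γ(sheafEnd P, U)) : LinearMap.trace Γ(X, U) Γ(P, U) (endEval U a) =
      (hb.endMat a).trace :=
  LinearMap.trace_eq_matrix_trace _ hb.basis _

lemma IsLocalBasis.secRes_trace {b : Fin 2 → Γ(P, U)} (hb : P.IsLocalBasis b) (h : V ≤ U)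
    (a : Γ(sheafEnd P, U)) : secRes h (hb.endMat a).trace =
      ((hb.res h).endMat ((sheafEnd P).res h a)).trace := by
  rw [hb.endMat_res]
  exact map_sum (secRes h) _ _

lemma IsLocallyFreeOfRank.exists_le_isLocalBasis {n : ℕ} (hP : P.IsLocallyFreeOfRank n) {x : X}
    (hx : x ∈ U) : ∃ V ≤ U, x ∈ V ∧ ∃ b : Fin n → Γ(P, V), P.IsLocalBasis b := by
  obtain ⟨V, hxV, hV⟩ := hP x
  obtain ⟨b, hb⟩ := (exists_isLocalBasis_iff n).1 hV
  exact ⟨U ⊓ V, inf_le_left, ⟨hx, hxV⟩, _, hb.res inf_le_right⟩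

lemma IsLocallyFreeOfRank.sheafEnd_ext {n : ℕ} (hP : P.IsLocallyFreeOfRank n)
    {f g : Γ(sheafEnd P, U)} (h : ∀ (V : X.Opens) (hV : V ≤ U) (b : Fin n → Γ(P, V))
      (hb : P.IsLocalBasis b), hb.endMat ((sheafEnd P).res hV f) =
        hb.endMat ((sheafEnd P).res hV g)) : f = g :=
  eq_of_locally_eq fun _ hx ↦ by
    obtain ⟨V, hV, hxV, b, hb⟩ := hP.exists_le_isLocalBasis hx
    exact ⟨V, hV, hxV, hb.endMat.injective (h V hV b hb)⟩

/-- The trace of a local endomorphism of a module of rank two. -/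
lemma IsLocallyFreeOfRank.exists_trace (hP : P.IsLocallyFreeOfRank 2) (a : Γ(sheafEnd P, U)) :
    ∃ t : Γ(X, U), ∀ (V : X.Opens) (hV : V ≤ U) (b : Fin 2 → Γ(P, V)) (hb : P.IsLocalBasis b),
      secRes hV t = (hb.endMat ((sheafEnd P).res hV a)).trace := by
  -- The index only records that a basis exists: the trace of a linear map does not depend on it, so
  -- the local traces agree on overlaps.
  let κ := {V : X.Opens // V ≤ U ∧ ∃ b : Fin 2 → Γ(P, V), P.IsLocalBasis b}
  have hres (k : κ) (W : X.Opens) (hW : W ≤ k.1) :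
      secRes hW (LinearMap.trace Γ(X, k.1) Γ(P, k.1)
        (endEval k.1 ((sheafEnd P).res k.2.1 a))) =
      LinearMap.trace Γ(X, W) Γ(P, W) (endEval W ((sheafEnd P).res (hW.trans k.2.1) a)) := by
    obtain ⟨V, hV, b, hb⟩ := k
    rw [hb.trace_endEval, hb.secRes_trace hW, (hb.res hW).trace_endEval, res_res]
  obtain ⟨t, ht⟩ := exists_glue (M := unitMod X) (U := U) (fun k : κ ↦ k.1) (fun k ↦ k.2.1)
    (fun x hx ↦ by
      obtain ⟨V, hV, hxV, h⟩ := hP.exists_le_isLocalBasis hx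
      exact ⟨⟨V, hV, h⟩, hxV⟩)
    (fun k ↦ LinearMap.trace Γ(X, k.1) Γ(P, k.1) (endEval k.1 ((sheafEnd P).res k.2.1 a)))
    (fun k l ↦ (hres k _ inf_le_left).trans (hres l _ inf_le_right).symm)
  exact ⟨t, fun V hV b hb ↦ (ht ⟨V, hV, b, hb⟩).trans (hb.trace_endEval _)⟩

/-- The left side is visibly linear and makes sense globally; the right side is visibly
anti-multiplicative and of order two. Their equality, special to degree two, supplies all the axioms
of an involution. -/
lemma trace_smul_one_sub {R : Type*} [CommRing R] (A : Matrix (Fin 2) (Fin 2) R) :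
    A.trace • 1 - A = A.adjugate := by
  rw [Matrix.adjugate_fin_two, Matrix.trace_fin_two]
  ext i j
  fin_cases i <;> fin_cases j <;> simp

/-- The canonical symplectic involution of `End(P)` for `P` of rank two. -/
lemma IsLocallyFreeOfRank.exists_endInvolution (hP : P.IsLocallyFreeOfRank 2) :
    ∃ σ : P.EndInvolution, ∀ (V : X.Opens) (b : Fin 2 → Γ(P, V)) (hb : P.IsLocalBasis b)
      (a : Γ(sheafEnd P, V)), hb.endMat (σ.hom.app V a) = (hb.endMat a).adjugate := by
  choose t ht using fun (U : X.Opens) (a : Γ(sheafEnd P, U)) ↦ hP.exists_trace a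
  let f (U : X.Opens) (a : Γ(sheafEnd P, U)) : Γ(sheafEnd P, U) := algebraMap _ _ (t U a) - a
  have hf (U : X.Opens) (a : Γ(sheafEnd P, U)) (V : X.Opens) (hV : V ≤ U) (b : Fin 2 → Γ(P, V))
      (hb : P.IsLocalBasis b) : hb.endMat ((sheafEnd P).res hV (f U a)) =
        (hb.endMat ((sheafEnd P).res hV a)).trace • 1 - hb.endMat ((sheafEnd P).res hV a) := by
    rw [map_sub, map_sub, sheafEnd_res_algebraMap, ht U a V hV b hb, AlgEquiv.commutes,
      Algebra.algebraMap_eq_smul_one]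
  have hf' (U : X.Opens) (a : Γ(sheafEnd P, U)) (V : X.Opens) (hV : V ≤ U) (b : Fin 2 → Γ(P, V))
      (hb : P.IsLocalBasis b) : hb.endMat ((sheafEnd P).res hV (f U a)) =
        (hb.endMat ((sheafEnd P).res hV a)).adjugate := by
    rw [hf, trace_smul_one_sub]
  let φ : sheafEnd P ⟶ sheafEnd P := homMk
    (fun U ↦ {
      toFun := f U
      map_add' := fun a a' ↦ hP.sheafEnd_ext fun V hV b hb ↦ by
        rw [map_add, map_add, hf, hf, hf, map_add, map_add, Matrix.trace_add, add_smul]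
        abel
      map_smul' := fun r a ↦ hP.sheafEnd_ext fun V hV b hb ↦ by
        have h1 : hb.endMat ((sheafEnd P).res hV (r • a)) =
            secRes hV r • hb.endMat ((sheafEnd P).res hV a) := by
          rw [res_smul]
          exact _root_.map_smul hb.endMat _ _
        have h3 : hb.endMat ((sheafEnd P).res hV (r • f U a)) =
            secRes hV r • hb.endMat ((sheafEnd P).res hV (f U a)) := by
          rw [res_smul]
          exact _root_.map_smul hb.endMat _ _
        refine Eq.trans ?_ h3.symm
        rw [hf, hf, h1, Matrix.trace_smul, smul_sub, smul_assoc] })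
    (fun {U V} h a ↦ hP.sheafEnd_ext fun W hW b hb ↦ by
      refine (hf V _ W hW b hb).trans ?_
      rw [res_res, res_res]
      exact (hf U a W (hW.trans h) b hb).symm)
  have hφ (V : X.Opens) (b : Fin 2 → Γ(P, V)) (hb : P.IsLocalBasis b)
      (a : Γ(sheafEnd P, V)) : hb.endMat (φ.app V a) = (hb.endMat a).adjugate := by
    have := hf' V a V le_rfl b hb
    rwa [res_self, res_self] at this
  refine ⟨⟨φ, hom_ext_apply fun U a ↦ hP.sheafEnd_ext fun V hV b hb ↦ ?_,
    fun U a a' ↦ hP.sheafEnd_ext fun V hV b hb ↦ ?_⟩, hφ⟩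
  · change hb.endMat ((sheafEnd P).res hV (φ.app U (φ.app U a))) =
      hb.endMat ((sheafEnd P).res hV a)
    -- The double adjugate of an `n × n` matrix is `det ^ (n - 2)` times the matrix, and the
    -- exponent is zero for `n = 2`.
    rw [← app_res, ← app_res, hφ, hφ, Matrix.adjugate_adjugate _ (by simp)]
    simp
  · rw [sheafEnd_res_mul, ← app_res, ← app_res, ← app_res, hφ, sheafEnd_res_mul, map_mul, map_mul,
      hφ, hφ, Matrix.adjugate_mul_distrib]

/-- In the basis of matrix units `f` is `a ↦ tr(a) - 2 a`, the difference of the canonical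
involution and the identity. As 2 is invertible, its kernel is the line of scalars in a space of
dimension four. -/
lemma finrank_range_eq_three {K V : Type*} [Field K] (h2 : (2 : K) ≠ 0) [AddCommGroup V]
    [Module K V] (F : Module.Basis (Fin 2 × Fin 2) K V) (f : V →ₗ[K] V)
    (hf : ∀ p, f (F p) = (if p.1 = p.2 then F (0, 0) + F (1, 1) else 0) - (2 : K) • F p) :
    Module.finrank K (LinearMap.range f) = 3 := by
  have : Module.Finite K V := Module.Finite.of_basis F
  have h4 : Module.finrank K V = 4 := by
    rw [Module.finrank_eq_card_basis F]
    rfl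
  let v := F (0, 0) + F (1, 1)
  have hf' : f = (F.coord (0, 0) + F.coord (1, 1)).smulRight v - (2 : K) • LinearMap.id := by
    refine F.ext fun p ↦ ?_
    obtain ⟨i, j⟩ := p
    rw [hf]
    fin_cases i <;> fin_cases j <;> simp [v]
  have hv : v ≠ 0 := fun h ↦ by
    have := congr_arg (F.coord (0, 0)) h
    simp [v] at this
  have hker : LinearMap.ker f = K ∙ v := by
    ext w
    rw [LinearMap.mem_ker, Submodule.mem_span_singleton]
    constructor
    · intro h
      rw [hf'] at h
      refine ⟨2⁻¹ * (F.coord (0, 0) + F.coord (1, 1)) w, ?_⟩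
      have h1 : (F.coord (0, 0) + F.coord (1, 1)) w • v = (2 : K) • w := sub_eq_zero.1 h
      rw [mul_smul, h1, smul_smul, inv_mul_cancel₀ h2, one_smul]
    · rintro ⟨c, rfl⟩
      rw [_root_.map_smul, map_add, hf, hf]
      simp only [if_true]
      rw [show F (0, 0) + F (1, 1) - (2 : K) • F (0, 0) +
        (F (0, 0) + F (1, 1) - (2 : K) • F (1, 1)) = 0 by module, smul_zero]
  have h5 := LinearMap.finrank_range_add_finrank_ker f
  rw [hker, finrank_span_singleton hv, h4] at h5
  omega

lemma IsLocallyFreeOfRank.exists_isSymplectic (h2 : IsUnit (2 : Γ(X, ⊤)))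
    (hP : P.IsLocallyFreeOfRank 2) : ∃ σ : P.EndInvolution, σ.IsSymplectic 2 := by
  obtain ⟨σ, hσ⟩ := hP.exists_endInvolution
  refine ⟨σ, fun x ↦ ?_⟩
  obtain ⟨U, -, hx, b, hb⟩ := hP.exists_le_isLocalBasis (U := ⊤) (x := x) trivial
  have h2' : (2 : IsLocalRing.ResidueField (X.presheaf.stalk x)) ≠ 0 := by
    have := h2.map (secVal x (U := ⊤) trivial)
    rw [map_ofNat] at this
    exact this.ne_zero
  refine finrank_range_eq_three h2' (hb.isLocalBasis_single.fibreBasis x hx) _ fun p ↦ ?_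
  have hE (p) : hb.isLocalBasis_single.fibreBasis x hx p =
    (sheafEnd P).fibreVal x hx (hb.endMat.symm (Matrix.single p.1 p.2 1)) :=
    IsLocalBasis.fibreBasis_apply ..
  have hs : σ.hom.app U (hb.endMat.symm (Matrix.single p.1 p.2 1)) =
      (if p.1 = p.2 then hb.endMat.symm (Matrix.single 0 0 1) + hb.endMat.symm (Matrix.single 1 1 1)
        else 0) - hb.endMat.symm (Matrix.single p.1 p.2 1) := by
    apply hb.endMat.injective
    rw [hσ, AlgEquiv.apply_symm_apply, ← trace_smul_one_sub, map_sub, AlgEquiv.apply_symm_apply]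
    congr 1
    obtain ⟨i, j⟩ := p
    have h1 : (1 : Matrix (Fin 2) (Fin 2) Γ(X, U)) =
        Matrix.single 0 0 1 + Matrix.single 1 1 1 := by
      ext i j; fin_cases i <;> fin_cases j <;> simp
    by_cases hij : i = j
    · subst hij
      rw [if_pos rfl, map_add, AlgEquiv.apply_symm_apply, AlgEquiv.apply_symm_apply, h1,
        Matrix.trace_single_eq_same, one_smul]
    · rw [if_neg hij, map_zero, Matrix.trace_single_eq_of_ne _ _ _ hij, zero_smul]
  rw [LinearMap.sub_apply, hE, hE, hE, fibreMap_fibreVal, hs, map_sub]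
  split_ifs
  · rw [map_add, LinearMap.id_apply, two_smul, sub_sub]
  · rw [map_zero, LinearMap.id_apply, two_smul, sub_sub]

lemma isZero_of_isEmpty (M : X.Modules) [IsEmpty X] : IsZero M := by
  rw [IsZero.iff_id_eq_zero]
  exact hom_ext_apply fun U s ↦ eq_of_locally_eq fun x _ ↦ isEmptyElim x

lemma IsLocallyFreeOfRank.isEmpty_of_isZero {L : X.Modules} (hL : L.IsLocallyFreeOfRank 1)
    (h : IsZero L) : IsEmpty X := by
  refine ⟨fun x ↦ ?_⟩
  obtain ⟨U, -, hx, b, hb⟩ := hL.exists_le_isLocalBasis (U := ⊤) (x := x) trivial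
  have hs (s : Γ(L, U)) : s = 0 := congr_arg (fun φ ↦ Hom.app φ U s) (h.eq_of_src (𝟙 L) 0)
  have : Nonempty U := ⟨⟨x, hx⟩⟩
  have : Nontrivial Γ(X, U) := component_nontrivial _ _
  have h1 := (hb U le_rfl).1 (a₁ := fun _ ↦ 0) (a₂ := fun _ ↦ 1) ((hs _).trans (hs _).symm)
  exact zero_ne_one (congr_fun h1 0)

end AlgebraicGeometry.Scheme.Modules

/-! ### The theorem. -/

open AlgebraicGeometry.Scheme.Modules in
theorem mainTheorem11 (X : Scheme.{u}) (h2 : IsUnit (2 : Γ(X, ⊤)))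
    (hX : Subsingleton (X.EtaleCohomology (AddCommGrpCat.of (ULift.{u} (ZMod 2))) 1))
    (P : X.Modules) (hP : P.IsLocallyFreeOfRank 2) :
    ((∃ σ : P.EndInvolution, σ.IsOrthogonal 2) →
      ∃ L₁ L₂ : X.Modules, L₁.IsLocallyFreeOfRank 1 ∧ L₂.IsLocallyFreeOfRank 1 ∧
        Nonempty (P ≅ L₁ ⊞ L₂)) ∧
    (Indecomposable P →
      (∃ σ : P.EndInvolution, σ.IsSymplectic 2) ∧
        ¬ ∃ σ : P.EndInvolution, σ.IsOrthogonal 2) := by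
  have h1 : (∃ σ : P.EndInvolution, σ.IsOrthogonal 2) →
      ∃ L₁ L₂ : X.Modules, L₁.IsLocallyFreeOfRank 1 ∧ L₂.IsLocallyFreeOfRank 1 ∧
        Nonempty (P ≅ L₁ ⊞ L₂) := fun ⟨σ, hσ⟩ ↦ by
    obtain ⟨u, hu, htr⟩ := hσ.exists_mul_self_eq_one h2 hX hP
    exact exists_iso_biprod_of_mul_self_eq_one h2 hu htr
  refine ⟨h1, fun hind ↦ ⟨hP.exists_isSymplectic h2, fun h ↦ ?_⟩⟩
  obtain ⟨L₁, L₂, hL₁, hL₂, ⟨e⟩⟩ := h1 h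
  -- Indecomposability forces one of the two line bundles to be zero. This happens only over the
  -- empty scheme, where `P` would be zero too.
  have : IsEmpty X := (hind.2 L₁ L₂ e).elim hL₁.isEmpty_of_isZero hL₂.isEmpty_of_isZero
  exact hind.1 (isZero_of_isEmpty P)
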